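/- Let $\Theta=(\theta_i)_{i\ge 0}$ be a sequence in $\mathbb{R}^+=[0,\infty)$ with $\sum_{i\ge 0}\theta_i^2=1$ and $\theta_1\ge\theta_2\ge\cdots$. **The ICRT.** Let $(X_i)_{i\ge1}$ be independent exponential random variables of parameters $(\theta_i)_{i\ge1}$ (with $X_i=\infty$ if $\theta_i=0$), and let $\mu=\theta_0^2\,dx+\sum_{i\ge1}\theta_i\delta_{X_i}$, a random measure on $\mathbb{R}^+$. Given $(X_i)$, let $Y_1<Y_2<\cdots$ be the points of a Poisson point process on $\mathbb{R}^+$ of rate $\mu[0,l]\,dl$. Given $(X_i)$ and $(Y_i)$, let $(Z_i)_{i\ge1}$ be independent random variables, $Z_i$ having law $\mu(\cdot\cap[0,Y_i])/\mu[0,Y_i]$. Put $Y_0=Z_0=0$. Let $d$ be the metric on $\mathbb{R}^+$ obtained by gluing, successively for $i=0,1,2,\dots$, the segment $(Y_i,Y_{i+1}]$ at the position $Z_i$, that is, for all $x\le y$ with $Y_i<y\le Y_{i+1}$, $$d(x,y)=\begin{cases} d(x,Z_i)+y-Y_i & \text{if } x\le Y_i,\\ y-x & \text{if } x>Y_i.\end{cases}$$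 The $\Theta$-ICRT $\mathcal{T}$ is the completion of $(\mathbb{R}^+,d)$; this is well defined almost surely. **The Gaussian free field.** Let $B:\mathbb{R}^+\to\mathbb{R}$ be a standard Brownian motion independent of $(X_i),(Y_i),(Z_i)$. Define $G:\mathbb{R}^+\to\mathbb{R}$ inductively by $G(0)=0$ and, for every $i\ge0$ and $Y_i<x\le Y_{i+1}$, $$G(x)=G(Z_i)+B(x)-B(Y_i).$$ **Theorem.** If $$\int^\infty\frac{dl}{l\sqrt{\mathbb{E}[\mu[0,l]]}}<\infty,$$ then almost surely $G$ extends to a continuous function on $\mathcal{T}$. -/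

import Mathlib

open MeasureTheory ProbabilityTheory Set Filter Topology
open scoped NNReal ENNReal

noncomputable section

namespace ICRT

/-! ### Stick-breaking construction of a tree -/

/-- The input of the generic stick-breaking construction: cuts `y₁ < y₂ < ⋯` tending to infinity
and glue points `zᵢ ≤ yᵢ`. The term of index `i` of the Lean sequences is the one usually
numbered `i + 1`. -/
structure Sticks where
  y : ℕ → ℝ≥0
  z : ℕ → ℝ≥0
  y_strictMono : StrictMono y
  y_tendsto : Tendsto y atTop atTop
  z_le_y : ∀ i, z i ≤ y i

/-- Put a first term `0` in front of a sequence (the convention `y₀ = z₀ = 0`). -/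
def zeroCons (u : ℕ → ℝ≥0) : ℕ → ℝ≥0
  | 0 => 0
  | n + 1 => u n

namespace Sticks

variable (S : Sticks)

/-- The cuts `0 = y₀, y₁, y₂, …`. -/
def cut : ℕ → ℝ≥0 := zeroCons S.y

/-- The glue points `0 = z₀, z₁, z₂, …`. -/
def glue : ℕ → ℝ≥0 := zeroCons S.z

/-- The distances `dₙ`. Only the values on `[0, yₙ]` matter: the segment `(yₙ, yₙ₊₁]`
is glued on the position `zₙ` of `([0, yₙ], dₙ)`. -/
def distAux : ℕ → ℝ≥0 → ℝ≥0 → ℝ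
  | 0, _, _ => 0
  | n + 1, a, b =>
    if a ≤ S.cut n then
      if b ≤ S.cut n then distAux n a b
      else distAux n a (S.glue n) + ((b : ℝ) - S.cut n)
    else
      if b ≤ S.cut n then distAux n b (S.glue n) + ((a : ℝ) - S.cut n)
      else |(a : ℝ) - b|

/-- The least `n` with `x ≤ yₙ`. -/
def level (x : ℝ≥0) : ℕ := sInf {n | x ≤ S.cut n}

/-- The distance `d` on `ℝ⁺`, which agrees with `dₙ` on `[0, yₙ]` for every `n`
(see `lineDist_eq`). -/
def lineDist (a b : ℝ≥0) : ℝ := S.distAux (S.level (max a b)) a b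

/-- The function `G` on `[0, yₙ]` obtained from `b : ℝ⁺ → ℝ` by gluing increments. -/
def fieldAux (b : ℝ≥0 → ℝ) : ℕ → ℝ≥0 → ℝ
  | 0, _ => 0
  | n + 1, x => if x ≤ S.cut n then fieldAux b n x
      else fieldAux b n (S.glue n) + b x - b (S.cut n)

/-- The function `G` on `ℝ⁺` with `G 0 = 0` and `G x = G zᵢ + b x - b yᵢ` for every `i ≥ 0` and
`yᵢ < x ≤ yᵢ₊₁` (see `field_zero` and `field_eq`). -/
def field (b : ℝ≥0 → ℝ) (x : ℝ≥0) : ℝ := S.fieldAux b (S.level x) x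

lemma cut_mono : Monotone S.cut := by
  refine monotone_nat_of_le_succ fun n => ?_
  cases n with
  | zero => exact zero_le
  | succ n => exact S.y_strictMono.monotone (Nat.le_succ n)

lemma glue_le_cut (n : ℕ) : S.glue n ≤ S.cut n := by
  cases n with
  | zero => exact le_rfl
  | succ n => exact S.z_le_y n

lemma le_cut_level (x : ℝ≥0) : x ≤ S.cut (S.level x) := by
  have hne : {n | x ≤ S.cut n}.Nonempty := by
    obtain ⟨n, hn⟩ := (S.y_tendsto.eventually_ge_atTop x).exists
    exact ⟨n + 1, hn⟩
  exact Nat.sInf_mem hne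

lemma level_le {x : ℝ≥0} {n : ℕ} (h : x ≤ S.cut n) : S.level x ≤ n := Nat.sInf_le h

lemma distAux_self (n : ℕ) (a : ℝ≥0) : S.distAux n a a = 0 := by
  induction n with
  | zero => rfl
  | succ n ih => by_cases h : a ≤ S.cut n <;> simp [distAux, h, ih]

lemma distAux_comm (n : ℕ) (a b : ℝ≥0) : S.distAux n a b = S.distAux n b a := by
  induction n with
  | zero => rfl
  | succ n ih =>
    by_cases h : a ≤ S.cut n <;> by_cases h' : b ≤ S.cut n <;>
      simp [distAux, h, h', ih, abs_sub_comm]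

lemma distAux_triangle (n : ℕ) (a b c : ℝ≥0) :
    S.distAux n a c ≤ S.distAux n a b + S.distAux n b c := by
  induction n generalizing a b c with
  | zero => simp [distAux]
  | succ n ih =>
    have hab := abs_le.1 (le_refl |(a : ℝ) - b|)
    have hbc := abs_le.1 (le_refl |(b : ℝ) - c|)
    have h1 := ih a b c
    have h2 := ih a b (S.glue n)
    have h3 := ih c b (S.glue n)
    have h4 := ih a (S.glue n) c
    have h5 := ih b (S.glue n) b
    have e1 := S.distAux_comm n c b
    have e2 := S.distAux_comm n (S.glue n) c
    have e3 := S.distAux_comm n (S.glue n) b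
    have e4 := S.distAux_self n b
    have h6 := abs_sub_le (a : ℝ) b c
    by_cases ha : a ≤ S.cut n <;> by_cases hb : b ≤ S.cut n <;> by_cases hc : c ≤ S.cut n <;>
      simp only [distAux, ha, hb, hc, if_true, if_false] <;>
      (try simp only [not_le, ← NNReal.coe_lt_coe] at ha hb hc) <;>
      first
        | linarith
        | (refine abs_le.2 ⟨?_, ?_⟩ <;> linarith)

lemma distAux_nonneg (n : ℕ) (a b : ℝ≥0) : 0 ≤ S.distAux n a b := by
  have h := S.distAux_triangle n a b a
  rw [S.distAux_self, S.distAux_comm n b a] at h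
  linarith

lemma eq_of_distAux_eq_zero (n : ℕ) {a b : ℝ≥0} (ha : a ≤ S.cut n) (hb : b ≤ S.cut n)
    (h : S.distAux n a b = 0) : a = b := by
  induction n generalizing a b with
  | zero => exact (le_antisymm ha zero_le).trans (le_antisymm hb zero_le).symm
  | succ n ih =>
    have h1 := S.distAux_nonneg n a (S.glue n)
    have h2 := S.distAux_nonneg n b (S.glue n)
    by_cases ha' : a ≤ S.cut n <;> by_cases hb' : b ≤ S.cut n <;>
      simp only [distAux, ha', hb', if_true, if_false] at h
    · exact ih ha' hb' h
    · rw [not_le, ← NNReal.coe_lt_coe] at hb'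
      linarith
    · rw [not_le, ← NNReal.coe_lt_coe] at ha'
      linarith
    · exact NNReal.coe_injective (sub_eq_zero.1 (abs_eq_zero.1 h))

lemma distAux_stable {m n : ℕ} (hmn : m ≤ n) {a b : ℝ≥0} (ha : a ≤ S.cut m) (hb : b ≤ S.cut m) :
    S.distAux n a b = S.distAux m a b := by
  induction n, hmn using Nat.le_induction with
  | base => rfl
  | succ n hmn ih =>
    simp only [distAux, ha.trans (S.cut_mono hmn), hb.trans (S.cut_mono hmn), if_true, ih]

lemma lineDist_eq {n : ℕ} {a b : ℝ≥0} (ha : a ≤ S.cut n) (hb : b ≤ S.cut n) :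
    S.lineDist a b = S.distAux n a b :=
  (S.distAux_stable (S.level_le (max_le ha hb)) ((le_max_left a b).trans (S.le_cut_level _))
    ((le_max_right a b).trans (S.le_cut_level _))).symm

lemma fieldAux_stable (b : ℝ≥0 → ℝ) {m n : ℕ} (hmn : m ≤ n) {x : ℝ≥0} (hx : x ≤ S.cut m) :
    S.fieldAux b n x = S.fieldAux b m x := by
  induction n, hmn using Nat.le_induction with
  | base => rfl
  | succ n hmn ih => simp only [fieldAux, hx.trans (S.cut_mono hmn), if_true, ih]

lemma field_zero (b : ℝ≥0 → ℝ) : S.field b 0 = 0 := by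
  have h : S.level 0 = 0 := Nat.le_zero.1 (S.level_le (n := 0) zero_le)
  simp [field, h, fieldAux]

lemma field_eq (b : ℝ≥0 → ℝ) {n : ℕ} {x : ℝ≥0} (h : S.cut n < x) (h' : x ≤ S.cut (n + 1)) :
    S.field b x = S.field b (S.glue n) + b x - b (S.cut n) := by
  unfold field
  rw [← S.fieldAux_stable b (S.level_le h') (S.le_cut_level x),
    ← S.fieldAux_stable b (S.level_le (S.glue_le_cut n)) (S.le_cut_level (S.glue n))]
  simp [fieldAux, not_le.2 h]

lemma lineDist_comm (a b : ℝ≥0) : S.lineDist a b = S.lineDist b a := by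
  rw [lineDist, lineDist, max_comm, S.distAux_comm]

lemma lineDist_triangle (a b c : ℝ≥0) :
    S.lineDist a c ≤ S.lineDist a b + S.lineDist b c := by
  have h := S.le_cut_level (max a (max b c))
  have ha := (le_max_left _ _).trans h
  have hb := ((le_max_left _ _).trans (le_max_right _ _)).trans h
  have hc := ((le_max_right _ _).trans (le_max_right _ _)).trans h
  rw [S.lineDist_eq ha hc, S.lineDist_eq ha hb, S.lineDist_eq hb hc]
  exact S.distAux_triangle _ a b c

lemma eq_of_lineDist_eq_zero {a b : ℝ≥0} (h : S.lineDist a b = 0) : a = b :=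
  S.eq_of_distAux_eq_zero _ ((le_max_left a b).trans (S.le_cut_level _))
    ((le_max_right a b).trans (S.le_cut_level _)) h

/-- The half-line `ℝ⁺`, to be equipped with the distance `d`. -/
def Line (_S : Sticks) : Type := ℝ≥0

instance : MetricSpace S.Line where
  dist a b := S.lineDist a b
  dist_self a := S.distAux_self _ a
  dist_comm a b := S.lineDist_comm a b
  dist_triangle a b c := S.lineDist_triangle a b c
  eq_of_dist_eq_zero h := S.eq_of_lineDist_eq_zero h

/-- The tree `T`: the completion of `(ℝ⁺, d)`. -/
abbrev Tree : Type := UniformSpace.Completion S.Line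

/-- A point of `ℝ⁺` seen as a point of the tree. -/
def toTree (x : ℝ≥0) : S.Tree := UniformSpace.Completion.coe' (α := S.Line) x

end Sticks

/-! ### The random inputs -/

/-- The parameter space: nonnegative sequences `(θᵢ)_{i ≥ 0}` with `∑ θᵢ² = 1` and
`θ₁ ≥ θ₂ ≥ ⋯`. -/
structure IsParam (θ : ℕ → ℝ≥0) : Prop where
  hasSum_sq : HasSum (fun i => θ i ^ 2) 1
  antitone : Antitone fun i => θ (i + 1)

/-- Lebesgue measure on `ℝ⁺`. -/
def lebesgue : Measure ℝ≥0 := Measure.comap ((↑) : ℝ≥0 → ℝ) volume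

/-- The measure `μ = θ₀² dx + ∑_{i ≥ 1} θᵢ δ_{xᵢ}` on `ℝ⁺`; `x i` stands for `xᵢ₊₁`. -/
def massMeasure (θ x : ℕ → ℝ≥0) : Measure ℝ≥0 :=
  (θ 0 ^ 2) • lebesgue + Measure.sum fun i => θ (i + 1) • Measure.dirac (x i)

/-- The measure `μ[0,l] dl` on `ℝ⁺`. -/
def cutIntensity (μ : Measure ℝ≥0) : Measure ℝ≥0 :=
  lebesgue.withDensity fun l => μ (Iic l)

/-- The number of points of a sequence in a set. -/
def count (A : Set ℝ≥0) (y : ℕ → ℝ≥0) : ℕ∞ := {i | y i ∈ A}.encard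

/-- `ν` is the law of the points, in increasing order, of a Poisson point process on `ℝ⁺` with
(infinite, diffuse and locally finite) intensity measure `Λ`: the number of points in `A` is Poisson
of parameter `Λ A`, and the numbers of points in disjoint sets are independent. -/
structure IsPoissonLaw (Λ : Measure ℝ≥0) (ν : Measure (ℕ → ℝ≥0)) : Prop where
  strictMono : ∀ᵐ y ∂ν, StrictMono y
  hasLaw_count : ∀ A, MeasurableSet A → Λ A ≠ ∞ →
    HasLaw (count A) ((poissonMeasure (Λ A).toNNReal).map ((↑) : ℕ → ℕ∞)) ν
  indep_count : ∀ (n : ℕ) (A : Fin n → Set ℝ≥0), (∀ j, MeasurableSet (A j)) →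
    Pairwise (Function.onFun Disjoint A) → iIndepFun (fun j => count (A j)) ν

/-- `X`, `Y`, `Z` are the random sequences used in the construction of the `Θ`-ICRT (the terms of
index `i` are `Xᵢ₊₁`, `Yᵢ₊₁`, `Zᵢ₊₁`). An exponential variable of parameter `0` is `∞`, and the
corresponding atom of `μ` has mass `0`, so that no law is prescribed for it. -/
structure IsInput {Ω : Type*} [MeasurableSpace Ω] (P : Measure Ω) [IsProbabilityMeasure P]
    (θ : ℕ → ℝ≥0) (X Y Z : Ω → ℕ → ℝ≥0) : Prop where
  measurable_X : Measurable X
  measurable_Y : Measurable Y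
  measurable_Z : Measurable Z
  /-- The `Xᵢ` are independent. -/
  indep_X : iIndepFun (fun i ω => X ω i) P
  /-- `Xᵢ` is exponential of parameter `θᵢ`. -/
  law_X : ∀ i, 0 < θ (i + 1) → HasLaw (fun ω => (X ω i : ℝ)) (expMeasure (θ (i + 1))) P
  /-- Given `X`, the cuts form a Poisson point process of rate `μ[0,l] dl`. -/
  law_Y : ∀ᵐ ω ∂P,
    IsPoissonLaw (cutIntensity (massMeasure θ (X ω))) (condDistrib Y X P (X ω))
  /-- Given `X` and `Y`, the `Zᵢ` are independent, and `Zᵢ` has law `μ` restricted to `[0, Yᵢ]` and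
  normalized. -/
  law_Z : ∀ᵐ ω ∂P, condDistrib Z (fun ω => (X ω, Y ω)) P (X ω, Y ω) =
    Measure.infinitePi fun i => ProbabilityTheory.cond (massMeasure θ (X ω)) (Iic (Y ω i))

/-- `E[μ[0,l]]`. -/
def meanMass {Ω : Type*} [MeasurableSpace Ω] (P : Measure Ω) (θ : ℕ → ℝ≥0) (X : Ω → ℕ → ℝ≥0)
    (l : ℝ≥0) : ℝ≥0∞ :=
  ∫⁻ ω, massMeasure θ (X ω) (Iic l) ∂P

end ICRT

end

/-! Let l_k = 2^(2^k) (`scale`) and m_k = E[μ[0, l_k]]. Stopping the driving path at l_k gives a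
field that varies along finitely many sticks only, hence is uniformly continuous for `d`.
Consecutive stopped fields differ by at most the supremum over [0, l_{k+1}] of the field built from
the increments after l_k. If these suprema are summable, the field is a uniform limit of uniformly
continuous functions and extends to the completion (`Sticks.exists_continuous_extension`).

Up to a Brownian modulus of continuity on the mesh 1/l_{k+1}, the supremum runs over glue points and
mesh points (`Sticks.abs_field_after_le`), whose mean number is polynomial in l_k. Given the tree,
the value at a point is centred Gaussian, with variance the distance from the point to [0, l_k]
(`Sticks.lintegral_exp_field`). So it suffices to control exponential moments of these distances, at
the rate c = μ[0, l_k]/2.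

Past l_k the cuts arrive at rate at least 2c, so c times the length since the last cut has a bounded
exponential moment (`lintegral_ageWeight_le`). A new glue point falls either in the older tree or in
the newest stick; this multiplies the exponential moment by at most 1 plus an integral over that
stick (`expDistGlue_succ_le`). The product is at most exp(W_k), where W_k integrates against
dμ(x)/μ[0, x] and has mean of the order of log μ[0, l_{k+1}], that is, of 2^k
(`lintegral_logWeight_le`). By Chebyshev, μ[0, l_k] ≥ m_k/2 eventually, and then the supremum is of
order at most (W_k + 2^k)/√m_k, plus the modulus.

Condensing the integral twice gives ∑ 2^k/√m_k < ∞ (`IsInput.summable_scaleMean`), hence also ∑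
W_k/√m_k < ∞ almost surely. -/

noncomputable section

namespace ICRT

/-! ### The field as a function of its path -/

/-- The path `b` stopped at time `l`. -/
def stopAt (b : ℝ≥0 → ℝ) (l : ℝ≥0) : ℝ≥0 → ℝ := fun t => b (min t l)

/-- The path `b` with its values on `[0, l]` replaced by `0` and the same increments after `l`. -/
def after (b : ℝ≥0 → ℝ) (l : ℝ≥0) : ℝ≥0 → ℝ := fun t => b t - b (min t l)

lemma after_sub_after (b : ℝ≥0 → ℝ) (l s t : ℝ≥0) :
    after b l t - after b l s = b (max t l) - b (max s l) := by
  rcases le_total t l with h | h <;> rcases le_total s l with h' | h' <;> simp [after, h, h']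

/-- The unbundled form of `Sticks.fieldAux`. -/
def stickAux (y z : ℕ → ℝ≥0) (b : ℝ≥0 → ℝ) : ℕ → ℝ≥0 → ℝ
  | 0, _ => 0
  | n + 1, x => if x ≤ zeroCons y n then stickAux y z b n x
      else stickAux y z b n (zeroCons z n) + b x - b (zeroCons y n)

/-- The largest multiple of `2 ^ (-n)` that is at most `x`. -/
def dyadicFloor (n : ℕ) (x : ℝ≥0) : ℝ≥0 := ⌊2 ^ n * x⌋₊ / 2 ^ n

lemma dyadicFloor_le (n : ℕ) (x : ℝ≥0) : dyadicFloor n x ≤ x := by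
  rw [dyadicFloor, div_le_iff₀ (by positivity), mul_comm]
  exact Nat.floor_le zero_le

lemma dyadicFloor_mono (n : ℕ) : Monotone (dyadicFloor n) := fun a b h => by
  unfold dyadicFloor
  gcongr

lemma dyadicFloor_dyadicFloor (n : ℕ) (x : ℝ≥0) :
    dyadicFloor n (dyadicFloor n x) = dyadicFloor n x := by
  have h : (2 : ℝ≥0) ^ n * (⌊2 ^ n * x⌋₊ / 2 ^ n) = ⌊2 ^ n * x⌋₊ := by field_simp
  unfold dyadicFloor
  rw [h, Nat.floor_natCast]

/-- Both points lie in one dyadic cell, so each is compared with the common left endpoint. -/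
lemma abs_sub_le_of_dyadicFloor_le {b : ℝ≥0 → ℝ} {n : ℕ} {L : ℝ≥0} {ε : ℝ}
    (hb : ∀ u ≤ L, |b u - b (dyadicFloor n u)| ≤ ε) {u v : ℝ≥0} (hv : v ≤ L) (huv : u ≤ v)
    (h : dyadicFloor n v ≤ u) : |b v - b u| ≤ 2 * ε := by
  have e : dyadicFloor n u = dyadicFloor n v := by
    refine le_antisymm (dyadicFloor_mono n huv) ?_
    rw [← dyadicFloor_dyadicFloor]
    exact dyadicFloor_mono n h
  have h1 := hb v hv
  have h2 := hb u (huv.trans hv)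
  rw [e] at h2
  rw [abs_le] at *
  constructor <;> linarith

/-- The increment of `after b l` involves the pair `u`, `v` and the pair `min u l`, `min v l`; each
pair lies in a single dyadic cell and costs `2 * ε`. -/
lemma abs_after_sub_le {b : ℝ≥0 → ℝ} {n : ℕ} {L : ℝ≥0} {ε : ℝ}
    (hb : ∀ u ≤ L, |b u - b (dyadicFloor n u)| ≤ ε) {u v : ℝ≥0} (l : ℝ≥0) (hv : v ≤ L)
    (huv : u ≤ v) (h : dyadicFloor n v ≤ u) : |after b l v - after b l u| ≤ 4 * ε := by
  have h1 := abs_sub_le_of_dyadicFloor_le hb hv huv h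
  have h2 := abs_sub_le_of_dyadicFloor_le hb ((min_le_left v l).trans hv)
    (min_le_min_right l huv)
    (le_min ((dyadicFloor_mono n (min_le_left v l)).trans h)
      ((dyadicFloor_le n _).trans (min_le_right v l)))
  unfold after
  rw [abs_le] at *
  constructor <;> linarith

/-! ### The field on a fixed tree -/

namespace Sticks

variable (S : Sticks)

/-- The random sequences form a `Sticks` only almost surely, so measurability and integration in `y`
and `z` are carried out on raw sequences. -/
lemma fieldAux_eq_stickAux (b : ℝ≥0 → ℝ) (n : ℕ) (x : ℝ≥0) :
    S.fieldAux b n x = stickAux S.y S.z b n x := by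
  induction n generalizing x with
  | zero => rfl
  | succ n ih => simp only [fieldAux, stickAux, ih, cut, glue]

lemma field_eq_stickAux (b : ℝ≥0 → ℝ) {n : ℕ} {x : ℝ≥0} (h : x ≤ S.cut n) :
    S.field b x = stickAux S.y S.z b n x := by
  rw [← fieldAux_eq_stickAux, field, ← S.fieldAux_stable b (S.level_le h) (S.le_cut_level x)]

lemma eq_zero_or_exists_cut_lt (x : ℝ≥0) : x = 0 ∨ ∃ n, S.cut n < x ∧ x ≤ S.cut (n + 1) := by
  have h := S.le_cut_level x
  rcases hn : S.level x with _ | n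
  · rw [hn] at h
    exact Or.inl (le_antisymm h zero_le)
  · refine Or.inr ⟨n, ?_, hn ▸ h⟩
    by_contra! h'
    have := S.level_le h'
    omega

/-- Strong induction along the sticks. -/
lemma stick_induction {p : ℝ≥0 → Prop} (zero : p 0)
    (step : ∀ n x, S.cut n < x → x ≤ S.cut (n + 1) → p (S.glue n) → p x) (x : ℝ≥0) : p x := by
  suffices h : ∀ n, ∀ x ≤ S.cut n, p x from h _ x (S.le_cut_level x)
  intro n
  induction n with
  | zero =>
    intro x hx
    rwa [le_antisymm hx zero_le]
  | succ n ih =>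
    intro x hx
    rcases le_or_gt x (S.cut n) with h | h
    · exact ih x h
    · exact step n x h hx (ih _ (S.glue_le_cut n))

lemma field_sub (b c : ℝ≥0 → ℝ) (x : ℝ≥0) :
    S.field (fun t => b t - c t) x = S.field b x - S.field c x := by
  induction x using S.stick_induction with
  | zero => simp [field_zero]
  | step n x h h' ih =>
    rw [S.field_eq _ h h', S.field_eq _ h h', S.field_eq _ h h', ih]
    ring

lemma field_congr {b c : ℝ≥0 → ℝ} {L : ℝ≥0} (hbc : ∀ t ≤ L, b t = c t) {x : ℝ≥0} (hx : x ≤ L) :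
    S.field b x = S.field c x := by
  induction x using S.stick_induction with
  | zero => simp [field_zero]
  | step n x h h' ih =>
    rw [S.field_eq _ h h', S.field_eq _ h h', ih ((S.glue_le_cut n).trans (h.le.trans hx)),
      hbc x hx, hbc _ (h.le.trans hx)]

/-- Past `L` the path has no increments, so the value at a later point is copied from its glue
point, or from `L` itself when the stick straddles `L`. -/
lemma abs_field_le_of_eq {b : ℝ≥0 → ℝ} {L : ℝ≥0} {t : ℝ} (hb : ∀ s, L ≤ s → b s = b L)
    (h : ∀ x ≤ L, |S.field b x| ≤ t) (x : ℝ≥0) : |S.field b x| ≤ t := by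
  induction x using S.stick_induction with
  | zero => exact h 0 zero_le
  | step n x h1 h2 ih =>
    rcases le_or_gt x L with hx | hx
    · exact h x hx
    rcases le_or_gt L (S.cut n) with hL | hL
    · rw [S.field_eq _ h1 h2, hb x hx.le, hb _ hL]
      simpa using ih
    · rw [S.field_eq _ h1 h2, hb x hx.le, ← S.field_eq b hL (hx.le.trans h2)]
      exact h L le_rfl

lemma lineDist_of_le_of_lt {n : ℕ} {a b : ℝ≥0} (ha : a ≤ S.cut n) (hb : S.cut n < b)
    (hb' : b ≤ S.cut (n + 1)) :
    S.lineDist a b = S.lineDist a (S.glue n) + ((b : ℝ) - S.cut n) := by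
  rw [S.lineDist_eq (ha.trans (S.cut_mono n.le_succ)) hb', S.lineDist_eq ha (S.glue_le_cut n)]
  simp [distAux, ha, not_le.2 hb]

lemma lineDist_of_lt_of_lt {n : ℕ} {a b : ℝ≥0} (ha : S.cut n < a) (ha' : a ≤ S.cut (n + 1))
    (hb : S.cut n < b) (hb' : b ≤ S.cut (n + 1)) : S.lineDist a b = |(a : ℝ) - b| := by
  rw [S.lineDist_eq ha' hb']
  simp [distAux, not_le.2 ha, not_le.2 hb]

lemma lineDist_nonneg (a b : ℝ≥0) : 0 ≤ S.lineDist a b := S.distAux_nonneg _ a b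

/-- The field of a path that is eventually constant and continuous is uniformly continuous for the
distance `d`. -/
lemma exists_field_modulus {b : ℝ≥0 → ℝ} {L : ℝ≥0} (hc : Continuous b)
    (hb : ∀ s, L ≤ s → b s = b L) {ε : ℝ} (hε : 0 < ε) :
    ∃ δ > 0, ∀ x y, S.lineDist x y < δ → |S.field b x - S.field b y| < ε := by
  have huc : ∀ ε > 0, ∃ δ > 0, ∀ s t : ℝ≥0, |(s : ℝ) - t| < δ → |b s - b t| < ε := by
    have hu : UniformContinuousOn b (Icc 0 (L + 1)) :=
      isCompact_Icc.uniformContinuousOn_of_continuous hc.continuousOn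
    intro ε hε
    obtain ⟨δ, hδ, h⟩ := Metric.uniformContinuousOn_iff.1 hu ε hε
    refine ⟨δ, hδ, fun s t hst => ?_⟩
    have e : ∀ s, b s = b (min s L) := fun s => by
      rcases le_total s L with hs | hs
      · rw [min_eq_left hs]
      · rw [min_eq_right hs, hb s hs]
    rw [e s, e t]
    refine h _ ⟨zero_le, (min_le_right _ _).trans (by simp)⟩ _
      ⟨zero_le, (min_le_right _ _).trans (by simp)⟩ (lt_of_le_of_lt ?_ hst)
    rw [NNReal.dist_eq, NNReal.coe_min, NNReal.coe_min]
    exact abs_min_sub_min_le_max _ _ _ _ |>.trans (by simp)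
  -- moduli that may depend on the number of sticks
  have hn : ∀ n, ∀ ε > 0, ∃ δ > 0, ∀ x ≤ S.cut n, ∀ y ≤ S.cut n,
      S.lineDist x y < δ → |S.field b x - S.field b y| < ε := by
    intro n
    induction n with
    | zero =>
      intro ε hε
      refine ⟨1, one_pos, fun x hx y hy _ => ?_⟩
      rw [le_antisymm hx zero_le, le_antisymm hy zero_le]
      simpa using hε
    | succ n ih =>
      intro ε hε
      obtain ⟨δ₁, hδ₁, h₁⟩ := ih (ε / 2) (half_pos hε)
      obtain ⟨δ₂, hδ₂, h₂⟩ := huc (ε / 2) (half_pos hε)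
      -- From the older tree to the new stick, the distance is the sum of the distance to the glue
      -- point and the length along the stick; both are small.
      have key : ∀ x ≤ S.cut n, ∀ y, S.cut n < y → y ≤ S.cut (n + 1) →
          S.lineDist x y < min δ₁ δ₂ → |S.field b x - S.field b y| < ε := by
        intro x hx y hy hy' hxy
        rw [S.lineDist_of_le_of_lt hx hy hy'] at hxy
        have h3 : (0 : ℝ) < y - S.cut n := sub_pos.2 (by exact_mod_cast hy)
        have h4 := S.lineDist_nonneg x (S.glue n)
        have h5 := h₁ x hx _ (S.glue_le_cut n) (by linarith [min_le_left δ₁ δ₂])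
        have h6 := h₂ y (S.cut n) (by rw [abs_of_pos h3]; linarith [min_le_right δ₁ δ₂])
        rw [S.field_eq b hy hy']
        rw [abs_lt] at *
        constructor <;> linarith
      refine ⟨min δ₁ δ₂, lt_min hδ₁ hδ₂, fun x hx y hy hxy => ?_⟩
      rcases le_or_gt x (S.cut n) with hx' | hx' <;> rcases le_or_gt y (S.cut n) with hy' | hy'
      · exact (h₁ x hx' y hy' (hxy.trans_le (min_le_left _ _))).trans (half_lt_self hε)
      · exact key x hx' y hy' hy hxy
      · rw [abs_sub_comm]
        rw [S.lineDist_comm] at hxy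
        exact key y hy' x hx' hx hxy
      · rw [S.lineDist_of_lt_of_lt hx' hx hy' hy] at hxy
        have h6 := h₂ x y (hxy.trans_le (min_le_right _ _))
        rw [S.field_eq b hx' hx, S.field_eq b hy' hy]
        have e : S.field b (S.glue n) + b x - b (S.cut n)
          - (S.field b (S.glue n) + b y - b (S.cut n)) = b x - b y := by ring
        rw [e]
        exact h6.trans (half_lt_self hε)
  -- On sticks that start after `L` the field is constant, equal to its value at the glue point, and
  -- moving to the glue point only shortens distances. The modulus of the first `m` sticks therefore
  -- serves for all.
  obtain ⟨m, hm⟩ : ∃ m, L ≤ S.cut m := ⟨_, S.le_cut_level L⟩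
  obtain ⟨δ, hδ, h⟩ := hn m ε hε
  refine ⟨δ, hδ, ?_⟩
  suffices H : ∀ n, ∀ x ≤ S.cut (m + n), ∀ y ≤ S.cut (m + n),
      S.lineDist x y < δ → |S.field b x - S.field b y| < ε by
    intro x y
    have h0 := S.le_cut_level (max x y)
    have h1 := S.cut_mono (Nat.le_add_left (S.level (max x y)) m)
    exact H _ x ((le_max_left _ _).trans (h0.trans h1)) y ((le_max_right _ _).trans (h0.trans h1))
  intro n
  induction n with
  | zero => exact h
  | succ n ih =>
    have hL : L ≤ S.cut (m + n) := hm.trans (S.cut_mono (Nat.le_add_right m n))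
    have e : ∀ x, S.cut (m + n) < x → x ≤ S.cut (m + n + 1) →
        S.field b x = S.field b (S.glue (m + n)) := by
      intro x hx hx'
      rw [S.field_eq b hx hx', hb _ hL, hb x (hL.trans hx.le)]
      ring
    have key : ∀ x ≤ S.cut (m + n), ∀ y, S.cut (m + n) < y → y ≤ S.cut (m + n + 1) →
        S.lineDist x y < δ → |S.field b x - S.field b y| < ε := by
      intro x hx y hy hy' hxy
      rw [S.lineDist_of_le_of_lt hx hy hy'] at hxy
      have h3 : (0 : ℝ) < y - S.cut (m + n) := sub_pos.2 (by exact_mod_cast hy)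
      rw [e y hy hy']
      exact ih x hx _ (S.glue_le_cut _) (by linarith)
    intro x hx y hy hxy
    rcases le_or_gt x (S.cut (m + n)) with hx' | hx' <;>
      rcases le_or_gt y (S.cut (m + n)) with hy' | hy'
    · exact ih x hx' y hy' hxy
    · exact key x hx' y hy' hy hxy
    · rw [abs_sub_comm]
      rw [S.lineDist_comm] at hxy
      exact key y hy' x hx' hx hxy
    · rw [e x hx' hx, e y hy' hy]
      simpa using hε

/-- The field extends continuously to the tree as soon as its increments after the times `l k`
are uniformly small. -/
theorem exists_continuous_extension {b : ℝ≥0 → ℝ} (hb : Continuous b) {l : ℕ → ℝ≥0}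
    (hl : Monotone l) (hl' : Tendsto l atTop atTop) {τ : ℕ → ℝ} (hτ : Summable τ)
    (h : ∀ᶠ k in atTop, ∀ x ≤ l (k + 1), |S.field (after b (l k)) x| ≤ τ k) :
    ∃ f : S.Tree → ℝ, Continuous f ∧ ∀ x : ℝ≥0, f (S.toTree x) = S.field b x := by
  obtain ⟨K, hK⟩ := eventually_atTop.1 h
  have hstep : ∀ k ≥ K, ∀ x,
      |S.field (stopAt b (l (k + 1))) x - S.field (stopAt b (l k)) x| ≤ τ k := by
    intro k hk x
    have hlk := hl k.le_succ
    rw [← field_sub]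
    -- The difference of the two stopped paths is constant after `l (k + 1)` and equals `after b (l
    -- k)` before.
    refine S.abs_field_le_of_eq (L := l (k + 1)) (fun s hs => ?_) (fun x hx => ?_) x
    · simp [stopAt, hs, hlk, hlk.trans hs]
    · rw [S.field_congr (c := after b (l k)) (fun t ht => ?_) hx]
      · exact hK k hk x hx
      · simp [after, stopAt, ht]
  have htail : ∀ k ≥ K, ∀ x, |S.field b x - S.field (stopAt b (l k)) x| ≤ ∑' j, τ (j + k) := by
    intro k hk x
    have hτk : Summable fun j => τ (j + k) := (summable_nat_add_iff k).2 hτ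
    have h0 : ∀ j, 0 ≤ τ (j + k) := fun j =>
      (abs_nonneg _).trans (hstep (j + k) (by omega) 0)
    have hsum : ∀ n, |S.field (stopAt b (l (n + k))) x - S.field (stopAt b (l k)) x|
        ≤ ∑ j ∈ Finset.range n, τ (j + k) := by
      intro n
      induction n with
      | zero => simp
      | succ n ih =>
        rw [Finset.sum_range_succ]
        have h1 := hstep (n + k) (by omega) x
        rw [show n + 1 + k = n + k + 1 by ring]
        rw [abs_le] at *
        constructor <;> linarith
    obtain ⟨n, hn⟩ := (hl'.eventually_ge_atTop x).exists
    have e : S.field b x = S.field (stopAt b (l (n + k))) x :=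
      S.field_congr (L := x) (fun t ht => by
        simp [stopAt, ht.trans (hn.trans (hl (Nat.le_add_right n k)))]) le_rfl
    rw [e]
    exact (hsum n).trans (hτk.sum_le_tsum _ fun j _ => h0 j)
  have hu : UniformContinuous (fun x : S.Line => S.field b x) := by
    rw [Metric.uniformContinuous_iff]
    intro ε hε
    -- An ε/3 argument: two tails of the series and the modulus of the field stopped at `l k`.
    obtain ⟨k, hk, hkK⟩ := (((tendsto_sum_nat_add τ).eventually
      (gt_mem_nhds (show (0 : ℝ) < ε / 3 by positivity))).and (eventually_ge_atTop K)).exists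
    obtain ⟨δ, hδ, hm⟩ := S.exists_field_modulus (b := stopAt b (l k)) (L := l k)
      (hb.comp (continuous_id.min continuous_const)) (fun s hs => by simp [stopAt, hs])
      (show (0 : ℝ) < ε / 3 by positivity)
    refine ⟨δ, hδ, fun {x y} hxy => ?_⟩
    have h1 := hm x y hxy
    have h2 := htail k hkK x
    have h3 := htail k hkK y
    rw [Real.dist_eq]
    rw [abs_lt] at *
    rw [abs_le] at *
    constructor <;> linarith
  refine ⟨UniformSpace.Completion.extension fun x : S.Line => S.field b x,
    UniformSpace.Completion.continuous_extension, fun x => ?_⟩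
  exact UniformSpace.Completion.extension_coe hu x

/-- Reduction of the supremum of the field over `[0, L]` to glue points and dyadic points. -/
lemma abs_field_after_le {b : ℝ≥0 → ℝ} {n : ℕ} {l L : ℝ≥0} {ε t : ℝ} (ht : 0 ≤ t)
    (hb : ∀ u ≤ L, |b u - b (dyadicFloor n u)| ≤ ε)
    (hz : ∀ i, S.y i < L → |stickAux S.y S.z (after b l) (i + 1) (S.z i)| ≤ t)
    (hx : ∀ i m, S.cut m < dyadicFloor n i → dyadicFloor n i ≤ S.cut (m + 1) →
      dyadicFloor n i ≤ L → |stickAux S.y S.z (after b l) (m + 1) (dyadicFloor n i)| ≤ t)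
    {x : ℝ≥0} (hxL : x ≤ L) : |S.field (after b l) x| ≤ t + 4 * ε := by
  have hε : 0 ≤ ε := (abs_nonneg _).trans (hb x hxL)
  rcases S.eq_zero_or_exists_cut_lt x with rfl | ⟨m, hm, hm'⟩
  · simp only [field_zero, abs_zero]
    positivity
  have hd := dyadicFloor_le n x
  -- If the mesh point preceding `x` is not on its stick, then the start of the stick is within one
  -- mesh cell of `x`, and the glue point replaces the mesh point.
  rcases le_or_gt (dyadicFloor n x) (S.cut m) with h | h
  · have h1 := abs_after_sub_le hb l hxL hm.le h
    have h2 : |S.field (after b l) (S.glue m)| ≤ t := by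
      rcases m with _ | m
      · simpa [glue, zeroCons, field_zero] using ht
      · rw [S.field_eq_stickAux (n := m + 1) _ (S.glue_le_cut _)]
        exact hz m (hm.trans_le hxL)
    rw [S.field_eq _ hm hm']
    rw [abs_le] at *
    constructor <;> linarith
  · have h1 := abs_after_sub_le hb l hxL hd le_rfl
    have h2 := hx x m h (hd.trans hm') (hd.trans hxL)
    rw [← S.field_eq_stickAux _ (hd.trans hm'), S.field_eq _ h (hd.trans hm')] at h2
    rw [S.field_eq _ hm hm']
    rw [abs_le] at *
    constructor <;> linarith

end Sticks


/-! ### Brownian motion along the sticks -/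

section Brownian

variable {Ω : Type*} [MeasurableSpace Ω] {P : Measure Ω} {B : ℝ≥0 → Ω → ℝ}

lemma lintegral_exp_increment (hB : IsPreBrownianReal B P) (s : ℝ) {u t : ℝ≥0} (hut : u ≤ t) :
    ∫⁻ ω, ENNReal.ofReal (Real.exp (s * (B t ω - B u ω))) ∂P
      = ENNReal.ofReal (Real.exp (s ^ 2 / 2 * ((t : ℝ) - u))) := by
  have h := hB.hasLaw_sub t u
  have e := h.lintegral_comp (f := fun x => ENNReal.ofReal (Real.exp (s * x)))
    (by fun_prop)
  simp only [Pi.sub_apply] at e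
  rw [e, ← ofReal_integral_eq_lintegral_ofReal (integrable_exp_mul_gaussianReal s)
    (ae_of_all _ fun _ => (Real.exp_pos _).le)]
  have h2 := congrFun (mgf_id_gaussianReal (μ := 0) (v := nndist t.1 u.1)) s
  simp only [mgf, id] at h2
  rw [h2]
  congr 2
  rw [coe_nndist, Real.dist_eq, abs_of_nonneg (sub_nonneg.2 (by exact_mod_cast hut))]
  simp only [NNReal.val_eq_coe]
  ring

/-- The modulus of continuity used for Brownian motion on the mesh `2 ^ (-n)`. -/
def meshRate (n : ℕ) : ℝ := ((2 : ℝ) ^ (-(1 / 4) : ℝ)) ^ n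

lemma meshRate_pos (n : ℕ) : 0 < meshRate n := by unfold meshRate; positivity

lemma meshRate_pow_four (n : ℕ) : meshRate n ^ 4 = (2 ^ n)⁻¹ := by
  unfold meshRate
  rw [← pow_mul, mul_comm, pow_mul, ← Real.rpow_natCast (_ ^ _) 4, ← Real.rpow_mul (by norm_num)]
  norm_num
  rw [one_div, inv_pow]

lemma summable_meshRate : Summable meshRate := by
  refine summable_geometric_of_lt_one (by positivity) ?_
  exact Real.rpow_lt_one_of_one_lt_of_neg (by norm_num) (by norm_num)

/-- Chernoff's bound with parameter r⁻², where r = 2^(-n/4): the variance 2^(-n) = r⁴ makes the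
Laplace transform the constant exp(1/2), which leaves exp(-1/r) ≤ 12! r¹² = 12! 8^(-n). The power 12
is chosen so that 8^(-n) beats the 4^n increments of a union bound. -/
lemma measure_abs_increment_gt_le (hB : IsPreBrownianReal B P) (n : ℕ) {u t : ℝ≥0} (hut : u ≤ t)
    (h : (t : ℝ) - u = (2 ^ n)⁻¹) :
    P {ω | meshRate n < |B t ω - B u ω|}
      ≤ ENNReal.ofReal (2 * Real.exp (1 / 2) * Nat.factorial 12 * (1 / 8) ^ n) := by
  set r := meshRate n with hr
  have hr0 : 0 < r := meshRate_pos n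
  have hr4 : r ^ 4 = (2 ^ n)⁻¹ := meshRate_pow_four n
  have hs : ((r ^ 2)⁻¹) ^ 2 / 2 * ((t : ℝ) - u) = 1 / 2 := by
    rw [h, ← hr4]
    field_simp
  have one : ∀ σ : ℝ, σ ^ 2 = 1 → P {ω | r < σ * (B t ω - B u ω)}
      ≤ ENNReal.ofReal (Real.exp (1 / 2) * Real.exp (-r⁻¹)) := by
    intro σ hσ
    have h1 := lintegral_exp_increment hB ((r ^ 2)⁻¹ * σ) hut
    rw [mul_pow, hσ, mul_one, hs] at h1
    have h2 := mul_meas_ge_le_lintegral₀ (μ := P)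
      (f := fun ω => ENNReal.ofReal (Real.exp ((r ^ 2)⁻¹ * σ * (B t ω - B u ω))))
      (by have := hB.aemeasurable t; have := hB.aemeasurable u; fun_prop)
      (ENNReal.ofReal (Real.exp r⁻¹))
    rw [h1] at h2
    have h3 : P {ω | r < σ * (B t ω - B u ω)} ≤ P {ω | ENNReal.ofReal (Real.exp r⁻¹) ≤
        ENNReal.ofReal (Real.exp ((r ^ 2)⁻¹ * σ * (B t ω - B u ω)))} := by
      refine measure_mono fun ω hω => ?_
      simp only [mem_ofPred_eq] at hω ⊢
      refine ENNReal.ofReal_le_ofReal (Real.exp_le_exp.2 ?_)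
      have e : r⁻¹ = (r ^ 2)⁻¹ * r := by field_simp
      rw [e, mul_assoc]
      gcongr
    have h4 : ENNReal.ofReal (Real.exp (1 / 2) * Real.exp (-r⁻¹))
        = ENNReal.ofReal (Real.exp (1 / 2)) / ENNReal.ofReal (Real.exp r⁻¹) := by
      rw [← ENNReal.ofReal_div_of_pos (Real.exp_pos _), Real.exp_neg]
      rfl
    rw [h4, ENNReal.le_div_iff_mul_le (Or.inl (by simp [Real.exp_pos])) (Or.inl (by simp)),
      mul_comm]
    exact (mul_le_mul_right h3 _).trans h2
  have hsub : {ω | r < |B t ω - B u ω|}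
      ⊆ {ω | r < 1 * (B t ω - B u ω)} ∪ {ω | r < (-1) * (B t ω - B u ω)} := by
    intro ω hω
    simp only [mem_ofPred_eq, lt_abs, mem_union] at hω ⊢
    simpa using hω
  have hexp : Real.exp (-r⁻¹) ≤ Nat.factorial 12 * (1 / 8) ^ n := by
    have h5 := Real.pow_div_factorial_le_exp r⁻¹ (by positivity) 12
    have e8 : (r⁻¹) ^ 12 = 8 ^ n := by
      rw [inv_pow, show (12 : ℕ) = 4 * 3 by norm_num, pow_mul, hr4, inv_pow, inv_inv, ← pow_mul,
        mul_comm, pow_mul]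
      norm_num
    rw [e8] at h5
    rw [Real.exp_neg, inv_le_comm₀ (Real.exp_pos _) (by positivity)]
    refine le_trans (le_of_eq ?_) h5
    rw [mul_inv, one_div, inv_pow, inv_inv]
    ring
  calc P {ω | r < |B t ω - B u ω|}
      ≤ P {ω | r < 1 * (B t ω - B u ω)} + P {ω | r < (-1) * (B t ω - B u ω)} :=
        (measure_mono hsub).trans (measure_union_le _ _)
    _ ≤ ENNReal.ofReal (Real.exp (1 / 2) * Real.exp (-r⁻¹))
        + ENNReal.ofReal (Real.exp (1 / 2) * Real.exp (-r⁻¹)) :=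
        add_le_add (one 1 (by norm_num)) (one (-1) (by norm_num))
    _ ≤ _ := by
        rw [← ENNReal.ofReal_add (by positivity) (by positivity)]
        refine ENNReal.ofReal_le_ofReal ?_
        have := mul_le_mul_of_nonneg_left hexp (Real.exp_pos (1 / 2)).le
        linarith

/-- Borel-Cantelli: the 4^n mesh intervals cover [0, 2^n], and 4^n · 8^(-n) = 2^(-n) is summable. -/
lemma ae_eventually_abs_increment_le (hB : IsPreBrownianReal B P) :
    ∀ᵐ ω ∂P, ∀ᶠ n : ℕ in atTop, ∀ j : ℕ, j < 4 ^ n →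
      |B ((j + 1 : ℕ) / 2 ^ n) ω - B (j / 2 ^ n) ω| ≤ meshRate n := by
  set C : ℝ := 2 * Real.exp (1 / 2) * Nat.factorial 12
  have hle : ∀ n : ℕ, P (⋃ j ∈ Finset.range (4 ^ n),
      {ω | meshRate n < |B ((j + 1 : ℕ) / 2 ^ n) ω - B (j / 2 ^ n) ω|})
      ≤ ENNReal.ofReal (C * (1 / 2) ^ n) := by
    intro n
    refine (measure_biUnion_finset_le _ _).trans ?_
    refine (Finset.sum_le_sum fun (j : ℕ) _ => measure_abs_increment_gt_le hB n (u := j / 2 ^ n)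
      (t := (j + 1 : ℕ) / 2 ^ n) ?_ ?_).trans ?_
    · gcongr
      simp
    · push_cast
      field_simp
      ring
    · rw [Finset.sum_const, Finset.card_range, nsmul_eq_mul, ← ENNReal.ofReal_natCast,
        ← ENNReal.ofReal_mul (by positivity)]
      refine ENNReal.ofReal_le_ofReal (le_of_eq ?_)
      rw [show (1 / 2 : ℝ) ^ n = 4 ^ n * (1 / 8) ^ n by rw [← mul_pow]; norm_num]
      push_cast
      ring
  have hsum : ∑' n : ℕ, P (⋃ j ∈ Finset.range (4 ^ n),
      {ω | meshRate n < |B ((j + 1 : ℕ) / 2 ^ n) ω - B (j / 2 ^ n) ω|}) ≠ ∞ := by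
    refine ne_top_of_le_ne_top ?_ (ENNReal.tsum_le_tsum hle)
    exact ((summable_geometric_of_lt_one (by norm_num) (by norm_num)).mul_left C).tsum_ofReal_ne_top
  filter_upwards [ae_eventually_notMem hsum] with ω hω
  filter_upwards [hω] with n hn j hj
  simp only [Finset.mem_range, mem_iUnion, not_exists, mem_ofPred_eq, not_lt] at hn
  exact hn j hj

lemma tendsto_dyadicFloor (x : ℝ≥0) : Tendsto (fun n => dyadicFloor n x) atTop (𝓝 x) := by
  have h : Tendsto (fun n : ℕ => (x : ℝ) - (1 / 2) ^ n) atTop (𝓝 (x : ℝ)) := by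
    simpa using (tendsto_pow_atTop_nhds_zero_of_lt_one (by norm_num : (0 : ℝ) ≤ 1 / 2)
      (by norm_num)).const_sub (x : ℝ)
  rw [← NNReal.tendsto_coe]
  refine tendsto_of_tendsto_of_tendsto_of_le_of_le h tendsto_const_nhds (fun n => ?_) fun n =>
    NNReal.coe_le_coe.2 (dyadicFloor_le n x)
  have h1 := (Nat.lt_floor_add_one (2 ^ n * x)).le
  have h2 : (2 : ℝ) ^ n * x ≤ (⌊2 ^ n * x⌋₊ : ℝ) + 1 := by exact_mod_cast h1
  simp only [dyadicFloor, NNReal.coe_div, NNReal.coe_natCast, NNReal.coe_pow, NNReal.coe_ofNat]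
  rw [le_div_iff₀ (by positivity), sub_mul, ← mul_pow]
  norm_num
  linarith

/-- Chaining over the dyadic meshes. -/
lemma abs_sub_dyadicFloor_le {b : ℝ≥0 → ℝ} (hb : Continuous b) {n : ℕ}
    (h : ∀ m ≥ n, ∀ j : ℕ, j < 4 ^ m → |b ((j + 1 : ℕ) / 2 ^ m) - b (j / 2 ^ m)| ≤ meshRate m)
    {u : ℝ≥0} (hu : u ≤ 2 ^ n) : |b u - b (dyadicFloor n u)| ≤ ∑' m, meshRate (m + n) := by
  have hsum : Summable fun m => meshRate (m + n) := (summable_nat_add_iff n).2 summable_meshRate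
  have hstep : ∀ m ≥ n, |b (dyadicFloor (m + 1) u) - b (dyadicFloor m u)| ≤ meshRate (m + 1) := by
    intro m hm
    set j := ⌊2 ^ m * u⌋₊ with hj
    have hj1 : (j : ℝ≥0) ≤ 2 ^ m * u := Nat.floor_le zero_le
    have hj2 : 2 ^ m * u < j + 1 := Nat.lt_floor_add_one _
    have e0 : dyadicFloor m u = (2 * j : ℕ) / 2 ^ (m + 1) := by
      rw [dyadicFloor, ← hj]
      push_cast
      field_simp
      ring
    have hj3 : 2 * j < 4 ^ (m + 1) := by
      have h1 : (j : ℝ≥0) ≤ 4 ^ m := by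
        calc (j : ℝ≥0) ≤ 2 ^ m * u := hj1
          _ ≤ 2 ^ m * 2 ^ m := by
            gcongr
            exact hu.trans (pow_le_pow_right₀ (by norm_num) hm)
          _ = 4 ^ m := by rw [← mul_pow]; norm_num
      have h2 : j ≤ 4 ^ m := by exact_mod_cast h1
      have h3 : 0 < 4 ^ m := by positivity
      rw [pow_succ]
      omega
    have hlo : 2 * j ≤ ⌊2 ^ (m + 1) * u⌋₊ := by
      refine Nat.le_floor ?_
      push_cast
      rw [pow_succ, mul_comm _ (2 : ℝ≥0), mul_assoc]
      gcongr
    have hhi : ⌊2 ^ (m + 1) * u⌋₊ < 2 * j + 2 := by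
      rw [Nat.floor_lt zero_le]
      push_cast
      rw [pow_succ, mul_comm _ (2 : ℝ≥0), mul_assoc, ← mul_add_one]
      gcongr
    have e1 : dyadicFloor (m + 1) u = (⌊2 ^ (m + 1) * u⌋₊ : ℕ) / 2 ^ (m + 1) := rfl
    -- Refining the mesh once either keeps the dyadic floor or moves it to the next point, at the
    -- cost of a single increment.
    rcases (by omega : ⌊2 ^ (m + 1) * u⌋₊ = 2 * j ∨ ⌊2 ^ (m + 1) * u⌋₊ = 2 * j + 1)
      with h' | h'
    · rw [e1, e0, h', sub_self, abs_zero]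
      exact (meshRate_pos _).le
    · rw [e1, e0, h']
      exact h (m + 1) (by omega) (2 * j) hj3
  have hpart : ∀ k, |b (dyadicFloor (n + k) u) - b (dyadicFloor n u)|
      ≤ ∑ m ∈ Finset.range (k + 1), meshRate (m + n) := by
    intro k
    induction k with
    | zero => simpa using (meshRate_pos n).le
    | succ k ih =>
      rw [Finset.sum_range_succ]
      have h1 := hstep (n + k) (by omega)
      rw [show k + 1 + n = n + k + 1 by ring, ← add_assoc]
      rw [abs_le] at *
      constructor <;> linarith
  have hlim : Tendsto (fun k => |b (dyadicFloor (n + k) u) - b (dyadicFloor n u)|) atTop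
      (𝓝 |b u - b (dyadicFloor n u)|) := by
    have h1 := (tendsto_dyadicFloor u).comp (tendsto_add_atTop_nat n)
    simp_rw [Function.comp_def, add_comm _ n] at h1
    exact (((hb.tendsto u).comp h1).sub_const _).abs
  exact le_of_tendsto' hlim fun k =>
    (hpart k).trans (hsum.sum_le_tsum _ fun j _ => (meshRate_pos _).le)

lemma tsum_meshRate_add (n : ℕ) : ∑' m, meshRate (m + n) = (∑' m, meshRate m) * meshRate n := by
  rw [← tsum_mul_right]
  exact tsum_congr fun m => pow_add _ _ _

/-- A modulus of continuity for Brownian motion on the dyadic meshes of growing intervals. -/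
lemma exists_ae_dyadic_modulus (hB : IsBrownianReal B P) :
    ∃ ε : ℕ → ℝ, Summable ε ∧ ∀ᵐ ω ∂P, ∀ᶠ n : ℕ in atTop, ∀ u ≤ (2 : ℝ≥0) ^ n,
      |B u ω - B (dyadicFloor n u) ω| ≤ ε n := by
  refine ⟨fun n => ∑' m, meshRate (m + n), ?_, ?_⟩
  · simp_rw [tsum_meshRate_add]
    exact summable_meshRate.mul_left _
  filter_upwards [hB.cont, ae_eventually_abs_increment_le hB.toIsPreBrownianReal] with ω hc hω
  obtain ⟨N, hN⟩ := eventually_atTop.1 hω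
  exact eventually_atTop.2 ⟨N, fun n hn u hu =>
    abs_sub_dyadicFloor_le hc (fun m hm => hN m (hn.trans hm)) hu⟩

/-! ### Gaussian exponential moments of the field on a fixed tree -/

namespace Sticks

variable (S : Sticks)

lemma measurable_field (x : ℝ≥0) : Measurable fun b : ℝ≥0 → ℝ => S.field b x := by
  induction x using S.stick_induction with
  | zero => simp [field_zero]
  | step n x h h' ih =>
    simp_rw [S.field_eq _ h h']
    fun_prop

lemma measurable_field_after (l x : ℝ≥0) :
    Measurable fun b : ℝ≥0 → ℝ => S.field (after b l) x :=
  (S.measurable_field x).comp (by unfold after; fun_prop)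

lemma aemeasurable_field_after (hB : IsPreBrownianReal B P) (l x : ℝ≥0) :
    AEMeasurable (fun ω => S.field (after (fun t => B t ω) l) x) P := by
  have := hB.aemeasurable
  induction x using S.stick_induction with
  | zero => simp [field_zero]
  | step n x h h' ih =>
    simp_rw [S.field_eq _ h h']
    unfold after
    exact (ih.add ((this _).sub (this _))).sub ((this _).sub (this _))

lemma field_eq_add_increment (b : ℝ≥0 → ℝ) (l : ℝ≥0) {n : ℕ} {x : ℝ≥0} (h : S.cut n < x)
    (h' : x ≤ S.cut (n + 1)) : S.field (after b l) x
      = S.field (after b l) (S.glue n) + (b (max x l) - b (max (S.cut n) l)) := by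
  rw [S.field_eq _ h h', ← after_sub_after]
  ring

/-- The field at `x` reads the path on `[0, T]` only, so it is a measurable function of the
restricted path, which is independent of the increments after `T`. -/
lemma indepFun_field_increment (hB : IsPreBrownianReal B P) {l x T t : ℝ≥0} (hl : l ≤ T)
    (hx : x ≤ T) (ht : T ≤ t) :
    IndepFun (fun ω => S.field (after (fun t => B t ω) l) x) (fun ω => B t ω - B T ω) P := by
  have h := (hB.indepFun_shift T).symm
  have hψ : Measurable fun w : ℝ≥0 → ℝ => w (t - T) := measurable_pi_apply (t - T)
  have h1 := h.comp (φ := fun w : Iic T → ℝ =>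
      S.field (after (fun s => w ⟨min s T, min_le_right s T⟩) l) x)
    (ψ := fun w : ℝ≥0 → ℝ => w (t - T))
    ((S.measurable_field_after l x).comp (measurable_pi_lambda _ fun s => measurable_pi_apply _))
    hψ
  convert h1 using 1
  · funext ω
    refine S.field_congr (fun s hs => ?_) hx
    simp [after, hs, (min_le_right s l).trans hl]
  · funext ω
    simp [ht]

/-- On a fixed tree the field is a sum of independent Gaussian increments along the branch to `x`.
Its variance obeys the same gluing recursion driven by the identity path: it is the length of the
branch that lies after time `l`. -/
lemma lintegral_exp_field (hB : IsPreBrownianReal B P) (s : ℝ) (l x : ℝ≥0) :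
    ∫⁻ ω, ENNReal.ofReal (Real.exp (s * S.field (after (fun t => B t ω) l) x)) ∂P
      = ENNReal.ofReal (Real.exp (s ^ 2 / 2 * S.field (after (fun t => (t : ℝ)) l) x)) := by
  have := hB.isGaussianProcess.isProbabilityMeasure
  induction x using S.stick_induction with
  | zero => simp [field_zero]
  | step n x h h' ih =>
    have hmax : max (S.cut n) l ≤ max x l := max_le_max_right l h.le
    simp_rw [S.field_eq_add_increment _ l h h', mul_add, Real.exp_add,
      ENNReal.ofReal_mul (Real.exp_pos _).le]
    rw [lintegral_mul_eq_lintegral_mul_lintegral_of_indepFun'', ih,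
      lintegral_exp_increment hB s hmax]
    · exact ((S.aemeasurable_field_after hB l _).const_mul s).exp.ennreal_ofReal
    · exact (((hB.aemeasurable _).sub (hB.aemeasurable _)).const_mul s).exp.ennreal_ofReal
    · exact (S.indepFun_field_increment hB (le_max_right _ _)
        ((S.glue_le_cut n).trans (le_max_left _ _)) hmax).comp
        (φ := fun u => ENNReal.ofReal (Real.exp (s * u)))
        (ψ := fun u => ENNReal.ofReal (Real.exp (s * u))) (by fun_prop) (by fun_prop)

lemma lintegral_exp_abs_field_le (hB : IsPreBrownianReal B P) (s : ℝ) (l x : ℝ≥0) :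
    ∫⁻ ω, ENNReal.ofReal (Real.exp (s * |S.field (after (fun t => B t ω) l) x|)) ∂P
      ≤ 2 * ENNReal.ofReal (Real.exp (s ^ 2 / 2 * S.field (after (fun t => (t : ℝ)) l) x)) := by
  have h1 := S.lintegral_exp_field hB s l x
  have h2 := S.lintegral_exp_field hB (-s) l x
  rw [neg_sq] at h2
  rw [two_mul]
  nth_rw 1 [← h1]
  rw [← h2, ← lintegral_add_left']
  · refine lintegral_mono fun ω => ?_
    rw [← ENNReal.ofReal_add (Real.exp_pos _).le (Real.exp_pos _).le]
    refine ENNReal.ofReal_le_ofReal ?_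
    have h3 := Real.exp_pos (s * S.field (after (fun t => B t ω) l) x)
    have h4 := Real.exp_pos (-s * S.field (after (fun t => B t ω) l) x)
    rcases abs_choice (S.field (after (fun t => B t ω) l) x) with h | h <;> rw [h]
    · linarith
    · rw [mul_neg, ← neg_mul]
      linarith
  · exact ((S.aemeasurable_field_after hB l _).const_mul s).exp.ennreal_ofReal

end Sticks

end Brownian


/-! ### The random measure `μ` -/

lemma measurableEmbedding_nnreal : MeasurableEmbedding ((↑) : ℝ≥0 → ℝ) :=
  MeasurableEmbedding.subtype_coe measurableSet_Ici

lemma lebesgue_preimage (t : Set ℝ) : lebesgue ((↑) ⁻¹' t) = volume (t ∩ Ici 0) := by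
  rw [lebesgue, measurableEmbedding_nnreal.comap_preimage]
  congr 2
  ext x
  exact ⟨fun ⟨y, hy⟩ => hy ▸ y.2, fun hx => ⟨⟨x, hx⟩, rfl⟩⟩

lemma lebesgue_Iic (l : ℝ≥0) : lebesgue (Iic l) = l := by
  have h : Iic l = ((↑) : ℝ≥0 → ℝ) ⁻¹' Iic (l : ℝ) := by ext; simp
  rw [h, lebesgue_preimage, inter_comm, Ici_inter_Iic, Real.volume_Icc]
  simp

lemma lebesgue_Ioo (a b : ℝ≥0) : lebesgue (Ioo a b) = b - a := by
  have h : Ioo a b = ((↑) : ℝ≥0 → ℝ) ⁻¹' Ioo (a : ℝ) b := by ext; simp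
  rw [h, lebesgue_preimage, inter_eq_left.2 (show _ ⊆ Ici (0 : ℝ) from fun x hx => a.coe_nonneg.trans hx.1.le), Real.volume_Ioo,
    ENNReal.ofReal_sub _ a.coe_nonneg]
  simp

lemma lebesgue_Ioc (a b : ℝ≥0) : lebesgue (Ioc a b) = b - a := by
  have h : Ioc a b = ((↑) : ℝ≥0 → ℝ) ⁻¹' Ioc (a : ℝ) b := by ext; simp
  rw [h, lebesgue_preimage, inter_eq_left.2 (show _ ⊆ Ici (0 : ℝ) from fun x hx => a.coe_nonneg.trans hx.1.le), Real.volume_Ioc,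
    ENNReal.ofReal_sub _ a.coe_nonneg]
  simp

instance : SigmaFinite lebesgue :=
  ⟨⟨{ set := fun n => Iic n
      set_mem := fun _ => trivial
      finite := fun n => by simp [lebesgue_Iic]
      spanning := iUnion_eq_univ_iff.2 fun x => exists_nat_ge x }⟩⟩

instance (θ x : ℕ → ℝ≥0) : SFinite (massMeasure θ x) := by
  unfold massMeasure
  infer_instance

lemma lintegral_massMeasure (θ x : ℕ → ℝ≥0) {f : ℝ≥0 → ℝ≥0∞} (hf : Measurable f) :
    ∫⁻ t, f t ∂massMeasure θ x
      = (θ 0 ^ 2 : ℝ≥0) * ∫⁻ t, f t ∂lebesgue + ∑' i, (θ (i + 1) : ℝ≥0∞) * f (x i) := by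
  simp only [massMeasure, lintegral_add_measure, lintegral_sum_measure, lintegral_smul_measure,
    lintegral_dirac' _ hf, ENNReal.smul_def, smul_eq_mul]

lemma massMeasure_apply (θ x : ℕ → ℝ≥0) {s : Set ℝ≥0} (hs : MeasurableSet s) :
    massMeasure θ x s
      = (θ 0 ^ 2 : ℝ≥0) * lebesgue s + ∑' i, (θ (i + 1) : ℝ≥0∞) * s.indicator 1 (x i) := by
  rw [← lintegral_indicator_one hs, lintegral_massMeasure _ _ (measurable_one.indicator hs),
    lintegral_indicator_one hs]

lemma measurable_massMeasure (θ : ℕ → ℝ≥0) : Measurable (massMeasure θ) := by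
  refine Measure.measurable_of_measurable_coe _ fun s hs => ?_
  simp_rw [massMeasure_apply θ _ hs]
  refine measurable_const.add (Measurable.tsum fun i => Measurable.const_mul ?_ _)
  exact (measurable_one.indicator hs).comp (measurable_pi_apply i)

lemma meanMass_mono {Ω : Type*} [MeasurableSpace Ω] (P : Measure Ω) (θ : ℕ → ℝ≥0)
    (X : Ω → ℕ → ℝ≥0) : Monotone (meanMass P θ X) := fun _ _ h =>
  lintegral_mono fun _ => measure_mono (Iic_subset_Iic.2 h)

section Mass

variable {Ω : Type*} [MeasurableSpace Ω] {P : Measure Ω} [IsProbabilityMeasure P]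
  {θ : ℕ → ℝ≥0} {X Y Z : Ω → ℕ → ℝ≥0}

lemma measurable_massMeasure_apply (hX : Measurable X) {s : Set ℝ≥0} (hs : MeasurableSet s) :
    Measurable fun ω => massMeasure θ (X ω) s :=
  ((Measure.measurable_coe hs).comp (measurable_massMeasure θ)).comp hX

lemma meanMass_eq (hX : Measurable X) (l : ℝ≥0) :
    meanMass P θ X l = (θ 0 ^ 2 : ℝ≥0) * l + ∑' i, (θ (i + 1) : ℝ≥0∞) * P {ω | X ω i ≤ l} := by
  have hm : ∀ i, MeasurableSet {ω | X ω i ≤ l} := fun i =>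
    measurableSet_le ((measurable_pi_apply i).comp hX) measurable_const
  have e : ∀ i ω, (Iic l).indicator (1 : ℝ≥0 → ℝ≥0∞) (X ω i)
      = {ω | X ω i ≤ l}.indicator (1 : Ω → ℝ≥0∞) ω := fun i ω => rfl
  simp_rw [meanMass, massMeasure_apply θ _ measurableSet_Iic, lebesgue_Iic, e]
  rw [lintegral_add_left measurable_const, lintegral_const, measure_univ, mul_one,
    lintegral_tsum fun i => ((measurable_one.indicator (hm i)).const_mul _).aemeasurable]
  congr 1
  refine tsum_congr fun i => ?_
  rw [lintegral_const_mul _ (measurable_one.indicator (hm i)), lintegral_indicator_one (hm i)]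

lemma IsInput.measure_le_le (h : IsInput P θ X Y Z) (i : ℕ) (hi : 0 < θ (i + 1)) (l : ℝ≥0) :
    P {ω | X ω i ≤ l} ≤ θ (i + 1) * l := by
  have h1 := (h.law_X i hi).measure_eq (p := fun x => x ≤ (l : ℝ)) measurableSet_Iic
  simp only [NNReal.coe_le_coe] at h1
  have hr : (0 : ℝ) < θ (i + 1) := hi
  have := isProbabilityMeasure_expMeasure hr
  change P {ω | X ω i ≤ l} = expMeasure (θ (i + 1)) (Iic (l : ℝ)) at h1
  rw [h1, ← ofReal_cdf, cdf_expMeasure_eq hr, if_pos l.coe_nonneg]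
  have h2 := Real.add_one_le_exp (-((θ (i + 1) : ℝ) * l))
  calc ENNReal.ofReal (1 - Real.exp (-((θ (i + 1) : ℝ) * l)))
      ≤ ENNReal.ofReal ((θ (i + 1) : ℝ) * l) := ENNReal.ofReal_le_ofReal (by linarith)
    _ = _ := by
      rw [ENNReal.ofReal_mul (by positivity), ENNReal.ofReal_coe_nnreal, ENNReal.ofReal_coe_nnreal]

lemma IsInput.meanMass_le (h : IsInput P θ X Y Z) (hθ : IsParam θ) (l : ℝ≥0) :
    meanMass P θ X l ≤ l := by
  rw [meanMass_eq h.measurable_X]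
  have h1 : ∑' i, (θ i ^ 2 : ℝ≥0∞) = 1 := by
    have := ENNReal.hasSum_coe.2 hθ.hasSum_sq
    simpa using this.tsum_eq
  calc (θ 0 ^ 2 : ℝ≥0) * (l : ℝ≥0∞) + ∑' i, (θ (i + 1) : ℝ≥0∞) * P {ω | X ω i ≤ l}
      ≤ (θ 0 : ℝ≥0∞) ^ 2 * l + ∑' i, (θ (i + 1) : ℝ≥0∞) ^ 2 * l := by
        push_cast
        refine add_le_add le_rfl (ENNReal.tsum_le_tsum fun i => ?_)
        -- No law is prescribed when the parameter vanishes, but then the atom has no mass.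
        rcases eq_zero_or_pos (θ (i + 1)) with h0 | h0
        · simp [h0]
        · rw [sq, mul_assoc]
          exact mul_le_mul_right (h.measure_le_le i h0 l) _
    _ = l := by
        rw [ENNReal.tsum_mul_right, ← add_mul, ← tsum_eq_zero_add' (f := fun i => (θ i ^ 2 : ℝ≥0∞)) ENNReal.summable,
          h1, one_mul]

lemma IsInput.ae_massMeasure_lt_top (h : IsInput P θ X Y Z) (hθ : IsParam θ) :
    ∀ᵐ ω ∂P, ∀ l, massMeasure θ (X ω) (Iic l) < ∞ := by
  have h1 : ∀ n : ℕ, ∀ᵐ ω ∂P, massMeasure θ (X ω) (Iic n) < ∞ := fun n =>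
    ae_lt_top (measurable_massMeasure_apply h.measurable_X measurableSet_Iic)
      (ne_top_of_le_ne_top ENNReal.coe_ne_top (h.meanMass_le hθ n))
  filter_upwards [ae_all_iff.2 h1] with ω hω l
  obtain ⟨n, hn⟩ := exists_nat_ge l
  exact (measure_mono (Iic_subset_Iic.2 hn)).trans_lt (hω n)

/-- Chebyshev's inequality for `μ[0, l]`. -/
lemma IsInput.measure_massMeasure_lt_le (h : IsInput P θ X Y Z) (hθ : IsParam θ) {l : ℝ≥0} {m : ℝ}
    (hm : 0 < m) (hml : ENNReal.ofReal m = meanMass P θ X l) :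
    P {ω | massMeasure θ (X ω) (Iic l) < ENNReal.ofReal (m / 2)} ≤ ENNReal.ofReal (16 / m ^ 2) := by
  let ξ : ℕ → Ω → ℝ := fun i ω => θ (i + 1) * (Iic l).indicator 1 (X ω i)
  have hind : Measurable ((Iic l).indicator (1 : ℝ≥0 → ℝ)) := measurable_one.indicator
    measurableSet_Iic
  have hXi : ∀ i, Measurable fun ω => X ω i := fun i => (measurable_pi_apply i).comp h.measurable_X
  have hξm : ∀ i, Measurable (ξ i) := fun i => (hind.comp (hXi i)).const_mul _
  have hξ01 : ∀ i ω, ξ i ω ∈ Icc (0 : ℝ) (θ (i + 1)) := by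
    intro i ω
    simp only [ξ, indicator_apply, Pi.one_apply]
    split_ifs <;> simp
  have hξ2 : ∀ i, MemLp (ξ i) 2 P := fun i =>
    MemLp.of_bound (hξm i).aestronglyMeasurable (θ (i + 1)) (ae_of_all _ fun ω => by
      rw [Real.norm_eq_abs, abs_of_nonneg (hξ01 i ω).1]
      exact (hξ01 i ω).2)
  have hξi : iIndepFun ξ P := h.indep_X.comp (fun i x => (θ (i + 1) : ℝ) * (Iic l).indicator (1 : ℝ≥0 → ℝ) x)
    fun i => hind.const_mul _
  have hξE : ∀ i, ∫ ω, ξ i ω ∂P = θ (i + 1) * (P {ω | X ω i ≤ l}).toReal := by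
    intro i
    have e : ∀ ω, (Iic l).indicator (1 : ℝ≥0 → ℝ) (X ω i)
      = {ω | X ω i ≤ l}.indicator (1 : Ω → ℝ) ω := fun ω => rfl
    simp only [ξ, e]
    rw [integral_const_mul, integral_indicator_one (measurableSet_le (hXi i) measurable_const)]
    rfl
  -- truncation
  obtain ⟨N, hN⟩ : ∃ N, 3 * m / 4 ≤ θ 0 ^ 2 * l + ∑ i ∈ Finset.range N, ∫ ω, ξ i ω ∂P := by
    have hs := (ENNReal.summable (f := fun i => (θ (i + 1) : ℝ≥0∞) * P {ω | X ω i ≤ l})).hasSum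
      |>.tendsto_sum_nat.const_add (((θ 0 ^ 2 : ℝ≥0) : ℝ≥0∞) * l)
    rw [← meanMass_eq h.measurable_X, ← hml] at hs
    have hlt : ENNReal.ofReal (3 * m / 4) < ENNReal.ofReal m :=
      (ENNReal.ofReal_lt_ofReal_iff hm).2 (by linarith)
    obtain ⟨N, hN⟩ := (hs.eventually (lt_mem_nhds hlt)).exists
    refine ⟨N, ?_⟩
    have h0 : 0 ≤ θ 0 ^ 2 * (l : ℝ) + ∑ i ∈ Finset.range N, ∫ ω, ξ i ω ∂P := by
      have : ∀ i ∈ Finset.range N, 0 ≤ ∫ ω, ξ i ω ∂P := fun i _ =>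
        integral_nonneg fun ω => (hξ01 i ω).1
      have := Finset.sum_nonneg this
      positivity
    rw [← ENNReal.ofReal_le_ofReal_iff h0]
    refine hN.le.trans (le_of_eq ?_)
    simp_rw [hξE]
    rw [ENNReal.ofReal_add (by positivity) (Finset.sum_nonneg fun i _ => by positivity),
      ENNReal.ofReal_sum_of_nonneg fun i _ => by positivity, ENNReal.ofReal_mul (by positivity)]
    congr 2
    · rw [← NNReal.coe_pow, ENNReal.ofReal_coe_nnreal]
    · simp
    · ext i
      rw [ENNReal.ofReal_mul (by positivity), ENNReal.ofReal_coe_nnreal,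
        ENNReal.ofReal_toReal (measure_ne_top _ _)]
  set T : Ω → ℝ := ∑ i ∈ Finset.range N, ξ i with hT
  have hT2 : MemLp T 2 P := memLp_finsetSum' _ fun i _ => hξ2 i
  have hTE : ∫ ω, T ω ∂P = ∑ i ∈ Finset.range N, ∫ ω, ξ i ω ∂P := by
    simp only [hT, Finset.sum_apply]
    exact integral_finsetSum _ fun i _ => (hξ2 i).integrable (by norm_num)
  -- A variable with values in `[0, θ (i + 1)]` has variance at most a quarter of the square of `θ
  -- (i + 1)`, and the squares sum to at most 1.
  have hTV : variance T P ≤ 1 := by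
    rw [hT, IndepFun.variance_sum (fun i _ => hξ2 i) fun i _ j _ hij => hξi.indepFun hij]
    have h1 : ∀ i ∈ Finset.range N, variance (ξ i) P ≤ (θ (i + 1) : ℝ) ^ 2 := fun i _ => by
      refine (variance_le_sq_of_bounded (ae_of_all _ (hξ01 i)) (hξm i).aemeasurable).trans ?_
      rw [sub_zero, div_pow]
      have := sq_nonneg (θ (i + 1) : ℝ)
      linarith
    refine (Finset.sum_le_sum h1).trans ?_
    have h2 : HasSum (fun i => (θ i : ℝ) ^ 2) 1 := by
      simpa using NNReal.hasSum_coe.2 hθ.hasSum_sq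
    have h3 := h2.summable.sum_le_tsum (Finset.range (N + 1)) fun i _ => sq_nonneg _
    rw [h2.tsum_eq, Finset.sum_range_succ'] at h3
    have := sq_nonneg (θ 0 : ℝ)
    linarith
  -- The truncated mean is at least 3m/4, so a mass below m/2 forces a deviation of at least m/4.
  have hcheb := meas_ge_le_variance_div_sq hT2 (c := m / 4) (by positivity)
  refine (measure_mono fun ω hω => ?_).trans (hcheb.trans (ENNReal.ofReal_le_ofReal ?_))
  · simp only [mem_ofPred_eq] at hω ⊢
    have hlow : ENNReal.ofReal (θ 0 ^ 2 * l + T ω) ≤ massMeasure θ (X ω) (Iic l) := by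
      rw [massMeasure_apply θ _ measurableSet_Iic, lebesgue_Iic, ENNReal.ofReal_add (by positivity)
        (by
          simp only [hT, Finset.sum_apply]
          exact Finset.sum_nonneg fun i _ => (hξ01 i ω).1)]
      refine add_le_add (le_of_eq ?_) ?_
      · rw [ENNReal.ofReal_mul (by positivity), ← NNReal.coe_pow, ENNReal.ofReal_coe_nnreal,
          ENNReal.ofReal_coe_nnreal]
      · simp only [hT, Finset.sum_apply]
        rw [ENNReal.ofReal_sum_of_nonneg fun i _ => (hξ01 i ω).1]
        refine le_trans (Finset.sum_le_sum fun i _ => le_of_eq ?_) (ENNReal.sum_le_tsum _)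
        simp only [ξ, indicator_apply, Pi.one_apply]
        split_ifs <;> simp
    have h1 := (ENNReal.ofReal_lt_ofReal_iff (by positivity)).1 (hlow.trans_lt hω)
    rw [hTE]
    refine le_trans ?_ (neg_le_abs _)
    linarith
  · rw [div_pow, div_div_eq_mul_div]
    gcongr
    linarith

end Mass


/-! ### Scales -/

/-- The doubly exponential scales. -/
@[irreducible] def scale (k : ℕ) : ℝ≥0 := 2 ^ 2 ^ k

lemma scale_succ (k : ℕ) : scale (k + 1) = scale k ^ 2 := by
  rw [scale, scale, ← pow_mul, pow_succ]

lemma one_le_scale (k : ℕ) : 1 ≤ scale k := by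
  rw [scale]
  exact one_le_pow₀ (by norm_num)

lemma two_pow_le_scale (k : ℕ) : 2 ^ k ≤ scale k := by
  rw [scale]
  exact pow_le_pow_right₀ (by norm_num) Nat.lt_two_pow_self.le

lemma scale_mono : Monotone scale := fun _ _ h => by
  rw [scale, scale]
  exact pow_le_pow_right₀ (by norm_num) (Nat.pow_le_pow_right (by norm_num) h)

lemma tendsto_scale : Tendsto scale atTop atTop :=
  tendsto_atTop_mono two_pow_le_scale (tendsto_pow_atTop_atTop_of_one_lt (by norm_num))

/-- On an interval of length `2 ^ n` the weight `l⁻¹` is at least `2 ^ (-(n + 1))`; this loses only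
a factor 2. -/
lemma dyadic_le_two_mul_lintegral {f : ℝ≥0 → ℝ≥0∞} (hf : Antitone f) (n : ℕ) :
    f (2 ^ (n + 1)) ≤ 2 * ∫⁻ l in Ioc ((2 : ℝ≥0) ^ n) (2 ^ (n + 1)), (l : ℝ≥0∞)⁻¹ * f l ∂lebesgue := by
  have h1 : ∫⁻ _ in Ioc ((2 : ℝ≥0) ^ n) (2 ^ (n + 1)), ((2 : ℝ≥0∞) ^ (n + 1))⁻¹ * f (2 ^ (n + 1)) ∂lebesgue
      ≤ ∫⁻ l in Ioc ((2 : ℝ≥0) ^ n) (2 ^ (n + 1)), (l : ℝ≥0∞)⁻¹ * f l ∂lebesgue := by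
    refine setLIntegral_mono' measurableSet_Ioc fun l hl => ?_
    refine mul_le_mul' (ENNReal.inv_le_inv.2 ?_) (hf hl.2)
    exact_mod_cast hl.2
  refine le_trans (le_of_eq ?_) (mul_le_mul_right h1 2)
  rw [lintegral_const, Measure.restrict_apply_univ, lebesgue_Ioc]
  have e : (((2 ^ (n + 1) : ℝ≥0) : ℝ≥0∞) - (2 ^ n : ℝ≥0)) = 2 ^ n := by
    rw [← ENNReal.coe_sub, pow_succ, mul_two, add_tsub_cancel_right]
    simp
  rw [e]
  calc f (2 ^ (n + 1)) = 2 ^ (n + 1) * (2 ^ (n + 1))⁻¹ * f (2 ^ (n + 1)) := by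
        rw [ENNReal.mul_inv_cancel (by simp) (by simp), one_mul]
    _ = 2 * ((2 ^ (n + 1))⁻¹ * f (2 ^ (n + 1)) * 2 ^ n) := by
        rw [pow_succ']
        ring

/-- Two condensations: the integral against dl/l controls the sum of `f` over powers of 2, and
Cauchy condensation of that sum gives the doubly exponential scales. The shift is needed because the
integral is only controlled beyond `a`. -/
lemma exists_tsum_scale_ne_top {f : ℝ≥0 → ℝ≥0∞} (hf : Antitone f) {a : ℝ≥0}
    (h : ∫⁻ l in Ioi a, (l : ℝ≥0∞)⁻¹ * f l ∂lebesgue < ∞) :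
    ∃ K, ∑' k, 2 ^ (k + K) * f (scale (k + K)) ≠ ∞ := by
  obtain ⟨I, hI⟩ := pow_unbounded_of_one_lt a (show (1 : ℝ≥0) < 2 by norm_num)
  have hmono : Monotone fun n : ℕ => (2 : ℝ≥0) ^ (n + I) := fun m n hmn =>
    pow_le_pow_right₀ (by norm_num) (by omega)
  have hg : ∑' i, f (2 ^ (i + I + 1)) ≠ ∞ := by
    refine ne_top_of_le_ne_top (ENNReal.mul_ne_top ENNReal.ofNat_ne_top h.ne) (b := 2 * _) ?_
    refine (ENNReal.tsum_le_tsum fun i => dyadic_le_two_mul_lintegral hf (i + I)).trans ?_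
    rw [ENNReal.tsum_mul_left, ← lintegral_iUnion (fun i => measurableSet_Ioc)]
    · refine mul_le_mul_right (lintegral_mono_set (iUnion_subset fun i x hx => ?_)) _
      exact (hI.le.trans (pow_le_pow_right₀ (by norm_num) (by omega))).trans_lt hx.1
    · have := hmono.pairwise_disjoint_on_Ioc_succ
      simpa only [Nat.succ_eq_succ, Order.succ_eq_add_one, add_right_comm _ 1 I] using this
  have hgm : Antitone fun i : ℕ => f (2 ^ (i + I + 1)) := fun m n hmn =>
    hf (pow_le_pow_right₀ (by norm_num) (by omega))
  have hcond := ENNReal.tsum_condensed_le (f := fun i : ℕ => f (2 ^ (i + I + 1)))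
    fun m n _ hmn => hgm hmn
  have hfin : ∑' k : ℕ, 2 ^ k * f (2 ^ (2 ^ k + I + 1)) ≠ ∞ := by
    refine ne_top_of_le_ne_top ?_ hcond
    exact ENNReal.add_ne_top.2 ⟨ENNReal.ne_top_of_tsum_ne_top hg 1,
      ENNReal.mul_ne_top ENNReal.ofNat_ne_top hg⟩
  -- One extra doubling of the exponent absorbs the offset, since `2 ^ (k + I + 1) + I + 1 ≤ 2 ^ (k
  -- + I + 2)` and `f` is antitone.
  refine ⟨I + 2, ne_top_of_le_ne_top (ENNReal.mul_ne_top ENNReal.ofNat_ne_top hfin) (b := 2 * _) ?_⟩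
  rw [← ENNReal.tsum_mul_left]
  refine le_trans (ENNReal.tsum_le_tsum fun k => ?_)
    (ENNReal.tsum_comp_le_tsum_of_injective (add_left_injective (I + 1)) _)
  rw [show k + (I + 2) = k + (I + 1) + 1 by ring, pow_succ, mul_comm _ (2 : ℝ≥0∞), mul_assoc]
  refine mul_le_mul_right (mul_le_mul_right (hf ?_) _) _
  rw [scale]
  refine pow_le_pow_right₀ (by norm_num) ?_
  have h1 : I + 1 ≤ 2 ^ (I + 1) := Nat.lt_two_pow_self.le
  have h2 : 2 ^ (I + 1) ≤ 2 ^ (k + (I + 1)) := Nat.pow_le_pow_right (by norm_num) (by omega)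
  rw [pow_succ 2 (k + (I + 1))]
  omega

/-! ### Mean and typical mass along the scales -/

section Mass

variable {Ω : Type*} [MeasurableSpace Ω] {P : Measure Ω} [IsProbabilityMeasure P]
  {θ : ℕ → ℝ≥0} {X Y Z : Ω → ℕ → ℝ≥0}

/-- The mean mass of `[0, scale k]`, as a real number. -/
def scaleMean (P : Measure Ω) (θ : ℕ → ℝ≥0) (X : Ω → ℕ → ℝ≥0) (k : ℕ) : ℝ :=
  (meanMass P θ X (scale k)).toReal

lemma IsInput.ofReal_scaleMean (h : IsInput P θ X Y Z) (hθ : IsParam θ) (k : ℕ) :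
    ENNReal.ofReal (scaleMean P θ X k) = meanMass P θ X (scale k) :=
  ENNReal.ofReal_toReal (ne_top_of_le_ne_top ENNReal.coe_ne_top (h.meanMass_le hθ _))

/-- The condensation applies to the inverse square root of the mean mass. The terms of a convergent
series are eventually below 1, which is the growth `4 ^ k`. -/
lemma IsInput.summable_scaleMean (h : IsInput P θ X Y Z) (hθ : IsParam θ)
    (hint : ∃ a : ℝ≥0, 0 < a ∧
      ∫⁻ l in Ioi a, ((l : ℝ≥0∞) * meanMass P θ X l ^ (1 / 2 : ℝ))⁻¹ ∂lebesgue < ∞) :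
    (Summable fun k => 2 ^ k / √(scaleMean P θ X k)) ∧ ∀ᶠ k in atTop, 4 ^ k ≤ scaleMean P θ X k := by
  obtain ⟨a, -, ha⟩ := hint
  have hf : Antitone fun l => (meanMass P θ X l ^ (1 / 2 : ℝ))⁻¹ := fun s t hst =>
    ENNReal.inv_le_inv.2 (ENNReal.rpow_le_rpow (meanMass_mono P θ X hst) (by norm_num))
  obtain ⟨K, hK⟩ := exists_tsum_scale_ne_top hf (a := a) (by
    refine lt_of_le_of_lt (le_of_eq ?_) ha
    refine lintegral_congr fun l => (ENNReal.mul_inv (Or.inr ?_) (Or.inl ENNReal.coe_ne_top)).symm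
    exact (ENNReal.rpow_lt_top_of_nonneg (by norm_num)
      (ne_top_of_le_ne_top ENNReal.coe_ne_top (h.meanMass_le hθ l))).ne)
  have hs := (summable_nat_add_iff (f := fun k => 2 ^ k / √(scaleMean P θ X k)) K).1 (by
    have h1 := ENNReal.summable_toReal hK
    refine h1.congr fun k => ?_
    rw [ENNReal.toReal_mul, ENNReal.toReal_inv, ← ENNReal.toReal_rpow, Real.sqrt_eq_rpow]
    simp [scaleMean, div_eq_mul_inv])
  refine ⟨hs, ?_⟩
  filter_upwards [hs.tendsto_atTop_zero.eventually (gt_mem_nhds one_pos), eventually_ge_atTop K]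
    with k hk hkK
  -- The real quotient is 0 by convention when the mean vanishes and says nothing then; the extended
  -- sum, where that term would be infinite, excludes this case.
  have hne : meanMass P θ X (scale k) ≠ 0 := by
    intro h0
    have := ENNReal.ne_top_of_tsum_ne_top hK (k - K)
    rw [Nat.sub_add_cancel hkK, h0] at this
    simp at this
  have hpos : 0 < scaleMean P θ X k := ENNReal.toReal_pos hne
    (ne_top_of_le_ne_top ENNReal.coe_ne_top (h.meanMass_le hθ _))
  rw [div_lt_one (Real.sqrt_pos.2 hpos)] at hk
  have h2 := (Real.lt_sqrt (by positivity)).1 hk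
  rw [← pow_mul, mul_comm, pow_mul] at h2
  norm_num at h2
  exact h2.le

/-- Borel-Cantelli twice: Chebyshev gives 16/m_k², summable because m_k ≥ 4^k, and Markov with
E[μ[0, l]] ≤ l gives probability at most 1/l for μ[0, l] ≥ l². -/
lemma IsInput.ae_eventually_massMeasure (h : IsInput P θ X Y Z) (hθ : IsParam θ)
    (hm : ∀ᶠ k in atTop, 4 ^ k ≤ scaleMean P θ X k) :
    ∀ᵐ ω ∂P, ∀ᶠ k in atTop,
      ENNReal.ofReal (scaleMean P θ X k / 2) ≤ massMeasure θ (X ω) (Iic (scale k)) ∧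
        massMeasure θ (X ω) (Iic (scale k)) ≤ (scale k : ℝ≥0∞) ^ 2 := by
  obtain ⟨K, hK⟩ := eventually_atTop.1 hm
  set m := scaleMean P θ X
  have hgeom : ∀ C : ℝ, ∑' k, ENNReal.ofReal (C * (1 / 2) ^ k) ≠ ∞ := fun C =>
    ((summable_geometric_of_lt_one (by norm_num) (by norm_num)).mul_left C).tsum_ofReal_ne_top
  have h1 : ∑' k, P {ω | massMeasure θ (X ω) (Iic (scale (k + K)))
      < ENNReal.ofReal (m (k + K) / 2)} ≠ ∞ := by
    refine ne_top_of_le_ne_top (hgeom 16) (ENNReal.tsum_le_tsum fun k => ?_)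
    have h4 := hK (k + K) (by omega)
    have hpos : 0 < m (k + K) := lt_of_lt_of_le (by positivity) h4
    refine (h.measure_massMeasure_lt_le hθ hpos (h.ofReal_scaleMean hθ _)).trans
      (ENNReal.ofReal_le_ofReal ?_)
    rw [div_eq_mul_inv, one_div, inv_pow]
    gcongr
    calc (2 : ℝ) ^ k ≤ 4 ^ (k + K) := by
          rw [show (4 : ℝ) = 2 ^ 2 by norm_num, ← pow_mul]
          exact pow_le_pow_right₀ (by norm_num) (by omega)
      _ ≤ m (k + K) := h4
      _ ≤ m (k + K) ^ 2 := le_self_pow₀ ((one_le_pow₀ (by norm_num)).trans h4) (by norm_num)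
  have h2 : ∑' k, P {ω | (scale (k + K) : ℝ≥0∞) ^ 2
      ≤ massMeasure θ (X ω) (Iic (scale (k + K)))} ≠ ∞ := by
    refine ne_top_of_le_ne_top (hgeom 1) (ENNReal.tsum_le_tsum fun k => ?_)
    have h3 := mul_meas_ge_le_lintegral (μ := P) (measurable_massMeasure_apply (θ := θ)
      h.measurable_X (measurableSet_Iic (a := scale (k + K)))) ((scale (k + K) : ℝ≥0∞) ^ 2)
    replace h3 := h3.trans (h.meanMass_le hθ (scale (k + K)))
    have hne : (scale (k + K) : ℝ≥0∞) ≠ 0 := by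
      have := one_le_scale (k + K)
      exact ENNReal.coe_ne_zero.2 (by positivity)
    set p := P {ω | (scale (k + K) : ℝ≥0∞) ^ 2 ≤ massMeasure θ (X ω) (Iic (scale (k + K)))}
    replace h3 : (scale (k + K) : ℝ≥0∞) * (scale (k + K) * p) ≤ scale (k + K) * 1 := by
      rwa [← mul_assoc, ← sq, mul_one]
    rw [ENNReal.mul_le_mul_iff_right hne ENNReal.coe_ne_top, mul_comm,
      ← ENNReal.le_inv_iff_mul_le] at h3
    refine h3.trans ?_
    rw [one_mul, ENNReal.ofReal_pow (by norm_num), one_div, ENNReal.ofReal_inv_of_pos (by norm_num),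
      ← ENNReal.inv_pow, ENNReal.inv_le_inv, ENNReal.ofReal_ofNat]
    have h4 := (pow_le_pow_right₀ (by norm_num) (by omega)).trans (two_pow_le_scale (k + K))
      (a := (2 : ℝ≥0) ^ k)
    exact_mod_cast h4
  filter_upwards [ae_eventually_notMem h1, ae_eventually_notMem h2] with ω hω1 hω2
  have hev : ∀ᶠ k in atTop,
      ENNReal.ofReal (m (k + K) / 2) ≤ massMeasure θ (X ω) (Iic (scale (k + K))) ∧
        massMeasure θ (X ω) (Iic (scale (k + K))) ≤ (scale (k + K) : ℝ≥0∞) ^ 2 := by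
    filter_upwards [hω1, hω2] with k hk1 hk2
    simp only [not_lt, not_le] at hk1 hk2
    exact ⟨hk1, hk2.le⟩
  filter_upwards [(tendsto_sub_atTop_nat K).eventually hev, eventually_ge_atTop K] with k hk hkK
  rwa [Nat.sub_add_cancel hkK] at hk

end Mass


/-! ### Poisson cuts -/

lemma monotone_measure_Iic (μ : Measure ℝ≥0) : Monotone fun l => μ (Iic l) := fun _ _ h =>
  measure_mono (Iic_subset_Iic.2 h)

lemma measurable_measure_Iic (μ : Measure ℝ≥0) : Measurable fun l => μ (Iic l) :=
  (monotone_measure_Iic μ).measurable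

lemma cutIntensity_le {μ : Measure ℝ≥0} {L : ℝ≥0} {A : Set ℝ≥0} (hA : A ⊆ Iic L) :
    cutIntensity μ A ≤ L * μ (Iic L) := by
  rw [cutIntensity]
  refine (measure_mono hA).trans ?_
  rw [withDensity_apply _ measurableSet_Iic]
  refine (setLIntegral_mono' measurableSet_Iic fun x hx =>
    monotone_measure_Iic μ hx).trans (le_of_eq ?_)
  rw [lintegral_const, Measure.restrict_apply_univ, lebesgue_Iic, mul_comm]

lemma le_cutIntensity_Ioo (μ : Measure ℝ≥0) {l a b : ℝ≥0} (hl : l ≤ a) :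
    (b - a) * μ (Iic l) ≤ cutIntensity μ (Ioo a b) := by
  rw [cutIntensity, withDensity_apply _ measurableSet_Ioo]
  refine le_trans (le_of_eq ?_) (setLIntegral_mono' measurableSet_Ioo fun x hx =>
    monotone_measure_Iic μ (hl.trans hx.1.le))
  rw [lintegral_const, Measure.restrict_apply_univ, lebesgue_Ioo, mul_comm]

/-- An upper bound for the exponential moments of the distance to the previous cut. -/
def ageBound : ℝ≥0∞ := ∑' j : ℕ, ENNReal.ofReal (Real.exp (1 - j))

lemma ageBound_ne_top : ageBound ≠ ∞ := by
  have h : Summable fun j : ℕ => Real.exp (1 - j) := by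
    have := (Real.summable_exp_neg_nat).mul_left (Real.exp 1)
    refine this.congr fun j => ?_
    rw [← Real.exp_add]
    ring_nf
  exact h.tsum_ofReal_ne_top

/-- There is no cut in the open interval of length `j / c` before `x`, and this interval lies after
`l` (unless `j = 0`). -/
def IsYoung (c : ℝ) (l : ℝ≥0) (j : ℕ) (y : ℕ → ℝ≥0) (x : ℝ≥0) : Prop :=
  (j : ℝ) ≤ c * (x - l : ℝ≥0) ∧ ∀ i, (y i : ℝ) ≤ x - j / c ∨ x ≤ y i

open Classical in
/-- An upper bound for the exponential of `c` times the length of `(l, x]` after the last cut. -/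
def ageWeight (c : ℝ) (l : ℝ≥0) (y : ℕ → ℝ≥0) (x : ℝ≥0) : ℝ≥0∞ :=
  ∑' j : ℕ, if IsYoung c l j y x then ENNReal.ofReal (Real.exp (j + 1)) else 0

lemma measurable_isYoung (l : ℝ≥0) (j : ℕ) :
    Measurable fun p : ℝ × (ℕ → ℝ≥0) × ℝ≥0 => IsYoung p.1 l j p.2.1 p.2.2 := by
  refine Measurable.and (measurableSet_setOfPred.1 ?_) (Measurable.forall fun i => Measurable.or
    (measurableSet_setOfPred.1 ?_) (measurableSet_setOfPred.1 ?_))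
  · exact measurableSet_le (by fun_prop) (by fun_prop)
  · exact measurableSet_le (by fun_prop) (by fun_prop)
  · exact measurableSet_le (by fun_prop) (by fun_prop)

lemma measurable_ageWeight (l : ℝ≥0) :
    Measurable fun p : ℝ × (ℕ → ℝ≥0) × ℝ≥0 => ageWeight p.1 l p.2.1 p.2.2 := by
  exact Measurable.tsum fun j => Measurable.ite
    (measurableSet_setOfPred.2 (measurable_isYoung l j)) measurable_const measurable_const

/-- A single term of the series suffices, with `j` the integer part of `c` times the length of `(s,
x]` after `l`. Here `s` plays the role of the last cut before `x`. -/
lemma exp_le_ageWeight {c : ℝ} (hc : 0 < c) (l : ℝ≥0) {y : ℕ → ℝ≥0} {s x : ℝ≥0} (hsx : s < x)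
    (h : ∀ i, y i ≤ s ∨ x ≤ y i) :
    ENNReal.ofReal (Real.exp (c * ((max x l : ℝ≥0) - (max s l : ℝ≥0)))) ≤ ageWeight c l y x := by
  set t : ℝ := (max x l : ℝ≥0) - (max s l : ℝ≥0) with ht
  have ht0 : 0 ≤ t := sub_nonneg.2 (by exact_mod_cast max_le_max_right l hsx.le)
  have htl : t ≤ (x - l : ℝ≥0) := by
    rw [NNReal.coe_sub_def, ht]
    have h1 : (l : ℝ) ≤ (max s l : ℝ≥0) := by exact_mod_cast le_max_right s l
    rcases le_total x l with hx | hx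
    · rw [max_eq_right hx]
      exact (sub_nonpos.2 h1).trans (le_max_right _ _)
    · rw [max_eq_left hx]
      exact (sub_le_sub_left h1 _).trans (le_max_left _ _)
  set j := ⌊c * t⌋₊
  have hj : (j : ℝ) ≤ c * t := Nat.floor_le (by positivity)
  have hj' : c * t ≤ j + 1 := (Nat.lt_floor_add_one _).le
  have hy : IsYoung c l j y x := by
    refine ⟨hj.trans (by gcongr), fun i => ?_⟩
    rcases h i with hi | hi
    · left
      have hjt : j / c ≤ t := by rw [div_le_iff₀ hc]; linarith
      have hts : t ≤ x - s := by
        have h1 := after_sub_after (fun t => (t : ℝ)) l s x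
        simp only [after] at h1
        rw [ht, ← h1]
        have h2 : ((min s l : ℝ≥0) : ℝ) ≤ (min x l : ℝ≥0) := by
          exact_mod_cast min_le_min_right l hsx.le
        linarith
      have : (y i : ℝ) ≤ s := by exact_mod_cast hi
      linarith
    · exact Or.inr hi
  refine le_trans ?_ (ENNReal.le_tsum j)
  rw [if_pos hy]
  exact ENNReal.ofReal_le_ofReal (Real.exp_le_exp.2 hj')

/-- The integral of `1 / μ[0, x]` against `μ` is at most logarithmic. -/
lemma lintegral_inv_measure_Iic_le {μ : Measure ℝ≥0} {l L : ℝ≥0} {N : ℕ} (hl : 1 ≤ μ (Iic l))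
    (hL : μ (Iic L) ≤ 2 ^ N) :
    ∫⁻ x in Ioc l L, (μ (Iic x))⁻¹ ∂μ ≤ 2 * (N + 1) := by
  set F := fun x => μ (Iic x)
  have hF : Monotone F := monotone_measure_Iic μ
  have hFm : Measurable F := measurable_measure_Iic μ
  -- `F` may jump, so a sublevel set is either a closed initial interval or a countable increasing
  -- union of such intervals; in both cases its mass is at most the level.
  have hD : ∀ u : ℝ≥0∞, μ {x | F x < u} ≤ u := by
    intro u
    by_cases hmax : ∃ s, F s < u ∧ ∀ x, F x < u → x ≤ s
    · obtain ⟨s, hs, hs'⟩ := hmax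
      exact (measure_mono fun x hx => hs' x hx).trans hs.le
    · push Not at hmax
      obtain ⟨D, hDc, hDd⟩ := TopologicalSpace.exists_countable_dense ℝ≥0
      have e : {x | F x < u} ⊆ ⋃ q ∈ D ∩ {x | F x < u}, Iic q := by
        intro x hx
        obtain ⟨x', hx', hxx'⟩ := hmax x hx
        obtain ⟨q, hqD, hq⟩ := hDd.exists_between hxx'
        exact mem_biUnion (⟨hqD, (hF hq.2.le).trans_lt hx'⟩ : q ∈ D ∩ {x | F x < u}) hq.1.le
      refine (measure_mono e).trans ?_
      rw [measure_biUnion_eq_iSup (hDc.mono inter_subset_left)]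
      · exact iSup₂_le fun q hq => hq.2.le
      · intro p hp q hq
        rcases le_total p q with h | h
        · exact ⟨q, hq, Iic_subset_Iic.2 h, subset_rfl⟩
        · exact ⟨p, hp, subset_rfl, Iic_subset_Iic.2 h⟩
  -- The shells on which `F` doubles: each contributes at most 2, and `N + 1` of them lead from 1 to
  -- `2 ^ (N + 1)`.
  have hcover : Ioc l L ⊆ ⋃ j : Fin (N + 1), {x | 2 ^ (j : ℕ) ≤ F x ∧ F x < 2 ^ (j + 1 : ℕ)} := by
    intro x hx
    have h1 : 1 ≤ F x := hl.trans (hF hx.1.le)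
    have h2 : F x < 2 ^ (N + 1) := ((hF hx.2).trans hL).trans_lt
      (by exact_mod_cast Nat.pow_lt_pow_right (by norm_num) N.lt_succ_self)
    classical
    have hex : ∃ j, F x < 2 ^ (j + 1) := ⟨N, h2⟩
    refine mem_iUnion.2 ⟨⟨Nat.find hex, Nat.lt_succ_of_le (Nat.find_min' hex h2)⟩, ?_,
      Nat.find_spec hex⟩
    change 2 ^ Nat.find hex ≤ F x
    rcases hj : Nat.find hex with _ | j
    · simpa using h1
    · have := Nat.find_min hex (m := j) (by omega)
      exact not_lt.1 this
  calc ∫⁻ x in Ioc l L, (F x)⁻¹ ∂μ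
      ≤ ∫⁻ x in ⋃ j : Fin (N + 1), {x | 2 ^ (j : ℕ) ≤ F x ∧ F x < 2 ^ (j + 1 : ℕ)}, (F x)⁻¹ ∂μ :=
        lintegral_mono_set hcover
    _ ≤ ∑ j : Fin (N + 1), ∫⁻ x in {x | 2 ^ (j : ℕ) ≤ F x ∧ F x < 2 ^ (j + 1 : ℕ)}, (F x)⁻¹ ∂μ := by
        exact (lintegral_iUnion_le _ _).trans_eq (tsum_fintype _)
    _ ≤ ∑ j : Fin (N + 1), 2 := by
        refine Finset.sum_le_sum fun j _ => ?_
        have hm : MeasurableSet {x | 2 ^ (j : ℕ) ≤ F x ∧ F x < 2 ^ (j + 1 : ℕ)} :=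
          (measurableSet_le measurable_const hFm).inter (measurableSet_lt hFm measurable_const)
        refine (setLIntegral_mono' hm (g := fun _ => ((2 : ℝ≥0∞) ^ (j : ℕ))⁻¹)
          fun x hx => ENNReal.inv_le_inv.2 hx.1).trans ?_
        rw [lintegral_const, Measure.restrict_apply_univ]
        refine (mul_le_mul_right ((measure_mono fun x hx => hx.2).trans (hD _)) _).trans
          (le_of_eq ?_)
        rw [pow_succ, ← mul_assoc, ENNReal.inv_mul_cancel (by simp) (by simp), one_mul]
    _ = 2 * (N + 1) := by
        simp [mul_comm]

/-- An upper bound for the logarithm of the exponential moments of the distances to `[0, l]`. -/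
def logWeight (μ : Measure ℝ≥0) (c : ℝ) (l L : ℝ≥0) (y : ℕ → ℝ≥0) : ℝ≥0∞ :=
  ∫⁻ x in Ioc l L, ageWeight c l y x * (μ (Iic x))⁻¹ ∂μ

lemma count_eq_zero_iff {A : Set ℝ≥0} {y : ℕ → ℝ≥0} : count A y = 0 ↔ ∀ i, y i ∉ A := by
  simp [count, Set.eq_empty_iff_forall_notMem]

namespace IsPoissonLaw

variable {μ : Measure ℝ≥0} {ν : Measure (ℕ → ℝ≥0)} {Λ : Measure ℝ≥0}

lemma measure_void (h : IsPoissonLaw Λ ν) {A : Set ℝ≥0} (hA : MeasurableSet A) (hΛ : Λ A ≠ ∞) :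
    ν {y | ∀ i, y i ∉ A} = ENNReal.ofReal (Real.exp (-(Λ A).toReal)) := by
  have h1 := (h.hasLaw_count A hA hΛ).measure_eq (p := fun n => n = 0) (measurableSet_singleton 0)
  simp only [count_eq_zero_iff] at h1
  rw [h1]
  change (poissonMeasure _).map _ {0} = _
  rw [Measure.map_apply (measurable_of_countable _) (measurableSet_singleton 0)]
  have e : ((↑) : ℕ → ℕ∞) ⁻¹' {0} = {0} := by ext; simp
  rw [e, poissonMeasure_singleton]
  simp [ENNReal.coe_toNNReal_eq_toReal]

lemma ae_notMem (h : IsPoissonLaw Λ ν) [IsProbabilityMeasure ν] {A : Set ℝ≥0}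
    (hA : MeasurableSet A) (hΛ : Λ A = 0) : ∀ᵐ y ∂ν, ∀ i, y i ∉ A := by
  have h1 := h.measure_void hA (by simp [hΛ])
  rw [hΛ] at h1
  have hm : MeasurableSet {y : ℕ → ℝ≥0 | ∀ i, y i ∉ A} := by
    exact measurableSet_setOfPred.2 (Measurable.forall fun i => measurableSet_setOfPred.1
      (hA.compl.preimage (measurable_pi_apply i)))
  have := (prob_compl_eq_zero_iff hm).2 (h1.trans (by simp))
  exact this

lemma lintegral_count (h : IsPoissonLaw Λ ν) {A : Set ℝ≥0} (hA : MeasurableSet A) (hΛ : Λ A ≠ ∞) :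
    ∫⁻ y, (count A y : ℝ≥0∞) ∂ν = Λ A := by
  have hm : Measurable fun n : ℕ∞ => (n : ℝ≥0∞) := measurable_of_countable _
  rw [(h.hasLaw_count A hA hΛ).lintegral_comp hm.aemeasurable,
    lintegral_map hm (measurable_of_countable _)]
  set r := (Λ A).toNNReal with hr
  rw [lintegral_countable', tsum_eq_zero_add' ENNReal.summable]
  simp only [poissonMeasure_singleton, ENat.toENNReal_coe]
  have hstep : ∀ n : ℕ, ((n + 1 : ℕ) : ℝ≥0∞)
      * ENNReal.ofReal (Real.exp (-r) * r ^ (n + 1) / (n + 1).factorial)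
      = r * ENNReal.ofReal (Real.exp (-r) * r ^ n / n.factorial) := by
    intro n
    rw [← ENNReal.ofReal_natCast, ← ENNReal.ofReal_coe_nnreal (p := r),
      ← ENNReal.ofReal_mul (by positivity), ← ENNReal.ofReal_mul (by positivity),
      Nat.factorial_succ]
    congr 1
    push_cast
    field_simp
    ring
  simp_rw [hstep]
  rw [ENNReal.tsum_mul_left, ← ENNReal.ofReal_tsum_of_nonneg (fun n => by positivity)
    (hasSum_one_poissonMeasure r).summable, (hasSum_one_poissonMeasure r).tsum_eq]
  simp [hr, ENNReal.coe_toNNReal hΛ]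

/-- A bounded increasing sequence of cuts would put infinitely many points in some `[0, n]`, whose
mean number of points is finite. -/
lemma ae_tendsto (h : IsPoissonLaw (cutIntensity μ) ν) (hμ : ∀ l, μ (Iic l) < ∞) :
    ∀ᵐ y ∂ν, Tendsto y atTop atTop := by
  have h1 : ∀ n : ℕ, ∀ᵐ y ∂ν, (count (Iic (n : ℝ≥0)) y : ℝ≥0∞) < ∞ := by
    intro n
    have hΛ : cutIntensity μ (Iic (n : ℝ≥0)) ≠ ∞ := ne_top_of_le_ne_top
      (ENNReal.mul_ne_top ENNReal.coe_ne_top (hμ n).ne) (cutIntensity_le subset_rfl)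
    refine ae_lt_top' ?_ ?_
    · exact (measurable_of_countable _).comp_aemeasurable
        (h.hasLaw_count _ measurableSet_Iic hΛ).aemeasurable
    · rwa [h.lintegral_count measurableSet_Iic hΛ]
  filter_upwards [h.strictMono, ae_all_iff.2 h1] with y hy hc
  refine tendsto_atTop_atTop_of_monotone hy.monotone fun b => ?_
  by_contra! hb
  obtain ⟨n, hn⟩ := exists_nat_ge b
  have h2 := hc n
  have e : {i | y i ∈ Iic (n : ℝ≥0)} = univ := eq_univ_of_forall fun i => (hb i).le.trans hn
  rw [count, e] at h2
  simp at h2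

/-- The intensity has density zero where `μ (Iic l)` vanishes, so no cut falls there. This makes the
conditioning of `μ` to `[0, Yᵢ]` legitimate. -/
lemma ae_measure_Iic_ne_zero (h : IsPoissonLaw (cutIntensity μ) ν) [IsProbabilityMeasure ν] :
    ∀ᵐ y ∂ν, ∀ i, μ (Iic (y i)) ≠ 0 := by
  have hm : MeasurableSet {l | μ (Iic l) = 0} :=
    measurable_measure_Iic μ (measurableSet_singleton 0)
  refine h.ae_notMem (A := {l | μ (Iic l) = 0}) hm ?_
  rw [cutIntensity, withDensity_apply _ hm]
  rw [setLIntegral_congr_fun hm (g := fun _ => 0) fun x hx => hx]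
  simp

open Classical in
-- After `l` the cuts have rate at least `2 * c`, so an interval of length `j / c` is free of cuts
-- with probability at most exp(-2j). Against the weight exp(j + 1) this leaves exp(1 - j), the
-- terms of `ageBound`.
lemma lintegral_ageWeight_le (h : IsPoissonLaw (cutIntensity μ) ν) [IsProbabilityMeasure ν]
    (hμ : ∀ l, μ (Iic l) < ∞) {c : ℝ} (hc : 0 < c) {l : ℝ≥0}
    (hl : ENNReal.ofReal (2 * c) ≤ μ (Iic l)) (x : ℝ≥0) :
    ∫⁻ y, ageWeight c l y x ∂ν ≤ ageBound := by
  have hmj : ∀ j : ℕ, MeasurableSet {y | IsYoung c l j y x} := by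
    intro j
    exact measurableSet_setOfPred.2 ((measurable_isYoung l j).comp
      (measurable_const.prodMk (measurable_id.prodMk measurable_const)))
  have hvoid : ∀ j : ℕ, ν {y | IsYoung c l j y x} ≤ ENNReal.ofReal (Real.exp (-(2 * j))) := by
    intro j
    by_cases hj : (j : ℝ) ≤ c * (x - l : ℝ≥0)
    · rcases Nat.eq_zero_or_pos j with rfl | hj0
      · simpa using prob_le_one
      have hxl : l ≤ x := by
        by_contra! hlt
        rw [tsub_eq_zero_of_le hlt.le] at hj
        simp only [NNReal.coe_zero, mul_zero] at hj
        exact absurd hj (by simpa using hj0.ne')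
      rw [NNReal.coe_sub hxl] at hj
      have hjc : (j : ℝ) / c ≤ x - l := by rw [div_le_iff₀ hc]; linarith
      have ha : l ≤ x - (j / c).toNNReal := by
        rw [← NNReal.coe_le_coe, NNReal.coe_sub, Real.coe_toNNReal _ (by positivity)]
        · linarith
        · rw [← NNReal.coe_le_coe, Real.coe_toNNReal _ (by positivity)]
          linarith [l.coe_nonneg]
      have hacoe : ((x - (j / c).toNNReal : ℝ≥0) : ℝ) = x - j / c := by
        rw [NNReal.coe_sub, Real.coe_toNNReal _ (by positivity)]
        rw [← NNReal.coe_le_coe, Real.coe_toNNReal _ (by positivity)]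
        linarith [l.coe_nonneg]
      set a := x - (j / c).toNNReal
      have hΛ : cutIntensity μ (Ioo a x) ≠ ∞ := ne_top_of_le_ne_top
        (ENNReal.mul_ne_top ENNReal.coe_ne_top (hμ x).ne) (cutIntensity_le fun t ht => ht.2.le)
      have hsub : {y | IsYoung c l j y x} ⊆ {y | ∀ i, y i ∉ Ioo a x} := by
        intro y hy i hi
        rcases hy.2 i with h1 | h1
        · rw [← hacoe, NNReal.coe_le_coe] at h1
          exact not_lt.2 h1 hi.1
        · exact not_lt.2 h1 hi.2
      refine (measure_mono hsub).trans ?_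
      rw [h.measure_void measurableSet_Ioo hΛ]
      refine ENNReal.ofReal_le_ofReal (Real.exp_le_exp.2 (neg_le_neg ?_))
      rw [← ENNReal.ofReal_le_iff_le_toReal hΛ]
      refine le_trans ?_ (le_cutIntensity_Ioo μ ha)
      have e : ENNReal.ofReal (2 * j) = (x - a) * ENNReal.ofReal (2 * c) := by
        have e1 : (x : ℝ≥0∞) - a = ENNReal.ofReal (j / c) := by
          rw [← ENNReal.ofReal_coe_nnreal, ← ENNReal.ofReal_coe_nnreal (p := a),
            ← ENNReal.ofReal_sub _ a.coe_nonneg, hacoe]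
          ring_nf
        rw [e1, ← ENNReal.ofReal_mul (by positivity)]
        congr 1
        field_simp
      rw [e]
      gcongr
    · have e : {y | IsYoung c l j y x} = ∅ := by
        ext y
        simp [IsYoung, hj]
      simp [e]
  unfold ageWeight ageBound
  rw [lintegral_tsum fun j => (Measurable.ite (hmj j) measurable_const
    measurable_const).aemeasurable]
  refine ENNReal.tsum_le_tsum fun j => ?_
  have e : ∀ y, (if IsYoung c l j y x then ENNReal.ofReal (Real.exp (j + 1)) else 0)
      = {y | IsYoung c l j y x}.indicator (fun _ => ENNReal.ofReal (Real.exp (j + 1))) y :=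
    fun y => rfl
  simp only [e]
  rw [lintegral_indicator_const (hmj j)]
  refine (mul_le_mul_right (hvoid j) _).trans (le_of_eq ?_)
  rw [← ENNReal.ofReal_mul (by positivity), ← Real.exp_add]
  ring_nf

lemma lintegral_logWeight_le (h : IsPoissonLaw (cutIntensity μ) ν) [IsProbabilityMeasure ν]
    [SFinite μ] (hμ : ∀ l, μ (Iic l) < ∞) {c : ℝ} (hc : 0 < c) {l L : ℝ≥0} {N : ℕ}
    (hl : ENNReal.ofReal (2 * c) ≤ μ (Iic l)) (hl1 : 1 ≤ μ (Iic l)) (hL : μ (Iic L) ≤ 2 ^ N) :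
    ∫⁻ y, logWeight μ c l L y ∂ν ≤ ageBound * (2 * (N + 1)) := by
  have hm : Measurable fun p : (ℕ → ℝ≥0) × ℝ≥0 => ageWeight c l p.1 p.2 :=
    (measurable_ageWeight l).comp (measurable_const.prodMk measurable_id)
  unfold logWeight
  rw [lintegral_lintegral_swap]
  · refine le_trans (lintegral_mono fun x => ?_) ((lintegral_const_mul' _ _ ageBound_ne_top).le.trans
      (mul_le_mul_right (lintegral_inv_measure_Iic_le hl1 hL) _))
    have hmx : Measurable fun y => ageWeight c l y x :=
      hm.comp (measurable_id.prodMk measurable_const)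
    rw [lintegral_mul_const _ hmx]
    gcongr
    exact h.lintegral_ageWeight_le hμ hc hl x
  · exact (hm.mul ((measurable_measure_Iic μ).comp measurable_snd).inv).aemeasurable

end IsPoissonLaw


/-! ### Random glue points -/

lemma measurable_zeroCons {α : Type*} [MeasurableSpace α] {u : α → ℕ → ℝ≥0} (hu : Measurable u)
    (n : ℕ) : Measurable fun a => zeroCons (u a) n := by
  cases n with
  | zero => exact measurable_const
  | succ n => exact (measurable_pi_apply n).comp hu

lemma measurable_stickAux {α : Type*} [MeasurableSpace α] {y z : α → ℕ → ℝ≥0}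
    {b : α → ℝ≥0 → ℝ} {x : α → ℝ≥0} (hy : Measurable y) (hz : Measurable z)
    (hb : Measurable fun p : α × ℝ≥0 => b p.1 p.2) (hx : Measurable x) (n : ℕ) :
    Measurable fun a => stickAux (y a) (z a) (b a) n (x a) := by
  have hbu : ∀ {u : α → ℝ≥0}, Measurable u → Measurable fun a => b a (u a) := fun hu =>
    hb.comp (measurable_id.prodMk hu)
  induction n generalizing x with
  | zero => exact measurable_const
  | succ n ih =>
    exact Measurable.ite (measurableSet_le hx (measurable_zeroCons hy n)) (ih hx)
      (((ih (measurable_zeroCons hz n)).add (hbu hx)).sub (hbu (measurable_zeroCons hy n)))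

/-- With `n` sticks only the glue points of index below `n` matter, so the next glue point is
independent of the tree it is attached to. -/
lemma stickAux_congr_glue {y z z' : ℕ → ℝ≥0} {b : ℝ≥0 → ℝ} {n : ℕ}
    (h : ∀ i < n, zeroCons z i = zeroCons z' i) (x : ℝ≥0) :
    stickAux y z b n x = stickAux y z' b n x := by
  induction n generalizing x with
  | zero => rfl
  | succ n ih =>
    simp only [stickAux, ih fun i hi => h i (hi.trans n.lt_succ_self), h n n.lt_succ_self]

lemma measurable_update_prod (n : ℕ) :
    Measurable fun p : (ℕ → ℝ≥0) × ℝ≥0 => Function.update p.1 n p.2 := by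
  refine measurable_pi_lambda _ fun i => ?_
  rcases eq_or_ne i n with rfl | hi
  · simpa using measurable_snd
  · simp only [Function.update_of_ne hi]
    fun_prop

/-- Resampling one coordinate independently preserves a product measure. This allows one glue point
to be integrated separately from the others. -/
lemma infinitePi_eq_map_update (ρ : ℕ → Measure ℝ≥0) [∀ i, IsProbabilityMeasure (ρ i)] (n : ℕ) :
    Measure.infinitePi ρ
      = ((Measure.infinitePi ρ).prod (ρ n)).map fun p => Function.update p.1 n p.2 := by
  have hm := measurable_update_prod n
  symm
  refine Measure.eq_infinitePi _ fun s t ht => ?_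
  rw [Measure.map_apply hm (MeasurableSet.pi s.countable_toSet fun i _ => ht i)]
  by_cases hn : n ∈ s
  · have e : (fun p : (ℕ → ℝ≥0) × ℝ≥0 => Function.update p.1 n p.2) ⁻¹' (Set.pi s t)
        = (Set.pi (s.erase n) t) ×ˢ t n := by
      ext p
      simp only [mem_preimage, Set.mem_pi, mem_prod, Finset.mem_coe, Finset.mem_erase]
      refine ⟨fun h => ⟨fun i hi => ?_, ?_⟩, fun h i hi => ?_⟩
      · simpa [hi.1] using h i hi.2
      · simpa using h n hn
      · rcases eq_or_ne i n with rfl | hin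
        · simpa using h.2
        · simpa [hin] using h.1 i ⟨hin, hi⟩
    rw [e, Measure.prod_prod, Measure.infinitePi_pi _ fun i _ => ht i, mul_comm,
      Finset.mul_prod_erase s (fun i => ρ i (t i)) hn]
  · have e : (fun p : (ℕ → ℝ≥0) × ℝ≥0 => Function.update p.1 n p.2) ⁻¹' (Set.pi s t)
        = (Set.pi s t) ×ˢ univ := by
      ext p
      simp only [mem_preimage, Set.mem_pi, mem_prod, Finset.mem_coe, mem_univ, and_true]
      refine forall₂_congr fun i hi => ?_
      rw [Function.update_of_ne (ne_of_mem_of_not_mem hi hn)]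
    rw [e, Measure.prod_prod, Measure.infinitePi_pi _ fun i _ => ht i, measure_univ, mul_one]

lemma lintegral_infinitePi_eval (ρ : ℕ → Measure ℝ≥0) [∀ i, IsProbabilityMeasure (ρ i)] (n : ℕ)
    {f : (ℕ → ℝ≥0) → ℝ≥0 → ℝ≥0∞} (hf : Measurable fun p : (ℕ → ℝ≥0) × ℝ≥0 => f p.1 p.2)
    (hn : ∀ z x t, f (Function.update z n t) x = f z x) :
    ∫⁻ z, f z (z n) ∂Measure.infinitePi ρ = ∫⁻ x, ∫⁻ z, f z x ∂Measure.infinitePi ρ ∂ρ n := by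
  have hm := measurable_update_prod n
  have hf' : Measurable fun z : ℕ → ℝ≥0 => f z (z n) :=
    hf.comp (measurable_id.prodMk (measurable_pi_apply n))
  rw [infinitePi_eq_map_update ρ n, lintegral_map hf' hm]
  simp only [Function.update_self, hn]
  rw [← infinitePi_eq_map_update ρ n, lintegral_prod_symm' _ hf]

section Glue

variable {μ : Measure ℝ≥0} {y : ℕ → ℝ≥0}

lemma isProbabilityMeasure_cond_Iic (hμ : ∀ l, μ (Iic l) < ∞) (hy0 : ∀ i, μ (Iic (y i)) ≠ 0)
    (i : ℕ) : IsProbabilityMeasure (ProbabilityTheory.cond μ (Iic (y i))) :=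
  cond_isProbabilityMeasure_of_finite (hy0 i) (hμ _).ne

/-- The law of the glue points. -/
def glueLaw (μ : Measure ℝ≥0) (y : ℕ → ℝ≥0) : Measure (ℕ → ℝ≥0) :=
  Measure.infinitePi fun i => ProbabilityTheory.cond μ (Iic (y i))

lemma ae_glueLaw_le (hμ : ∀ l, μ (Iic l) < ∞) (hy0 : ∀ i, μ (Iic (y i)) ≠ 0) :
    ∀ᵐ z ∂glueLaw μ y, ∀ i, z i ≤ y i := by
  have := isProbabilityMeasure_cond_Iic hμ hy0
  refine ae_all_iff.2 fun i => ?_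
  have h1 := (measurePreserving_eval_infinitePi
    (fun i => ProbabilityTheory.cond μ (Iic (y i))) i).quasiMeasurePreserving.ae
    (p := fun x => x ≤ y i) (ae_cond_mem measurableSet_Iic)
  exact h1

/-- The exponential moment of the distance from `x` to `[0, l]`. -/
def expDist (μ : Measure ℝ≥0) (y : ℕ → ℝ≥0) (c : ℝ) (l : ℝ≥0) (n : ℕ) (x : ℝ≥0) : ℝ≥0∞ :=
  ∫⁻ z, ENNReal.ofReal (Real.exp (c * stickAux y z (after (fun t => (t : ℝ)) l) n x)) ∂glueLaw μ y

/-- The exponential moment of the distance from the `n`-th glue point to `[0, l]`. -/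
def expDistGlue (μ : Measure ℝ≥0) (y : ℕ → ℝ≥0) (c : ℝ) (l : ℝ≥0) (n : ℕ) : ℝ≥0∞ :=
  ∫⁻ z, ENNReal.ofReal (Real.exp (c * stickAux y z (after (fun t => (t : ℝ)) l) n (zeroCons z n)))
    ∂glueLaw μ y

lemma measurable_exp_stickAux (y : ℕ → ℝ≥0) (c : ℝ) (l : ℝ≥0) (n : ℕ) :
    Measurable fun p : (ℕ → ℝ≥0) × ℝ≥0 => ENNReal.ofReal
      (Real.exp (c * stickAux y p.1 (after (fun t => (t : ℝ)) l) n p.2)) := by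
  refine ((measurable_stickAux measurable_const measurable_fst ?_ measurable_snd n).const_mul
    c).exp.ennreal_ofReal
  unfold after
  fun_prop

lemma expDist_succ_of_le (c : ℝ) (l : ℝ≥0) {n : ℕ} {x : ℝ≥0} (hx : x ≤ zeroCons y n) :
    expDist μ y c l (n + 1) x = expDist μ y c l n x := by
  simp only [expDist, stickAux, hx, if_true]

lemma expDist_succ_of_lt (c : ℝ) (l : ℝ≥0) {n : ℕ} {x : ℝ≥0} (hx : zeroCons y n < x) :
    expDist μ y c l (n + 1) x = expDistGlue μ y c l n
      * ENNReal.ofReal (Real.exp (c * ((max x l : ℝ≥0) - (max (zeroCons y n) l : ℝ≥0)))) := by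
  rw [expDist, expDistGlue, ← lintegral_mul_const]
  · refine lintegral_congr fun z => ?_
    rw [← ENNReal.ofReal_mul (Real.exp_pos _).le, ← Real.exp_add, ← mul_add, stickAux,
      if_neg (not_le.2 hx), add_sub_assoc, after_sub_after]
  · exact (measurable_exp_stickAux y c l n).comp
      (measurable_id.prodMk (measurable_zeroCons measurable_id n))

/-- The glue point is independent of the tree before it and has the normalized law of `μ`. The
product form also covers `n = 0`, where the mass of `{0}` may vanish. -/
lemma expDistGlue_mul (hμ : ∀ l, μ (Iic l) < ∞) (hy0 : ∀ i, μ (Iic (y i)) ≠ 0) (c : ℝ) (l : ℝ≥0)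
    (n : ℕ) : expDistGlue μ y c l n * μ (Iic (zeroCons y n))
      = ∫⁻ x in Iic (zeroCons y n), expDist μ y c l n x ∂μ := by
  have := isProbabilityMeasure_cond_Iic hμ hy0
  cases n with
  | zero =>
    have : IsProbabilityMeasure (glueLaw μ y) := by unfold glueLaw; infer_instance
    simp [expDistGlue, expDist, stickAux]
  | succ n =>
    have h1 : expDistGlue μ y c l (n + 1)
        = ∫⁻ x, expDist μ y c l (n + 1) x ∂ProbabilityTheory.cond μ (Iic (y n)) := by
      refine lintegral_infinitePi_eval (fun i => ProbabilityTheory.cond μ (Iic (y i))) n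
        (f := fun z x => ENNReal.ofReal
          (Real.exp (c * stickAux y z (after (fun t => (t : ℝ)) l) (n + 1) x)))
        (measurable_exp_stickAux y c l (n + 1)) fun z x t => ?_
      rw [stickAux_congr_glue fun i hi => ?_]
      cases i with
      | zero => rfl
      | succ i => exact Function.update_of_ne (by omega) _ _
    rw [h1, ProbabilityTheory.cond, lintegral_smul_measure, smul_eq_mul, mul_comm, ← mul_assoc]
    change μ (Iic (y n)) * _ * _ = _
    rw [ENNReal.mul_inv_cancel (hy0 n) (hμ _).ne, one_mul]
    rfl

lemma zeroCons_mono (hy : StrictMono y) : Monotone (zeroCons y) := by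
  refine monotone_nat_of_le_succ fun n => ?_
  cases n with
  | zero => exact zero_le
  | succ n => exact hy.monotone n.le_succ

/-- The next glue point is `μ`-distributed on `[0, b]`. On `[0, a]` the average is that of the
previous glue point; on the new stick `(a, b]` the distance is that of the previous glue point plus
the length after `l`. Since `μ (Iic x) ≤ μ (Iic b)`, the normalization can be taken at `x`. -/
lemma expDistGlue_succ_le [SFinite μ] (hμ : ∀ l, μ (Iic l) < ∞) (hy0 : ∀ i, μ (Iic (y i)) ≠ 0)
    (hy : StrictMono y) {c : ℝ} (hc : 0 < c) (l : ℝ≥0) (n : ℕ) :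
    expDistGlue μ y c l (n + 1) ≤ expDistGlue μ y c l n * (1 +
      ∫⁻ x in Ioc (zeroCons y n) (zeroCons y (n + 1)) ∩ Ioi l,
        ageWeight c l y x * (μ (Iic x))⁻¹ ∂μ) := by
  have hle := zeroCons_mono hy n.le_succ
  have hgm : Measurable fun x => ageWeight c l y x :=
    (measurable_ageWeight l).comp (measurable_const.prodMk (measurable_const.prodMk measurable_id))
  have hcut : ∀ i, y i ≤ zeroCons y n ∨ zeroCons y (n + 1) ≤ y i := by
    intro i
    rcases lt_or_ge i n with hi | hi
    · left
      obtain ⟨m, rfl⟩ := Nat.exists_eq_succ_of_ne_zero (by omega : n ≠ 0)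
      exact hy.monotone (by omega)
    · exact Or.inr (hy.monotone hi)
  set a := zeroCons y n
  set b := zeroCons y (n + 1) with hb
  have hb0 : μ (Iic b) ≠ 0 := hy0 n
  set Φ := expDistGlue μ y c l n with hΦ
  set E : ℝ≥0 → ℝ≥0∞ := fun x =>
    ENNReal.ofReal (Real.exp (c * ((max x l : ℝ≥0) - (max a l : ℝ≥0)))) with hE
  have hEm : Measurable E := by fun_prop
  have hEle : ∀ x ∈ Ioc a b, E x ≤ 1 + (Ioi l).indicator (fun x => ageWeight c l y x) x := by
    intro x hx
    rcases le_or_gt x l with hxl | hxl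
    · have : E x = 1 := by
        simp only [hE, max_eq_right hxl, max_eq_right (hx.1.le.trans hxl)]
        simp
      rw [this]
      exact le_self_add
    · rw [indicator_of_mem (show x ∈ Ioi l from hxl)]
      exact (exp_le_ageWeight hc l hx.1 fun i => (hcut i).imp id fun h => hx.2.trans h).trans
        le_add_self
  have hmass : μ (Iic a) + μ (Ioc a b) = μ (Iic b) := by
    rw [← measure_union (Iic_disjoint_Ioc le_rfl) measurableSet_Ioc, Iic_union_Ioc_eq_Iic hle]
  have key : expDistGlue μ y c l (n + 1) * μ (Iic b)
      ≤ Φ * (μ (Iic b) + ∫⁻ x in Ioc a b ∩ Ioi l, ageWeight c l y x ∂μ) := by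
    rw [expDistGlue_mul hμ hy0, ← hb, ← Iic_union_Ioc_eq_Iic hle,
      lintegral_union measurableSet_Ioc (Iic_disjoint_Ioc le_rfl),
      setLIntegral_congr_fun measurableSet_Iic fun x hx => expDist_succ_of_le c l hx,
      setLIntegral_congr_fun measurableSet_Ioc fun x hx => expDist_succ_of_lt c l hx.1,
      ← expDistGlue_mul hμ hy0, Iic_union_Ioc_eq_Iic hle, lintegral_const_mul _ hEm, ← mul_add,
      ← hmass, add_assoc]
    refine mul_le_mul_right (add_le_add le_rfl ?_) _
    refine (setLIntegral_mono' measurableSet_Ioc hEle).trans (le_of_eq ?_)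
    rw [lintegral_add_left measurable_const, lintegral_indicator measurableSet_Ioi,
      Measure.restrict_restrict measurableSet_Ioi, inter_comm]
    simp
  have hint : (μ (Iic b))⁻¹ * ∫⁻ x in Ioc a b ∩ Ioi l, ageWeight c l y x ∂μ
      ≤ ∫⁻ x in Ioc a b ∩ Ioi l, ageWeight c l y x * (μ (Iic x))⁻¹ ∂μ := by
    rw [← lintegral_const_mul _ hgm]
    refine setLIntegral_mono' (measurableSet_Ioc.inter measurableSet_Ioi) fun x hx => ?_
    rw [mul_comm]
    exact mul_le_mul_right (ENNReal.inv_le_inv.2 (monotone_measure_Iic μ hx.1.2)) _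
  calc expDistGlue μ y c l (n + 1)
      = (μ (Iic b))⁻¹ * (expDistGlue μ y c l (n + 1) * μ (Iic b)) := by
        rw [mul_comm, mul_assoc, ENNReal.mul_inv_cancel hb0 (hμ _).ne, mul_one]
    _ ≤ (μ (Iic b))⁻¹ * (Φ * (μ (Iic b) + ∫⁻ x in Ioc a b ∩ Ioi l, ageWeight c l y x ∂μ)) :=
        mul_le_mul_right key _
    _ = Φ * ((μ (Iic b))⁻¹ * μ (Iic b)
        + (μ (Iic b))⁻¹ * ∫⁻ x in Ioc a b ∩ Ioi l, ageWeight c l y x ∂μ) := by ring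
    _ ≤ _ := by
        rw [ENNReal.inv_mul_cancel hb0 (hμ _).ne]
        exact mul_le_mul_right (add_le_add le_rfl hint) _

lemma logWeight_mono (μ : Measure ℝ≥0) (c : ℝ) (l : ℝ≥0) {L L' : ℝ≥0} (h : L ≤ L')
    (y : ℕ → ℝ≥0) : logWeight μ c l L y ≤ logWeight μ c l L' y :=
  lintegral_mono_set (Ioc_subset_Ioc_right h)

/-- The recursion yields a product of factors 1 + d, bounded by exp(∑ d). The d are integrals over
disjoint pieces of `(l, L]`, so their sum is at most `logWeight`. -/
lemma expDistGlue_le [SFinite μ] (hμ : ∀ l, μ (Iic l) < ∞) (hy0 : ∀ i, μ (Iic (y i)) ≠ 0)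
    (hy : StrictMono y) {c : ℝ} (hc : 0 < c) {l L : ℝ≥0} (hW : logWeight μ c l L y ≠ ∞) {n : ℕ}
    (hn : zeroCons y n ≤ L) :
    expDistGlue μ y c l n ≤ ENNReal.ofReal (Real.exp (logWeight μ c l L y).toReal) := by
  have hfin : ∀ n, zeroCons y n ≤ L → logWeight μ c l (zeroCons y n) y ≠ ∞ := fun n hn =>
    ne_top_of_le_ne_top hW (logWeight_mono μ c l hn y)
  suffices h : expDistGlue μ y c l n
      ≤ ENNReal.ofReal (Real.exp (logWeight μ c l (zeroCons y n) y).toReal) from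
    h.trans (ENNReal.ofReal_le_ofReal (Real.exp_le_exp.2
      (ENNReal.toReal_mono hW (logWeight_mono μ c l hn y))))
  induction n with
  | zero =>
    have := isProbabilityMeasure_cond_Iic hμ hy0
    have : IsProbabilityMeasure (glueLaw μ y) := by unfold glueLaw; infer_instance
    simp [expDistGlue, stickAux]
  | succ n ih =>
    have hle := zeroCons_mono hy n.le_succ
    have ih' := ih (hle.trans hn)
    set d := ∫⁻ x in Ioc (zeroCons y n) (zeroCons y (n + 1)) ∩ Ioi l,
        ageWeight c l y x * (μ (Iic x))⁻¹ ∂μ with hd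
    have hsplit : logWeight μ c l (zeroCons y (n + 1)) y = logWeight μ c l (zeroCons y n) y + d := by
      rw [logWeight, logWeight, hd, ← lintegral_union (measurableSet_Ioc.inter measurableSet_Ioi)]
      · congr 2
        ext x
        simp only [mem_Ioc, mem_union, mem_inter_iff, mem_Ioi]
        constructor
        · rintro ⟨h1, h2⟩
          rcases le_or_gt x (zeroCons y n) with h | h
          · exact Or.inl ⟨h1, h⟩
          · exact Or.inr ⟨⟨h, h2⟩, h1⟩
        · rintro (⟨h1, h2⟩ | ⟨⟨h1, h2⟩, h3⟩)
          · exact ⟨h1, h2.trans hle⟩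
          · exact ⟨h3, h2⟩
      · refine Set.disjoint_left.2 fun x hx hx' => ?_
        exact not_lt.2 hx.2 hx'.1.1
    have hdfin : d ≠ ∞ := by
      have := hfin (n + 1) hn
      rw [hsplit] at this
      exact (ENNReal.add_ne_top.1 this).2
    rw [hsplit, ENNReal.toReal_add (hfin n (hle.trans hn)) hdfin, Real.exp_add,
      ENNReal.ofReal_mul (Real.exp_pos _).le]
    refine (expDistGlue_succ_le hμ hy0 hy hc l n).trans (mul_le_mul' ih' ?_)
    rw [← hd, ← ENNReal.ofReal_toReal hdfin, ← ENNReal.ofReal_one,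
      ← ENNReal.ofReal_add zero_le_one ENNReal.toReal_nonneg, ENNReal.ofReal_toReal hdfin]
    refine ENNReal.ofReal_le_ofReal ?_
    rw [add_comm]
    exact Real.add_one_le_exp _

lemma expDist_le [SFinite μ] (hμ : ∀ l, μ (Iic l) < ∞) (hy0 : ∀ i, μ (Iic (y i)) ≠ 0)
    (hy : StrictMono y) {c : ℝ} (hc : 0 < c) {l L : ℝ≥0} (hW : logWeight μ c l L y ≠ ∞) {n : ℕ}
    {x : ℝ≥0} (hx : zeroCons y n < x) (hx' : x ≤ zeroCons y (n + 1)) (hxL : x ≤ L) :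
    expDist μ y c l (n + 1) x
      ≤ ENNReal.ofReal (Real.exp (logWeight μ c l L y).toReal) * ageWeight c l y x := by
  rw [expDist_succ_of_lt c l hx]
  refine mul_le_mul' (expDistGlue_le hμ hy0 hy hc hW (hx.le.trans hxL))
    (exp_le_ageWeight hc l hx fun i => ?_)
  rcases lt_or_ge i n with hi | hi
  · left
    obtain ⟨m, rfl⟩ := Nat.exists_eq_succ_of_ne_zero (by omega : n ≠ 0)
    exact hy.monotone (by omega)
  · exact Or.inr (hx'.trans (hy.monotone hi))

end Glue


/-! ### Integration over the successive random inputs -/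

section Disintegration

variable {Ω α β : Type*} [MeasurableSpace Ω] [MeasurableSpace α] [MeasurableSpace β]
  {P : Measure Ω} [IsProbabilityMeasure P]

lemma lintegral_eq_lintegral_condDistrib [StandardBorelSpace β] [Nonempty β] {X : Ω → α} {Y : Ω → β}
    (hX : Measurable X) (hY : Measurable Y) {f : α → β → ℝ≥0∞}
    (hf : Measurable fun p : α × β => f p.1 p.2) :
    ∫⁻ ω, f (X ω) (Y ω) ∂P = ∫⁻ ω, ∫⁻ y, f (X ω) y ∂condDistrib Y X P (X ω) ∂P := by
  have h1 : ∫⁻ ω, f (X ω) (Y ω) ∂P = ∫⁻ p, f p.1 p.2 ∂P.map fun ω => (X ω, Y ω) :=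
    (lintegral_map hf (hX.prodMk hY)).symm
  rw [h1, ← compProd_map_condDistrib hY.aemeasurable, Measure.lintegral_compProd hf,
    lintegral_map hf.lintegral_kernel_prod_right' hX]

lemma ae_of_ae_condDistrib [StandardBorelSpace β] [Nonempty β] {X : Ω → α} {Y : Ω → β}
    (hX : Measurable X) (hY : Measurable Y) {p : α → β → Prop}
    (hp : Measurable fun q : α × β => p q.1 q.2)
    (h : ∀ᵐ ω ∂P, ∀ᵐ y ∂condDistrib Y X P (X ω), p (X ω) y) : ∀ᵐ ω ∂P, p (X ω) (Y ω) := by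
  classical
  have hf : Measurable fun q : α × β => if p q.1 q.2 then (0 : ℝ≥0∞) else 1 :=
    Measurable.ite (measurableSet_setOfPred.2 hp) measurable_const measurable_const
  have h1 : ∫⁻ ω, (if p (X ω) (Y ω) then (0 : ℝ≥0∞) else 1) ∂P = 0 := by
    rw [lintegral_eq_lintegral_condDistrib (f := fun x y => if p x y then (0 : ℝ≥0∞) else 1)
      hX hY hf]
    refine (lintegral_congr_ae (g := fun _ => 0) ?_).trans lintegral_zero
    filter_upwards [h] with ω hω
    refine (lintegral_congr_ae (g := fun _ => 0) ?_).trans lintegral_zero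
    filter_upwards [hω] with y hy
    simp [hy]
  rw [lintegral_eq_zero_iff (by exact hf.comp (hX.prodMk hY))] at h1
  filter_upwards [h1] with ω hω
  by_contra hn
  simp [hn] at hω

lemma lintegral_eq_lintegral_of_indepFun {X : Ω → α} {V : Ω → β} (hX : AEMeasurable X P)
    (hV : Measurable V) (h : IndepFun X V P) {f : α → β → ℝ≥0∞}
    (hf : Measurable fun p : α × β => f p.1 p.2) :
    ∫⁻ ω, f (X ω) (V ω) ∂P = ∫⁻ ω, ∫⁻ ω', f (X ω') (V ω) ∂P ∂P := by
  have h1 : ∫⁻ ω, f (X ω) (V ω) ∂P = ∫⁻ p, f p.1 p.2 ∂P.map fun ω => (X ω, V ω) :=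
    (lintegral_map' hf.aemeasurable (hX.prodMk hV.aemeasurable)).symm
  rw [h1, h.map_prod_eq_prod_map_map hX hV.aemeasurable, lintegral_prod_symm' _ hf,
    lintegral_map hf.lintegral_prod_left' hV]
  refine lintegral_congr fun ω => ?_
  exact lintegral_map' (hf.comp (measurable_id.prodMk measurable_const)).aemeasurable hX

end Disintegration

/-! ### Sampled paths, and sums over glue points and mesh points -/

/-- The value at time `t` of the path with value `w n j` at time `j / 2 ^ n`. -/
@[irreducible] def interp (w : ℕ → ℕ → ℝ) (t : ℝ≥0) : ℝ := liminf (fun n => w n ⌊2 ^ n * t⌋₊) atTop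

/-- Evaluation of a path at a random time is not measurable for the product σ-algebra on all paths.
Countably many samples suffice for a continuous path and make evaluation jointly measurable. -/
lemma measurable_interp {α : Type*} [MeasurableSpace α] {w : α → ℕ → ℕ → ℝ} {t : α → ℝ≥0}
    (hw : Measurable w) (ht : Measurable t) : Measurable fun a => interp (w a) (t a) := by
  unfold interp
  refine Measurable.liminf fun n => ?_
  have h1 : Measurable fun q : (ℕ → ℕ → ℝ) × ℕ => q.1 n q.2 :=
    measurable_from_prod_countable_left fun j =>
      (measurable_pi_apply j).comp (measurable_pi_apply n)
  have h2 : Measurable fun a => ⌊2 ^ n * t a⌋₊ := Nat.measurable_floor.comp (ht.const_mul _)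
  exact h1.comp (hw.prodMk h2)

lemma interp_eq {b : ℝ≥0 → ℝ} (hb : Continuous b) : interp (fun n j => b (j / 2 ^ n)) = b := by
  funext t
  rw [interp]
  exact ((hb.tendsto t).comp (tendsto_dyadicFloor t)).liminf_eq

/-- The dyadic points. -/
def mesh (N j : ℕ) : ℝ≥0 := j / 2 ^ N

open Classical in
/-- The sum of `e (i + 1)` over the `i`-th glue points with `y i < L`, and over the points of
`(0, 2 ^ N]` in the mesh `2 ^ (-N)` with the index of the cut that follows. -/
def pointSum (y z : ℕ → ℝ≥0) (L : ℝ≥0) (N : ℕ) (e : ℕ → ℝ≥0 → ℝ≥0∞) : ℝ≥0∞ :=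
  ∑' i, (if y i < L then e (i + 1) (z i) else 0) + ∑ j ∈ Finset.range (4 ^ N + 1),
    ∑' m, if zeroCons y m < mesh N j ∧ mesh N j ≤ zeroCons y (m + 1)
      then e (m + 1) (mesh N j) else 0

lemma measurable_pointSum {α : Type*} [MeasurableSpace α] {y z : α → ℕ → ℝ≥0} (L : ℝ≥0) (N : ℕ)
    {e : α → ℕ → ℝ≥0 → ℝ≥0∞} (hy : Measurable y) (hz : Measurable z)
    (he : ∀ n, Measurable fun p : α × ℝ≥0 => e p.1 n p.2) :
    Measurable fun a => pointSum (y a) (z a) L N (e a) := by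
  have heu : ∀ n {u : α → ℝ≥0}, Measurable u → Measurable fun a => e a n (u a) := fun n _ hu =>
    (he n).comp (measurable_id.prodMk hu)
  refine Measurable.add (Measurable.tsum fun i => ?_)
    (Finset.measurable_sum _ fun j _ => Measurable.tsum fun m => ?_)
  · exact Measurable.ite (measurableSet_lt ((measurable_pi_apply i).comp hy) measurable_const)
      (heu _ ((measurable_pi_apply i).comp hz)) measurable_const
  · have h1 : MeasurableSet {a | zeroCons (y a) m < mesh N j} :=
      measurableSet_lt (measurable_zeroCons hy m) measurable_const
    have h2 : MeasurableSet {a | mesh N j ≤ zeroCons (y a) (m + 1)} :=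
      measurableSet_le measurable_const (measurable_zeroCons hy (m + 1))
    exact Measurable.ite (h1.inter h2) (heu _ measurable_const) measurable_const

open Classical in
lemma lintegral_pointSum {α : Type*} [MeasurableSpace α] {ρ : Measure α} {y : ℕ → ℝ≥0}
    {z : α → ℕ → ℝ≥0} (L : ℝ≥0) (N : ℕ) {e : α → ℕ → ℝ≥0 → ℝ≥0∞}
    (he : ∀ i, AEMeasurable (fun a => e a (i + 1) (z a i)) ρ)
    (he' : ∀ n x, AEMeasurable (fun a => e a n x) ρ) :
    ∫⁻ a, pointSum y (z a) L N (e a) ∂ρ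
      = ∑' i, (if y i < L then ∫⁻ a, e a (i + 1) (z a i) ∂ρ else 0)
        + ∑ j ∈ Finset.range (4 ^ N + 1),
          ∑' m, if zeroCons y m < mesh N j ∧ mesh N j ≤ zeroCons y (m + 1)
            then ∫⁻ a, e a (m + 1) (mesh N j) ∂ρ else 0 := by
  have h1 : ∀ i, AEMeasurable (fun a => if y i < L then e a (i + 1) (z a i) else 0) ρ := by
    intro i
    split_ifs
    exacts [he i, aemeasurable_const]
  have h2 : ∀ j m, AEMeasurable (fun a => if zeroCons y m < mesh N j ∧
      mesh N j ≤ zeroCons y (m + 1) then e a (m + 1) (mesh N j) else 0) ρ := by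
    intro j m
    split_ifs
    exacts [he' _ _, aemeasurable_const]
  unfold pointSum
  rw [lintegral_add_left' (AEMeasurable.tsum h1), lintegral_tsum h1,
    lintegral_finsetSum' _ fun j _ => AEMeasurable.tsum (h2 j)]
  simp_rw [lintegral_tsum (h2 _)]
  congr 1
  · refine tsum_congr fun i => ?_
    split_ifs <;> simp
  · refine Finset.sum_congr rfl fun j _ => tsum_congr fun m => ?_
    split_ifs <;> simp

lemma le_pointSum_glue {y z : ℕ → ℝ≥0} {L : ℝ≥0} {N : ℕ} {e : ℕ → ℝ≥0 → ℝ≥0∞} {i : ℕ}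
    (hi : y i < L) : e (i + 1) (z i) ≤ pointSum y z L N e := by
  refine le_trans (le_trans ?_ (ENNReal.le_tsum i)) le_self_add
  rw [if_pos hi]

lemma le_pointSum_mesh {y z : ℕ → ℝ≥0} {L : ℝ≥0} {N : ℕ} {e : ℕ → ℝ≥0 → ℝ≥0∞} {j m : ℕ}
    (hj : j ≤ 4 ^ N) (h : zeroCons y m < mesh N j) (h' : mesh N j ≤ zeroCons y (m + 1)) :
    e (m + 1) (mesh N j) ≤ pointSum y z L N e := by
  refine le_trans (le_trans (le_trans ?_ (ENNReal.le_tsum m))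
    (Finset.single_le_sum (f := fun j : ℕ => ∑' m, if zeroCons y m < mesh N j ∧
      mesh N j ≤ zeroCons y (m + 1) then e (m + 1) (mesh N j) else 0) (fun _ _ => zero_le)
      (Finset.mem_range.2 (Nat.lt_succ_of_le hj)))) le_add_self
  rw [if_pos ⟨h, h'⟩]

lemma tsum_ite_lt_eq_count (y : ℕ → ℝ≥0) (L : ℝ≥0) (a : ℝ≥0∞) :
    ∑' i, (if y i < L then a else 0) = a * count (Iio L) y := by
  have h1 : ∑' i, (if y i < L then a else 0) = ∑' _ : {i | y i < L}, a := by
    rw [tsum_subtype {i | y i < L} fun _ => a]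
    rfl
  rw [h1, ENNReal.tsum_set_const, mul_comm]
  rfl

lemma tsum_ite_cut_le {y : ℕ → ℝ≥0} (hy : StrictMono y) (x : ℝ≥0) (a : ℝ≥0∞) :
    ∑' m, (if zeroCons y m < x ∧ x ≤ zeroCons y (m + 1) then a else 0) ≤ a := by
  by_cases h : ∃ m, zeroCons y m < x ∧ x ≤ zeroCons y (m + 1)
  · obtain ⟨m, hm⟩ := h
    rw [tsum_eq_single m, if_pos hm]
    intro m' hm'
    rw [if_neg]
    rintro ⟨h1, h2⟩
    rcases lt_or_gt_of_ne hm' with hlt | hlt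
    · exact absurd (h2.trans (zeroCons_mono hy hlt)) (not_le.2 hm.1)
    · exact absurd (hm.2.trans (zeroCons_mono hy hlt)) (not_le.2 h1)
  · push Not at h
    have : ∀ m, ¬ (zeroCons y m < x ∧ x ≤ zeroCons y (m + 1)) := fun m hm =>
      absurd hm.2 (not_le.2 (h m hm.1))
    simp [this]


/-! ### Moments at a given scale -/

section Level

/-- Half of the mass of `[0, scale k]`. -/
def rate (θ : ℕ → ℝ≥0) (k : ℕ) (x : ℕ → ℝ≥0) : ℝ := (massMeasure θ x (Iic (scale k))).toReal / 2

/-- `logWeight` between the scales `k` and `k + 1`. -/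
def scaleLogWeight (θ : ℕ → ℝ≥0) (k : ℕ) (x y : ℕ → ℝ≥0) : ℝ≥0∞ :=
  logWeight (massMeasure θ x) (rate θ k x) (scale k) (scale (k + 1)) y

/-- The exponentials of the field increments between the scales `k` and `k + 1`. -/
def fieldEnergy (θ : ℕ → ℝ≥0) (k : ℕ) (x y z : ℕ → ℝ≥0) (b : ℝ≥0 → ℝ) : ℝ≥0∞ :=
  pointSum y z (scale (k + 1)) (2 ^ (k + 1)) fun n u => ENNReal.ofReal
    (Real.exp (√(2 * rate θ k x) * |stickAux y z (after b (scale k)) n u|))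

/-- The exponentials of the distances to `[0, scale k]`. -/
def distEnergy (θ : ℕ → ℝ≥0) (k : ℕ) (x y z : ℕ → ℝ≥0) : ℝ≥0∞ :=
  pointSum y z (scale (k + 1)) (2 ^ (k + 1)) fun n u => ENNReal.ofReal
    (Real.exp (rate θ k x * stickAux y z (after (fun t => (t : ℝ)) (scale k)) n u))

/-- The number of cuts and the exponentials of the distances to the last cuts. -/
def cutEnergy (θ : ℕ → ℝ≥0) (k : ℕ) (x y : ℕ → ℝ≥0) : ℝ≥0∞ :=
  count (Iio (scale (k + 1))) y + ∑ j ∈ Finset.range (4 ^ 2 ^ (k + 1) + 1),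
    ageWeight (rate θ k x) (scale k) y (mesh (2 ^ (k + 1)) j)

/-- The masses of `[0, scale k]` and `[0, scale (k + 1)]` are not exceptional. -/
def goodMass (θ : ℕ → ℝ≥0) (m : ℝ) (k : ℕ) : Set (ℕ → ℝ≥0) :=
  {x | ENNReal.ofReal (m / 2) ≤ massMeasure θ x (Iic (scale k)) ∧
    massMeasure θ x (Iic (scale (k + 1))) ≤ (scale (k + 1) : ℝ≥0∞) ^ 2}

variable {θ : ℕ → ℝ≥0} {k : ℕ}

lemma rate_nonneg (x : ℕ → ℝ≥0) : 0 ≤ rate θ k x := div_nonneg ENNReal.toReal_nonneg zero_le_two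

lemma ofReal_two_mul_rate {x : ℕ → ℝ≥0} (h : massMeasure θ x (Iic (scale k)) < ∞) :
    ENNReal.ofReal (2 * rate θ k x) = massMeasure θ x (Iic (scale k)) := by
  rw [rate, mul_div_cancel₀ _ two_ne_zero, ENNReal.ofReal_toReal h.ne]

lemma one_le_of_mem_goodMass {m : ℝ} (hm : 4 ≤ m) {x : ℕ → ℝ≥0} (hx : x ∈ goodMass θ m k) :
    1 ≤ massMeasure θ x (Iic (scale k)) := by
  refine le_trans ?_ hx.1
  rw [ENNReal.one_le_ofReal]
  linarith

lemma rate_pos {m : ℝ} (hm : 4 ≤ m) {x : ℕ → ℝ≥0} (hx : x ∈ goodMass θ m k)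
    (h : massMeasure θ x (Iic (scale k)) < ∞) : 0 < rate θ k x := by
  have h1 := one_le_of_mem_goodMass hm hx
  refine div_pos (ENNReal.toReal_pos ?_ h.ne) two_pos
  exact (zero_lt_one.trans_le h1).ne'

lemma measurable_massMeasure_Iic {α : Type*} [MeasurableSpace α] {x : α → ℕ → ℝ≥0} {l : α → ℝ≥0}
    (θ : ℕ → ℝ≥0) (hx : Measurable x) (hl : Measurable l) :
    Measurable fun a => massMeasure θ (x a) (Iic (l a)) := by
  classical
  simp_rw [massMeasure_apply θ _ measurableSet_Iic, lebesgue_Iic]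
  have h0 : Measurable fun a => ((θ 0 ^ 2 : ℝ≥0) : ℝ≥0∞) * (l a : ℝ≥0∞) :=
    hl.coe_nnreal_ennreal.const_mul _
  refine Measurable.add h0 (Measurable.tsum fun i => Measurable.const_mul ?_ _)
  have h : MeasurableSet {a | x a i ≤ l a} := measurableSet_le ((measurable_pi_apply i).comp hx) hl
  exact Measurable.ite h measurable_const measurable_const

lemma measurable_rate (θ : ℕ → ℝ≥0) (k : ℕ) : Measurable (rate θ k) :=
  (measurable_massMeasure_Iic θ measurable_id measurable_const).ennreal_toReal.div_const 2

lemma measurableSet_goodMass (θ : ℕ → ℝ≥0) (m : ℝ) (k : ℕ) : MeasurableSet (goodMass θ m k) := by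
  have h1 : MeasurableSet {x : ℕ → ℝ≥0 |
      ENNReal.ofReal (m / 2) ≤ massMeasure θ x (Iic (scale k))} :=
    measurableSet_le measurable_const (measurable_massMeasure_Iic θ measurable_id measurable_const)
  have h2 : MeasurableSet {x : ℕ → ℝ≥0 |
      massMeasure θ x (Iic (scale (k + 1))) ≤ (scale (k + 1) : ℝ≥0∞) ^ 2} :=
    measurableSet_le (measurable_massMeasure_Iic θ measurable_id measurable_const) measurable_const
  exact h1.inter h2

lemma measurable_scaleLogWeight (θ : ℕ → ℝ≥0) (k : ℕ) :
    Measurable fun p : (ℕ → ℝ≥0) × (ℕ → ℝ≥0) => scaleLogWeight θ k p.1 p.2 := by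
  let h : ((ℕ → ℝ≥0) × (ℕ → ℝ≥0)) × ℝ≥0 → ℝ≥0∞ := fun q =>
    (univ ×ˢ Ioc (scale k) (scale (k + 1))).indicator
      (fun q => ageWeight (rate θ k q.1.1) (scale k) q.1.2 q.2 * (massMeasure θ q.1.1 (Iic q.2))⁻¹) q
  have hm : Measurable h := by
    refine Measurable.indicator ?_ (MeasurableSet.univ.prod measurableSet_Ioc)
    have h1 : Measurable fun q : ((ℕ → ℝ≥0) × (ℕ → ℝ≥0)) × ℝ≥0 =>
        ageWeight (rate θ k q.1.1) (scale k) q.1.2 q.2 :=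
      (measurable_ageWeight (scale k)).comp
        (((measurable_rate θ k).comp (measurable_fst.comp measurable_fst)).prodMk
          ((measurable_snd.comp measurable_fst).prodMk measurable_snd))
    have h2 : Measurable fun q : ((ℕ → ℝ≥0) × (ℕ → ℝ≥0)) × ℝ≥0 => massMeasure θ q.1.1 (Iic q.2) :=
      measurable_massMeasure_Iic θ (measurable_fst.comp measurable_fst) measurable_snd
    exact h1.mul h2.inv
  -- The integrating measure depends on the parameter; splitting it into its Lebesgue part and its
  -- atoms leaves a fixed measure and evaluations.
  have e : ∀ p : (ℕ → ℝ≥0) × (ℕ → ℝ≥0), scaleLogWeight θ k p.1 p.2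
      = (θ 0 ^ 2 : ℝ≥0) * ∫⁻ t, h (p, t) ∂lebesgue + ∑' i, (θ (i + 1) : ℝ≥0∞) * h (p, p.1 i) := by
    intro p
    rw [scaleLogWeight, logWeight, ← lintegral_indicator measurableSet_Ioc,
      ← lintegral_massMeasure θ p.1 (f := fun t => h (p, t))
        (hm.comp (measurable_const.prodMk measurable_id))]
    refine lintegral_congr fun t => ?_
    simp [h, indicator_apply]
  simp_rw [e]
  refine Measurable.add (hm.lintegral_prod_right'.const_mul _)
    (Measurable.tsum fun i => Measurable.const_mul ?_ _)
  exact hm.comp (measurable_id.prodMk ((measurable_pi_apply i).comp measurable_fst))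

lemma measurable_fieldEnergy {α : Type*} [MeasurableSpace α] {x y z : α → ℕ → ℝ≥0}
    {b : α → ℝ≥0 → ℝ} (θ : ℕ → ℝ≥0) (k : ℕ) (hx : Measurable x) (hy : Measurable y)
    (hz : Measurable z) (hb : Measurable fun p : α × ℝ≥0 => b p.1 p.2) :
    Measurable fun a => fieldEnergy θ k (x a) (y a) (z a) (b a) := by
  refine measurable_pointSum _ _ hy hz fun n => ?_
  have h1 : Measurable fun p : α × ℝ≥0 => rate θ k (x p.1) :=
    (measurable_rate θ k).comp (hx.comp measurable_fst)
  have h2 : Measurable fun p : α × ℝ≥0 =>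
      stickAux (y p.1) (z p.1) (after (b p.1) (scale k)) n p.2 := by
    refine measurable_stickAux (hy.comp measurable_fst) (hz.comp measurable_fst) ?_
      measurable_snd n
    unfold after
    exact (hb.comp ((measurable_fst.comp measurable_fst).prodMk measurable_snd)).sub
      (hb.comp ((measurable_fst.comp measurable_fst).prodMk (measurable_snd.min measurable_const)))
  have h3 : Measurable fun p : α × ℝ≥0 =>
      |stickAux (y p.1) (z p.1) (after (b p.1) (scale k)) n p.2| := h2.abs
  fun_prop

lemma measurable_distEnergy {α : Type*} [MeasurableSpace α] {x y z : α → ℕ → ℝ≥0}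
    (θ : ℕ → ℝ≥0) (k : ℕ) (hx : Measurable x) (hy : Measurable y) (hz : Measurable z) :
    Measurable fun a => distEnergy θ k (x a) (y a) (z a) := by
  refine measurable_pointSum _ _ hy hz fun n => ?_
  have h1 : Measurable fun p : α × ℝ≥0 => rate θ k (x p.1) :=
    (measurable_rate θ k).comp (hx.comp measurable_fst)
  have h2 : Measurable fun p : α × ℝ≥0 =>
      stickAux (y p.1) (z p.1) (after (fun t => (t : ℝ)) (scale k)) n p.2 := by
    refine measurable_stickAux (hy.comp measurable_fst) (hz.comp measurable_fst) ?_
      measurable_snd n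
    unfold after
    fun_prop
  fun_prop

open Classical in
lemma cutEnergy_eq (θ : ℕ → ℝ≥0) (k : ℕ) (x y : ℕ → ℝ≥0) :
    cutEnergy θ k x y = ∑' i, (if y i < scale (k + 1) then 1 else 0)
      + ∑ j ∈ Finset.range (4 ^ 2 ^ (k + 1) + 1),
        ageWeight (rate θ k x) (scale k) y (mesh (2 ^ (k + 1)) j) := by
  rw [cutEnergy, tsum_ite_lt_eq_count, one_mul]

lemma measurable_cutEnergy (θ : ℕ → ℝ≥0) (k : ℕ) :
    Measurable fun p : (ℕ → ℝ≥0) × (ℕ → ℝ≥0) => cutEnergy θ k p.1 p.2 := by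
  classical
  simp_rw [cutEnergy_eq]
  refine Measurable.add (Measurable.tsum fun i => ?_) (Finset.measurable_sum _ fun j _ => ?_)
  · exact Measurable.ite (measurableSet_lt (by fun_prop) measurable_const) measurable_const
      measurable_const
  · exact (measurable_ageWeight (scale k)).comp (((measurable_rate θ k).comp measurable_fst).prodMk
      (measurable_snd.prodMk measurable_const))

lemma mesh_le_scale {j : ℕ} (hj : j ≤ 4 ^ 2 ^ (k + 1)) : mesh (2 ^ (k + 1)) j ≤ scale (k + 1) := by
  rw [mesh, scale, div_le_iff₀ (by positivity), ← mul_pow]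
  norm_num
  exact_mod_cast hj

/-- Integration over the Brownian motion. -/
lemma lintegral_fieldEnergy_le {Ω : Type*} [MeasurableSpace Ω] {P : Measure Ω}
    {B : ℝ≥0 → Ω → ℝ} (hB : IsPreBrownianReal B P) (x : ℕ → ℝ≥0) (S : Sticks) :
    ∫⁻ ω, fieldEnergy θ k x S.y S.z (fun t => B t ω) ∂P ≤ 2 * distEnergy θ k x S.y S.z := by
  classical
  have hB' := hB.aemeasurable
  have hm : ∀ n u, AEMeasurable (fun ω => stickAux S.y S.z
      (after (fun t => B t ω) (scale k)) n u) P := by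
    intro n
    induction n with
    | zero => exact fun u => aemeasurable_const
    | succ n ih =>
      intro u
      simp only [stickAux]
      split_ifs
      · exact ih u
      · unfold after at ih ⊢
        exact ((ih _).add ((hB' _).sub (hB' _))).sub ((hB' _).sub (hB' _))
  have hme : ∀ n u, AEMeasurable (fun ω => ENNReal.ofReal (Real.exp (√(2 * rate θ k x)
      * |stickAux S.y S.z (after (fun t => B t ω) (scale k)) n u|))) P := fun n u =>
    ((continuous_abs.measurable.comp_aemeasurable (hm n u)).const_mul _).exp.ennreal_ofReal
  have hle : ∀ n, ∀ u ≤ S.cut n, ∫⁻ ω, ENNReal.ofReal (Real.exp (√(2 * rate θ k x)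
      * |stickAux S.y S.z (after (fun t => B t ω) (scale k)) n u|)) ∂P
      ≤ 2 * ENNReal.ofReal (Real.exp (rate θ k x
        * stickAux S.y S.z (after (fun t => (t : ℝ)) (scale k)) n u)) := by
    intro n u hu
    -- With s = √(2c) the Gaussian exponent s²/2 is exactly the rate c used for distances.
    have h1 := S.lintegral_exp_abs_field_le hB (√(2 * rate θ k x)) (scale k) u
    rw [Real.sq_sqrt (mul_nonneg zero_le_two (rate_nonneg x)), mul_div_cancel_left₀ _ two_ne_zero]
      at h1
    simpa only [S.field_eq_stickAux _ hu] using h1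
  unfold fieldEnergy distEnergy
  rw [lintegral_pointSum (z := fun _ => S.z) _ _ (fun i => hme _ _) hme, pointSum, mul_add,
    ← ENNReal.tsum_mul_left, Finset.mul_sum]
  simp_rw [← ENNReal.tsum_mul_left, mul_ite, mul_zero]
  refine add_le_add (ENNReal.tsum_le_tsum fun i => ?_)
    (Finset.sum_le_sum fun j _ => ENNReal.tsum_le_tsum fun m => ?_)
  · split_ifs
    · exact hle (i + 1) _ (S.z_le_y i)
    · exact le_rfl
  · split_ifs with h
    · exact hle (m + 1) _ h.2
    · exact le_rfl

/-- Integration over the glue points. -/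
lemma lintegral_distEnergy_le {x y : ℕ → ℝ≥0} (hμ : ∀ l, massMeasure θ x (Iic l) < ∞)
    (hy0 : ∀ i, massMeasure θ x (Iic (y i)) ≠ 0) (hy : StrictMono y) (hc : 0 < rate θ k x)
    (hW : scaleLogWeight θ k x y ≠ ∞) :
    ∫⁻ z, distEnergy θ k x y z ∂glueLaw (massMeasure θ x) y
      ≤ ENNReal.ofReal (Real.exp (scaleLogWeight θ k x y).toReal) * cutEnergy θ k x y := by
  classical
  have hme := measurable_exp_stickAux y (rate θ k x) (scale k)
  have h0 := lintegral_pointSum (ρ := glueLaw (massMeasure θ x) y) (y := y) (z := fun z => z)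
    (e := fun z n u => ENNReal.ofReal
      (Real.exp (rate θ k x * stickAux y z (after (fun t => (t : ℝ)) (scale k)) n u)))
    (scale (k + 1)) (2 ^ (k + 1)) (fun i => ((hme (i + 1)).comp
      (measurable_id.prodMk (measurable_pi_apply i))).aemeasurable)
    fun n u => ((hme n).comp (measurable_id.prodMk measurable_const)).aemeasurable
  refine (le_of_eq h0).trans ?_
  rw [cutEnergy_eq, mul_add, ← ENNReal.tsum_mul_left, Finset.mul_sum]
  refine add_le_add (ENNReal.tsum_le_tsum fun i => ?_) (Finset.sum_le_sum fun j hj => ?_)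
  · split_ifs with h
    · rw [mul_one]
      exact expDistGlue_le hμ hy0 hy hc hW (n := i + 1) h.le
    · exact zero_le
  · have hjs := mesh_le_scale (Nat.le_of_lt_succ (Finset.mem_range.1 hj))
    refine le_trans (ENNReal.tsum_le_tsum fun m => ?_) (tsum_ite_cut_le hy (mesh (2 ^ (k + 1)) j) _)
    split_ifs with h
    · exact expDist_le hμ hy0 hy hc hW h.1 h.2 hjs
    · exact le_rfl

/-- Integration over the cuts. -/
lemma lintegral_cutEnergy_le {x : ℕ → ℝ≥0} (hμ : ∀ l, massMeasure θ x (Iic l) < ∞)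
    (hc : 0 < rate θ k x) {ν : Measure (ℕ → ℝ≥0)} [IsProbabilityMeasure ν]
    (hν : IsPoissonLaw (cutIntensity (massMeasure θ x)) ν)
    (hx : massMeasure θ x (Iic (scale (k + 1))) ≤ (scale (k + 1) : ℝ≥0∞) ^ 2) :
    ∫⁻ y, cutEnergy θ k x y ∂ν ≤ (1 + 2 * ageBound) * (scale k : ℝ≥0∞) ^ 6 := by
  classical
  have hsub : Iio (scale (k + 1)) ⊆ Iic (scale (k + 1)) := Iio_subset_Iic_self
  have hΛ := cutIntensity_le (μ := massMeasure θ x) hsub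
  have hΛ' : cutIntensity (massMeasure θ x) (Iio (scale (k + 1))) ≠ ∞ :=
    ne_top_of_le_ne_top (ENNReal.mul_ne_top ENNReal.coe_ne_top (hμ _).ne) hΛ
  have ham : ∀ j : ℕ, Measurable fun y =>
      ageWeight (rate θ k x) (scale k) y (mesh (2 ^ (k + 1)) j) := fun j =>
    (measurable_ageWeight (scale k)).comp
      (measurable_const.prodMk (measurable_id.prodMk measurable_const))
  have hs1 : (1 : ℝ≥0∞) ≤ scale k := by exact_mod_cast one_le_scale k
  have hs : (scale (k + 1) : ℝ≥0∞) = (scale k : ℝ≥0∞) ^ 2 := by rw [scale_succ]; simp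
  unfold cutEnergy
  rw [lintegral_add_right _ (Finset.measurable_sum _ fun j _ => ham j),
    hν.lintegral_count measurableSet_Iio hΛ', lintegral_finsetSum _ fun j _ => ham j, add_mul,
    one_mul]
  -- The mesh has l_{k+1}² = l_k⁴ points besides 0; the mean number of cuts is at most l_{k+1} ·
  -- l_{k+1}² = l_k⁶.
  have e : ((4 ^ 2 ^ (k + 1) : ℕ) : ℝ≥0∞) = (scale k : ℝ≥0∞) ^ 4 := by
    rw [show (scale k : ℝ≥0∞) ^ 4 = (scale (k + 1) : ℝ≥0∞) ^ 2 by rw [hs]; ring, scale]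
    push_cast
    rw [← pow_mul, mul_comm, pow_mul]
    norm_num
  generalize 4 ^ 2 ^ (k + 1) = K at e
  refine add_le_add (hΛ.trans ((mul_le_mul_right hx _).trans (le_of_eq ?_))) ?_
  · rw [hs]
    ring
  · refine (Finset.sum_le_sum fun j _ =>
      hν.lintegral_ageWeight_le hμ hc (ofReal_two_mul_rate (hμ _)).le _).trans ?_
    rw [Finset.sum_const, Finset.card_range, nsmul_eq_mul, mul_comm, mul_comm 2, mul_assoc]
    refine mul_le_mul_right ?_ _
    rw [Nat.cast_add, e, two_mul, Nat.cast_one]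
    exact add_le_add (pow_le_pow_right₀ hs1 (by norm_num)) (one_le_pow₀ hs1)

end Level


/-! ### Almost sure properties of the input -/

section Assembly

variable {Ω : Type*} [MeasurableSpace Ω] {P : Measure Ω}

/-- The values of a Brownian motion at the dyadic points. -/
def samples (B : ℝ≥0 → Ω → ℝ) (ω : Ω) (n j : ℕ) : ℝ := B (j / 2 ^ n) ω

lemma aemeasurable_samples {B : ℝ≥0 → Ω → ℝ} (hB : IsBrownianReal B P) :
    AEMeasurable (samples B) P :=
  aemeasurable_pi_lambda _ fun _ => aemeasurable_pi_lambda _ fun _ =>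
    hB.toIsPreBrownianReal.aemeasurable _

lemma indepFun_samples {α : Type*} [MeasurableSpace α] {B : ℝ≥0 → Ω → ℝ} {V : Ω → α}
    (h : IndepFun (fun ω t => B t ω) V P) : IndepFun (samples B) V P := by
  have hφ : Measurable fun (b : ℝ≥0 → ℝ) (n j : ℕ) => b ((j : ℝ≥0) / 2 ^ n) :=
    measurable_pi_lambda _ fun n => measurable_pi_lambda _ fun j => measurable_pi_apply _
  exact h.comp hφ measurable_id

variable [IsProbabilityMeasure P] {θ : ℕ → ℝ≥0} {X Y Z : Ω → ℕ → ℝ≥0} {k : ℕ} {m : ℝ}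

/-- Together with `IsInput.ae_glue_le`, this turns almost every realization into a `Sticks`. -/
lemma IsInput.ae_cuts (h : IsInput P θ X Y Z) (hθ : IsParam θ) :
    ∀ᵐ ω ∂P, StrictMono (Y ω) ∧ Tendsto (Y ω) atTop atTop ∧
      ∀ i, massMeasure θ (X ω) (Iic (Y ω i)) ≠ 0 := by
  refine ae_of_ae_condDistrib (X := X) (Y := Y) (p := fun x y => StrictMono y ∧
    Tendsto y atTop atTop ∧ ∀ i, massMeasure θ x (Iic (y i)) ≠ 0) h.measurable_X h.measurable_Y
    ?_ ?_
  · refine Measurable.and ?_ (Measurable.and ?_ (Measurable.forall fun i => ?_))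
    · have e : ∀ y : ℕ → ℝ≥0, StrictMono y ↔ ∀ i, y i < y (i + 1) := fun y =>
        ⟨fun hy i => hy i.lt_succ_self, strictMono_nat_of_lt_succ⟩
      simp_rw [e]
      exact Measurable.forall fun i => measurableSet_setOfPred.1
        (measurableSet_lt (by fun_prop) (by fun_prop))
    · exact measurableSet_setOfPred.1 (measurableSet_tendsto (l := atTop) (l' := atTop)
        (f := fun i (p : (ℕ → ℝ≥0) × (ℕ → ℝ≥0)) => p.2 i) fun i => by fun_prop)
    · exact measurableSet_setOfPred.1 ((measurable_massMeasure_Iic θ measurable_fst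
        ((measurable_pi_apply i).comp measurable_snd)) (measurableSet_singleton 0).compl)
  · filter_upwards [h.law_Y, h.ae_massMeasure_lt_top hθ] with ω hω hω'
    filter_upwards [hω.strictMono, hω.ae_tendsto hω', hω.ae_measure_Iic_ne_zero] with y h1 h2 h3
    exact ⟨h1, h2, h3⟩

lemma IsInput.ae_glue_le (h : IsInput P θ X Y Z) (hθ : IsParam θ) :
    ∀ᵐ ω ∂P, ∀ i, Z ω i ≤ Y ω i := by
  refine ae_of_ae_condDistrib (X := fun ω => (X ω, Y ω)) (Y := Z)
    (p := fun (q : (ℕ → ℝ≥0) × (ℕ → ℝ≥0)) z => ∀ i, z i ≤ q.2 i)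
    (h.measurable_X.prodMk h.measurable_Y) h.measurable_Z ?_ ?_
  · exact Measurable.forall fun i => measurableSet_setOfPred.1
      (measurableSet_le (by fun_prop) (by fun_prop))
  · filter_upwards [h.law_Z, h.ae_cuts hθ, h.ae_massMeasure_lt_top hθ] with ω hω hω' hμ
    rw [hω]
    exact ae_glueLaw_le hμ hω'.2.2

/-! ### The moments of the input at a given scale -/

open Classical in
/-- `scaleLogWeight` on the event that the masses are not exceptional. -/
def goodLogWeight (θ : ℕ → ℝ≥0) (m : ℝ) (k : ℕ) (x y : ℕ → ℝ≥0) : ℝ≥0∞ :=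
  if x ∈ goodMass θ m k then scaleLogWeight θ k x y else 0

open Classical in
/-- The normalization of `fieldEnergy`. -/
def goodWeight (θ : ℕ → ℝ≥0) (m : ℝ) (k : ℕ) (x y : ℕ → ℝ≥0) : ℝ≥0∞ :=
  if x ∈ goodMass θ m k then ENNReal.ofReal (Real.exp (-(scaleLogWeight θ k x y).toReal)) else 0

lemma measurable_goodLogWeight (θ : ℕ → ℝ≥0) (m : ℝ) (k : ℕ) :
    Measurable fun p : (ℕ → ℝ≥0) × (ℕ → ℝ≥0) => goodLogWeight θ m k p.1 p.2 := by
  classical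
  exact Measurable.ite ((measurableSet_goodMass θ m k).preimage measurable_fst)
    (measurable_scaleLogWeight θ k) measurable_const

lemma measurable_goodWeight {α : Type*} [MeasurableSpace α] {x y : α → ℕ → ℝ≥0} (θ : ℕ → ℝ≥0)
    (m : ℝ) (k : ℕ) (hx : Measurable x) (hy : Measurable y) :
    Measurable fun a => goodWeight θ m k (x a) (y a) := by
  classical
  have h1 := (measurable_scaleLogWeight θ k).comp (hx.prodMk hy)
  exact Measurable.ite ((measurableSet_goodMass θ m k).preimage hx)
    h1.ennreal_toReal.neg.exp.ennreal_ofReal measurable_const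

/-- On the good event μ[0, l_{k+1}] ≤ l_{k+1}² = 2^(2^(k + 2)), whose binary logarithm gives the
order 2^k. -/
lemma lintegral_scaleLogWeight_le {x : ℕ → ℝ≥0} (hμ : ∀ l, massMeasure θ x (Iic l) < ∞)
    (hm : 4 ≤ m) (hx : x ∈ goodMass θ m k) {ν : Measure (ℕ → ℝ≥0)} [IsProbabilityMeasure ν]
    (hν : IsPoissonLaw (cutIntensity (massMeasure θ x)) ν) :
    ∫⁻ y, scaleLogWeight θ k x y ∂ν ≤ ageBound * (2 * ((2 ^ (k + 2) : ℕ) + 1)) := by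
  refine hν.lintegral_logWeight_le hμ (rate_pos hm hx (hμ _)) (ofReal_two_mul_rate (hμ _)).le
    (one_le_of_mem_goodMass hm hx) (hx.2.trans (le_of_eq ?_))
  rw [scale, pow_succ 2 (k + 1), pow_mul]
  simp

lemma IsInput.lintegral_goodLogWeight_le (h : IsInput P θ X Y Z) (hθ : IsParam θ) (hm : 4 ≤ m) :
    ∫⁻ ω, goodLogWeight θ m k (X ω) (Y ω) ∂P ≤ ageBound * (2 * ((2 ^ (k + 2) : ℕ) + 1)) := by
  rw [lintegral_eq_lintegral_condDistrib h.measurable_X h.measurable_Y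
    (measurable_goodLogWeight θ m k)]
  refine (lintegral_mono_ae (g := fun _ => ageBound * (2 * ((2 ^ (k + 2) : ℕ) + 1))) ?_).trans
    (by simp)
  filter_upwards [h.law_Y, h.ae_massMeasure_lt_top hθ] with ω hω hμ
  by_cases hx : X ω ∈ goodMass θ m k
  · simp only [goodLogWeight, hx, if_true]
    exact lintegral_scaleLogWeight_le hμ hm hx hω
  · simp [goodLogWeight, hx]

lemma IsInput.ae_scaleLogWeight_ne_top (h : IsInput P θ X Y Z) (hθ : IsParam θ) (hm : 4 ≤ m) :
    ∀ᵐ ω ∂P, X ω ∈ goodMass θ m k → scaleLogWeight θ k (X ω) (Y ω) ≠ ∞ := by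
  have h1 := ae_lt_top ((measurable_goodLogWeight θ m k).comp
    (h.measurable_X.prodMk h.measurable_Y)) (ne_top_of_le_ne_top (ENNReal.mul_ne_top
      ageBound_ne_top (by finiteness)) (h.lintegral_goodLogWeight_le hθ hm (k := k)))
  filter_upwards [h1] with ω hω hx
  simpa [goodLogWeight, hx] using hω.ne

lemma IsInput.lintegral_cutEnergy_le (h : IsInput P θ X Y Z) (hθ : IsParam θ) (hm : 4 ≤ m) :
    ∫⁻ ω, (goodMass θ m k).indicator (fun x => cutEnergy θ k x (Y ω)) (X ω) ∂P
      ≤ (1 + 2 * ageBound) * (scale k : ℝ≥0∞) ^ 6 := by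
  have hf : Measurable fun p : (ℕ → ℝ≥0) × (ℕ → ℝ≥0) =>
      (goodMass θ m k).indicator (fun x => cutEnergy θ k x p.2) p.1 := by
    exact (measurable_cutEnergy θ k).indicator
      ((measurableSet_goodMass θ m k).preimage measurable_fst)
  rw [lintegral_eq_lintegral_condDistrib (f := fun x y =>
    (goodMass θ m k).indicator (fun x => cutEnergy θ k x y) x) h.measurable_X h.measurable_Y hf]
  refine (lintegral_mono_ae (g := fun _ => (1 + 2 * ageBound) * (scale k : ℝ≥0∞) ^ 6) ?_).trans
    (by simp)
  filter_upwards [h.law_Y, h.ae_massMeasure_lt_top hθ] with ω hω hμ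
  by_cases hx : X ω ∈ goodMass θ m k
  · simp only [hx, indicator_of_mem]
    exact ICRT.lintegral_cutEnergy_le hμ (rate_pos hm hx (hμ _)) hω hx.2
  · simp [hx]

/-- Only the first moment of `scaleLogWeight` is controlled, not its exponential. The factor
`goodWeight` cancels that exponential before the cuts are integrated, and only `cutEnergy` remains.
-/
lemma IsInput.lintegral_distEnergy_le (h : IsInput P θ X Y Z) (hθ : IsParam θ) (hm : 4 ≤ m) :
    ∫⁻ ω, goodWeight θ m k (X ω) (Y ω) * distEnergy θ k (X ω) (Y ω) (Z ω) ∂P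
      ≤ (1 + 2 * ageBound) * (scale k : ℝ≥0∞) ^ 6 := by
  have hf : Measurable fun p : ((ℕ → ℝ≥0) × (ℕ → ℝ≥0)) × (ℕ → ℝ≥0) =>
      goodWeight θ m k p.1.1 p.1.2 * distEnergy θ k p.1.1 p.1.2 p.2 :=
    (measurable_goodWeight θ m k (measurable_fst.comp measurable_fst)
      (measurable_snd.comp measurable_fst)).mul
      (measurable_distEnergy θ k (measurable_fst.comp measurable_fst)
        (measurable_snd.comp measurable_fst) measurable_snd)
  rw [lintegral_eq_lintegral_condDistrib (X := fun ω => (X ω, Y ω)) (f := fun p z =>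
    goodWeight θ m k p.1 p.2 * distEnergy θ k p.1 p.2 z)
    (h.measurable_X.prodMk h.measurable_Y) h.measurable_Z hf]
  refine (lintegral_mono_ae ?_).trans (h.lintegral_cutEnergy_le hθ hm)
  filter_upwards [h.law_Z, h.ae_cuts hθ, h.ae_massMeasure_lt_top hθ,
    h.ae_scaleLogWeight_ne_top hθ hm] with ω hω hY hμ hW
  by_cases hx : X ω ∈ goodMass θ m k
  · have hd : Measurable fun z => distEnergy θ k (X ω) (Y ω) z :=
      measurable_distEnergy θ k measurable_const measurable_const measurable_id
    rw [lintegral_const_mul _ hd, hω]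
    refine (mul_le_mul_right (ICRT.lintegral_distEnergy_le hμ hY.2.2 hY.1
      (rate_pos hm hx (hμ _)) (hW hx)) _).trans (le_of_eq ?_)
    rw [goodWeight, if_pos hx, ← mul_assoc, ← ENNReal.ofReal_mul (Real.exp_pos _).le,
      ← Real.exp_add]
    simp [hx]
  · simp [goodWeight, hx]

lemma measurable_goodWeight_mul_fieldEnergy (θ : ℕ → ℝ≥0) (m : ℝ) (k : ℕ) :
    Measurable fun p : (ℕ → ℕ → ℝ) × (ℕ → ℝ≥0) × (ℕ → ℝ≥0) × (ℕ → ℝ≥0) =>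
      goodWeight θ m k p.2.1 p.2.2.1 *
        fieldEnergy θ k p.2.1 p.2.2.1 p.2.2.2 (interp p.1) := by
  have hx : Measurable fun p : (ℕ → ℕ → ℝ) × (ℕ → ℝ≥0) × (ℕ → ℝ≥0) × (ℕ → ℝ≥0) => p.2.1 :=
    measurable_fst.comp measurable_snd
  have hy : Measurable fun p : (ℕ → ℕ → ℝ) × (ℕ → ℝ≥0) × (ℕ → ℝ≥0) × (ℕ → ℝ≥0) => p.2.2.1 :=
    measurable_fst.comp (measurable_snd.comp measurable_snd)
  have hz : Measurable fun p : (ℕ → ℕ → ℝ) × (ℕ → ℝ≥0) × (ℕ → ℝ≥0) × (ℕ → ℝ≥0) => p.2.2.2 :=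
    measurable_snd.comp (measurable_snd.comp measurable_snd)
  have h1 : Measurable fun p : (ℕ → ℕ → ℝ) × (ℕ → ℝ≥0) × (ℕ → ℝ≥0) × (ℕ → ℝ≥0) =>
      goodWeight θ m k p.2.1 p.2.2.1 := measurable_goodWeight θ m k hx hy
  exact h1.mul (measurable_fieldEnergy θ k hx hy hz
    (measurable_interp (measurable_fst.comp measurable_fst) measurable_snd))

/-- By independence the Brownian path is integrated first with the tree fixed, which reduces the
field to distances. -/
lemma IsInput.lintegral_fieldEnergy_le (h : IsInput P θ X Y Z) (hθ : IsParam θ) (hm : 4 ≤ m)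
    {B : ℝ≥0 → Ω → ℝ} (hB : IsBrownianReal B P)
    (hBXYZ : IndepFun (fun ω t => B t ω) (fun ω => (X ω, Y ω, Z ω)) P) :
    ∫⁻ ω, goodWeight θ m k (X ω) (Y ω) *
        fieldEnergy θ k (X ω) (Y ω) (Z ω) (interp (samples B ω)) ∂P
      ≤ 2 * ((1 + 2 * ageBound) * (scale k : ℝ≥0∞) ^ 6) := by
  have h0 := lintegral_eq_lintegral_of_indepFun (aemeasurable_samples hB)
    (h.measurable_X.prodMk (h.measurable_Y.prodMk h.measurable_Z)) (indepFun_samples hBXYZ)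
    (f := fun w v => goodWeight θ m k v.1 v.2.1 * fieldEnergy θ k v.1 v.2.1 v.2.2 (interp w))
    (measurable_goodWeight_mul_fieldEnergy θ m k)
  refine (le_of_eq h0).trans ?_
  refine le_trans ?_ (mul_le_mul_right (h.lintegral_distEnergy_le hθ hm) 2)
  rw [← lintegral_const_mul' _ _ ENNReal.ofNat_ne_top]
  refine lintegral_mono_ae ?_
  filter_upwards [h.ae_cuts hθ, h.ae_glue_le hθ] with ω hY hZ
  let S : Sticks := ⟨Y ω, Z ω, hY.1, hY.2.1, hZ⟩
  have h1 : ∫⁻ ω', fieldEnergy θ k (X ω) (Y ω) (Z ω) (interp (samples B ω')) ∂P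
      ≤ 2 * distEnergy θ k (X ω) (Y ω) (Z ω) := by
    refine le_trans (le_of_eq (lintegral_congr_ae ?_))
      (ICRT.lintegral_fieldEnergy_le hB.toIsPreBrownianReal (X ω) S)
    filter_upwards [hB.cont] with ω' hω'
    have e : interp (samples B ω') = fun t => B t ω' := interp_eq hω'
    rw [e]
  have hne : goodWeight θ m k (X ω) (Y ω) ≠ ∞ := by
    unfold goodWeight
    split_ifs <;> simp
  rw [lintegral_const_mul' _ _ hne, mul_left_comm]
  exact mul_le_mul_right h1 _

end Assembly

/-! ### Borel-Cantelli arguments and conclusion -/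

section Conclusion

variable {Ω : Type*} [MeasurableSpace Ω] {P : Measure Ω}

lemma ae_tsum_ne_top_of_tsum_lintegral {f : ℕ → Ω → ℝ≥0∞} (hf : ∀ k, AEMeasurable (f k) P)
    (h : ∑' k, ∫⁻ ω, f k ω ∂P ≠ ∞) : ∀ᵐ ω ∂P, ∑' k, f k ω ≠ ∞ := by
  rw [← lintegral_tsum hf] at h
  filter_upwards [ae_lt_top' (AEMeasurable.tsum hf) h] with ω hω
  exact hω.ne

lemma ae_eventually_le_one_of_tsum_lintegral {f : ℕ → Ω → ℝ≥0∞} (hf : ∀ k, AEMeasurable (f k) P)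
    {K : ℕ} (h : ∑' k, ∫⁻ ω, f (k + K) ω ∂P ≠ ∞) : ∀ᵐ ω ∂P, ∀ᶠ k in atTop, f k ω ≤ 1 := by
  filter_upwards [ae_tsum_ne_top_of_tsum_lintegral (fun k => hf (k + K)) h] with ω hω
  have h1 := (tendsto_add_atTop_iff_nat (f := fun k => f k ω) K).1
    (ENNReal.tendsto_atTop_zero_of_tsum_ne_top hω)
  exact h1.eventually_le_const zero_lt_one

variable [IsProbabilityMeasure P] {θ : ℕ → ℝ≥0} {X Y Z : Ω → ℕ → ℝ≥0} {m : ℕ → ℝ}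

/-- The mean of the k-th weight is of order 2^k, so the series has finite mean by the summability of
2^k/√m_k. -/
lemma IsInput.ae_summable_goodLogWeight (h : IsInput P θ X Y Z) (hθ : IsParam θ)
    (hm : ∀ᶠ k in atTop, 4 ≤ m k) (hs : Summable fun k => 2 ^ k / √(m k)) :
    ∀ᵐ ω ∂P, Summable fun k => (goodLogWeight θ (m k) k (X ω) (Y ω)).toReal / √(m k) := by
  obtain ⟨K, hK⟩ := eventually_atTop.1 hm
  let f : ℕ → Ω → ℝ≥0∞ := fun k ω =>
    ENNReal.ofReal (√(m k))⁻¹ * goodLogWeight θ (m k) k (X ω) (Y ω)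
  have hf0 : ∀ k, Measurable fun ω => goodLogWeight θ (m k) k (X ω) (Y ω) := fun k => by
    have := (measurable_goodLogWeight θ (m k) k).comp (h.measurable_X.prodMk h.measurable_Y)
    exact this
  have hf : ∀ k, Measurable (f k) := fun k => (hf0 k).const_mul _
  have hb : ∀ k, ∫⁻ ω, f (k + K) ω ∂P
      ≤ ageBound * ENNReal.ofReal (10 * (2 ^ (k + K) / √(m (k + K)))) := by
    intro k
    have h1 := h.lintegral_goodLogWeight_le hθ (hK (k + K) (by omega)) (k := k + K)
    simp only [f]
    rw [lintegral_const_mul _ (hf0 _)]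
    refine (mul_le_mul_right h1 _).trans ?_
    rw [mul_left_comm]
    refine mul_le_mul_right ?_ _
    have e : (2 * (((2 ^ (k + K + 2) : ℕ) : ℝ≥0∞) + 1)) ≤ ENNReal.ofReal (10 * 2 ^ (k + K)) := by
      have e1 : (2 * (((2 ^ (k + K + 2) : ℕ) : ℝ≥0∞) + 1))
          = ENNReal.ofReal (2 * (2 ^ (k + K + 2) + 1)) := by
        rw [ENNReal.ofReal_mul zero_le_two, ENNReal.ofReal_add (by positivity) zero_le_one,
          ENNReal.ofReal_pow zero_le_two]
        simp
      rw [e1]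
      refine ENNReal.ofReal_le_ofReal ?_
      have : (1 : ℝ) ≤ 2 ^ (k + K) := one_le_pow₀ one_le_two
      rw [pow_add 2 (k + K) 2]
      linarith
    refine (mul_le_mul_right e _).trans (le_of_eq ?_)
    rw [← ENNReal.ofReal_mul (by positivity)]
    congr 1
    ring
  have hfin : ∑' k, ∫⁻ ω, f (k + K) ω ∂P ≠ ∞ := by
    refine ne_top_of_le_ne_top ?_ (ENNReal.tsum_le_tsum hb)
    rw [ENNReal.tsum_mul_left]
    exact ENNReal.mul_ne_top ageBound_ne_top
      (((summable_nat_add_iff K).2 hs).mul_left 10).tsum_ofReal_ne_top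
  filter_upwards [ae_tsum_ne_top_of_tsum_lintegral (fun k => (hf (k + K)).aemeasurable) hfin]
    with ω hω
  refine (summable_nat_add_iff K).1 ((ENNReal.summable_toReal hω).congr fun k => ?_)
  simp only [f]
  rw [ENNReal.toReal_mul, ENNReal.toReal_ofReal (by positivity), mul_comm, div_eq_mul_inv]

/-- The mean is of order l_k⁶; the two spare powers of l_k make the normalized means summable. -/
lemma IsInput.ae_eventually_fieldEnergy_le (h : IsInput P θ X Y Z) (hθ : IsParam θ)
    (hm : ∀ᶠ k in atTop, 4 ≤ m k) {B : ℝ≥0 → Ω → ℝ} (hB : IsBrownianReal B P)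
    (hBXYZ : IndepFun (fun ω t => B t ω) (fun ω => (X ω, Y ω, Z ω)) P) :
    ∀ᵐ ω ∂P, ∀ᶠ k in atTop, goodWeight θ (m k) k (X ω) (Y ω) *
      fieldEnergy θ k (X ω) (Y ω) (Z ω) (interp (samples B ω)) ≤ (scale k : ℝ≥0∞) ^ 8 := by
  obtain ⟨K, hK⟩ := eventually_atTop.1 hm
  let U : ℕ → Ω → ℝ≥0∞ := fun k ω => goodWeight θ (m k) k (X ω) (Y ω) *
      fieldEnergy θ k (X ω) (Y ω) (Z ω) (interp (samples B ω))
  have hs0 : ∀ k, (scale k : ℝ≥0∞) ≠ 0 := fun k =>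
    (zero_lt_one.trans_le (show (1 : ℝ≥0∞) ≤ scale k by exact_mod_cast one_le_scale k)).ne'
  have hU : ∀ k, AEMeasurable (U k) P := fun k => by
    have := (measurable_goodWeight_mul_fieldEnergy θ (m k) k).comp_aemeasurable
      ((aemeasurable_samples hB).prodMk
        (h.measurable_X.prodMk (h.measurable_Y.prodMk h.measurable_Z)).aemeasurable)
    exact this
  have hb : ∀ k, ∫⁻ ω, ((scale (k + K) : ℝ≥0∞) ^ 8)⁻¹ * U (k + K) ω ∂P
      ≤ 2 * (1 + 2 * ageBound) * ENNReal.ofReal ((1 / 2) ^ k) := by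
    intro k
    rw [lintegral_const_mul'' _ (hU _)]
    refine (mul_le_mul_right (h.lintegral_fieldEnergy_le hθ (hK (k + K) (by omega)) hB hBXYZ)
      _).trans ?_
    have e1 : ((scale (k + K) : ℝ≥0∞) ^ 8)⁻¹ * (scale (k + K) : ℝ≥0∞) ^ 6
        ≤ ENNReal.ofReal ((1 / 2) ^ k) := by
      have e2 : (2 : ℝ≥0∞) ^ k ≤ (scale (k + K) : ℝ≥0∞) ^ 2 := by
        have e3 : (2 : ℝ≥0∞) ^ (k + K) ≤ scale (k + K) := by exact_mod_cast two_pow_le_scale (k + K)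
        refine (pow_le_pow_right₀ one_le_two (Nat.le_add_right k K)).trans (e3.trans ?_)
        exact le_self_pow₀ (by exact_mod_cast one_le_scale (k + K)) two_ne_zero
      rw [show 8 = 2 + 6 by norm_num, pow_add, ENNReal.mul_inv (by simp) (by simp), mul_assoc,
        ENNReal.inv_mul_cancel (pow_ne_zero 6 (hs0 _)) (by simp), mul_one,
        ENNReal.ofReal_pow (by norm_num), one_div, ENNReal.ofReal_inv_of_pos two_pos,
        ENNReal.ofReal_ofNat, ← ENNReal.inv_pow]
      exact ENNReal.inv_le_inv.2 e2
    calc ((scale (k + K) : ℝ≥0∞) ^ 8)⁻¹ * (2 * ((1 + 2 * ageBound) * (scale (k + K) : ℝ≥0∞) ^ 6))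
        = 2 * (1 + 2 * ageBound) *
          (((scale (k + K) : ℝ≥0∞) ^ 8)⁻¹ * (scale (k + K) : ℝ≥0∞) ^ 6) := by ring
      _ ≤ _ := mul_le_mul_right e1 _
  have hfin : ∑' k, ∫⁻ ω, ((scale (k + K) : ℝ≥0∞) ^ 8)⁻¹ * U (k + K) ω ∂P ≠ ∞ := by
    refine ne_top_of_le_ne_top ?_ (ENNReal.tsum_le_tsum hb)
    rw [ENNReal.tsum_mul_left]
    refine ENNReal.mul_ne_top ?_
      (summable_geometric_of_lt_one (by norm_num) (by norm_num)).tsum_ofReal_ne_top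
    exact ENNReal.mul_ne_top ENNReal.ofNat_ne_top (ENNReal.add_ne_top.2
      ⟨ENNReal.one_ne_top, ENNReal.mul_ne_top ENNReal.ofNat_ne_top ageBound_ne_top⟩)
  filter_upwards [ae_eventually_le_one_of_tsum_lintegral
    (f := fun k ω => ((scale k : ℝ≥0∞) ^ 8)⁻¹ * U k ω) (fun k => (hU k).const_mul _) hfin] with ω hω
  filter_upwards [hω] with k hk
  rw [ENNReal.inv_mul_le_iff (pow_ne_zero 8 (hs0 k)) (by simp), mul_one] at hk
  exact hk

/-- A bound for the field increments between the scales `k` and `k + 1`. -/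
def fieldRate (θ : ℕ → ℝ≥0) (m : ℝ) (k : ℕ) (x y : ℕ → ℝ≥0) : ℝ :=
  √2 * ((goodLogWeight θ m k x y).toReal / √m + 8 * (2 ^ k / √m))

lemma scale_pow_eight_le (k : ℕ) : (scale k : ℝ≥0∞) ^ 8 ≤ ENNReal.ofReal (Real.exp (8 * 2 ^ k)) := by
  have h2 : (2 : ℝ) ≤ Real.exp 1 := by
    have := Real.add_one_le_exp 1
    linarith
  have e : (scale k : ℝ≥0∞) = ENNReal.ofReal (2 ^ 2 ^ k) := by
    rw [scale, ENNReal.ofReal_pow zero_le_two]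
    simp
  rw [e, ← ENNReal.ofReal_pow (by positivity)]
  refine ENNReal.ofReal_le_ofReal ?_
  calc ((2 : ℝ) ^ 2 ^ k) ^ 8 ≤ (Real.exp 1 ^ 2 ^ k) ^ 8 := by gcongr
    _ = Real.exp (8 * 2 ^ k) := by
      rw [← Real.exp_nat_mul, ← Real.exp_nat_mul]
      push_cast
      ring_nf

/-- Taking logarithms, √(2c)|D| is at most W plus 8 · 2^k, since l_k⁸ ≤ exp(8 · 2^k). On the good
event 2c ≥ m/2, whence the factor √2/√m. -/
lemma abs_le_fieldRate {x y : ℕ → ℝ≥0} {m : ℝ} {k : ℕ} (hm : 4 ≤ m)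
    (hμ : massMeasure θ x (Iic (scale k)) < ∞) (hx : x ∈ goodMass θ m k) {D : ℝ} {E : ℝ≥0∞}
    (hD : ENNReal.ofReal (Real.exp (√(2 * rate θ k x) * |D|)) ≤ E)
    (hE : goodWeight θ m k x y * E ≤ (scale k : ℝ≥0∞) ^ 8) : |D| ≤ fieldRate θ m k x y := by
  have h1 := ((mul_le_mul_right hD _).trans hE).trans (scale_pow_eight_le k)
  rw [goodWeight, if_pos hx, ← ENNReal.ofReal_mul (Real.exp_pos _).le, ← Real.exp_add,
    ENNReal.ofReal_le_ofReal_iff (Real.exp_pos _).le, Real.exp_le_exp] at h1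
  have h2 : m / 2 ≤ 2 * rate θ k x := by
    have := hx.1
    rwa [← ofReal_two_mul_rate hμ, ENNReal.ofReal_le_ofReal_iff
      (mul_nonneg zero_le_two (rate_nonneg x))] at this
  have h3 : √m / √2 * |D| ≤ √(2 * rate θ k x) * |D| := by
    rw [← Real.sqrt_div (by linarith)]
    exact mul_le_mul_of_nonneg_right (Real.sqrt_le_sqrt h2) (abs_nonneg D)
  have hm0 : 0 < √m := Real.sqrt_pos.2 (by linarith)
  have h4 : |D| ≤ √2 * (((scaleLogWeight θ k x y).toReal + 8 * 2 ^ k) / √m) := by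
    rw [← mul_div_assoc, le_div_iff₀ hm0]
    have h5 : √m / √2 * |D| ≤ (scaleLogWeight θ k x y).toReal + 8 * 2 ^ k := by linarith
    have h6 := mul_le_mul_of_nonneg_left h5 (Real.sqrt_nonneg 2)
    calc |D| * √m = √2 * (√m / √2 * |D|) := by field_simp
      _ ≤ _ := h6
  refine h4.trans (le_of_eq ?_)
  rw [fieldRate, goodLogWeight, if_pos hx]
  ring

lemma abs_field_after_scale_le {x : ℕ → ℝ≥0} (S : Sticks) {b : ℝ≥0 → ℝ} {m ε : ℝ} {k : ℕ}
    (hm : 4 ≤ m) (hμ : massMeasure θ x (Iic (scale k)) < ∞) (hx : x ∈ goodMass θ m k)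
    (hE : goodWeight θ m k x S.y * fieldEnergy θ k x S.y S.z b ≤ (scale k : ℝ≥0∞) ^ 8)
    (hε : ∀ u ≤ (2 : ℝ≥0) ^ 2 ^ (k + 1), |b u - b (dyadicFloor (2 ^ (k + 1)) u)| ≤ ε)
    {u : ℝ≥0} (hu : u ≤ scale (k + 1)) :
    |S.field (after b (scale k)) u| ≤ fieldRate θ m k x S.y + 4 * ε := by
  have hL : scale (k + 1) = 2 ^ 2 ^ (k + 1) := by rw [scale]
  refine S.abs_field_after_le (n := 2 ^ (k + 1)) (L := scale (k + 1)) ?_ (by rwa [hL])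
    (fun i hi => ?_) (fun i j hj hj' hjL => ?_) hu
  · unfold fieldRate
    positivity
  · refine abs_le_fieldRate hm hμ hx ?_ hE
    exact le_pointSum_glue (e := fun n u => ENNReal.ofReal
      (Real.exp (√(2 * rate θ k x) * |stickAux S.y S.z (after b (scale k)) n u|))) hi
  · refine abs_le_fieldRate hm hμ hx ?_ hE
    refine le_pointSum_mesh (e := fun n u => ENNReal.ofReal
      (Real.exp (√(2 * rate θ k x) * |stickAux S.y S.z (after b (scale k)) n u|)))
      (j := ⌊2 ^ 2 ^ (k + 1) * i⌋₊) ?_ hj hj'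
    rw [hL, dyadicFloor, div_le_iff₀ (by positivity), ← mul_pow] at hjL
    norm_num at hjL
    exact_mod_cast hjL

theorem IsInput.ae_exists_continuous_extension (h : IsInput P θ X Y Z) (hθ : IsParam θ)
    {B : ℝ≥0 → Ω → ℝ} (hB : IsBrownianReal B P)
    (hBXYZ : IndepFun (fun ω t => B t ω) (fun ω => (X ω, Y ω, Z ω)) P)
    (hint : ∃ a : ℝ≥0, 0 < a ∧
      ∫⁻ l in Ioi a, ((l : ℝ≥0∞) * meanMass P θ X l ^ (1 / 2 : ℝ))⁻¹ ∂lebesgue < ∞) :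
    ∀ᵐ ω ∂P, ∃ S : Sticks, S.y = Y ω ∧ S.z = Z ω ∧
      ∃ f : S.Tree → ℝ, Continuous f ∧
        ∀ x : ℝ≥0, f (S.toTree x) = S.field (fun t => B t ω) x := by
  obtain ⟨hs, hm⟩ := h.summable_scaleMean hθ hint
  have hm4 : ∀ᶠ k in atTop, 4 ≤ scaleMean P θ X k := by
    filter_upwards [hm, eventually_ge_atTop 1] with k hk hk1
    exact le_trans (le_self_pow₀ (by norm_num) (by omega)) hk
  obtain ⟨ε, hε, hεB⟩ := exists_ae_dyadic_modulus hB
  filter_upwards [h.ae_cuts hθ, h.ae_glue_le hθ, h.ae_massMeasure_lt_top hθ, hB.cont,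
    h.ae_eventually_massMeasure hθ hm, hεB, h.ae_summable_goodLogWeight hθ hm4 hs,
    h.ae_eventually_fieldEnergy_le hθ hm4 hB hBXYZ] with ω hY hZ hμ hb hM hω hW hE
  let S : Sticks := ⟨Y ω, Z ω, hY.1, hY.2.1, hZ⟩
  refine ⟨S, rfl, rfl, S.exists_continuous_extension hb scale_mono tendsto_scale
    (τ := fun k => fieldRate θ (scaleMean P θ X k) k (X ω) (Y ω) + 4 * ε (2 ^ (k + 1))) ?_ ?_⟩
  -- Scale k uses the mesh of index `2 ^ (k + 1)`, so the moduli form a subfamily of a summable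
  -- family.
  · have hinj : Function.Injective fun k : ℕ => 2 ^ (k + 1) := fun i j hij =>
      Nat.succ_injective (Nat.pow_right_injective le_rfl hij)
    exact ((hW.add (hs.mul_left 8)).mul_left _).add ((hε.comp_injective hinj).mul_left 4)
  · have hpow : Tendsto (fun k : ℕ => 2 ^ (k + 1)) atTop atTop :=
      (tendsto_pow_atTop_atTop_of_one_lt one_lt_two).comp (tendsto_add_atTop_nat 1)
    have e : interp (samples B ω) = fun t => B t ω := interp_eq hb
    rw [e] at hE
    -- The mass estimate is used at k for its lower bound and at k + 1 for its upper bound, the two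
    -- halves of `goodMass`.
    filter_upwards [hm4, hM, (tendsto_add_atTop_nat 1).eventually hM, hE, hpow.eventually hω]
      with k h1 h2 h3 h4 h5 u hu
    exact abs_field_after_scale_le S h1 (hμ _) ⟨h2.1, h3.2⟩ h4 h5 hu

end Conclusion

end ICRT

end

theorem mainTheorem7 {Ω : Type*} [MeasurableSpace Ω] (P : Measure Ω) [IsProbabilityMeasure P]
    (θ : ℕ → ℝ≥0) (hθ : ICRT.IsParam θ)
    (X Y Z : Ω → ℕ → ℝ≥0) (hXYZ : ICRT.IsInput P θ X Y Z)
    (B : ℝ≥0 → Ω → ℝ) (hB : IsBrownianReal B P)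
    (hBXYZ : IndepFun (fun ω t => B t ω) (fun ω => (X ω, Y ω, Z ω)) P)
    (hint : ∃ a : ℝ≥0, 0 < a ∧
      ∫⁻ l in Ioi a, ((l : ℝ≥0∞) * ICRT.meanMass P θ X l ^ (1 / 2 : ℝ))⁻¹ ∂ICRT.lebesgue < ∞) :
    ∀ᵐ ω ∂P, ∃ S : ICRT.Sticks, S.y = Y ω ∧ S.z = Z ω ∧
      ∃ f : S.Tree → ℝ, Continuous f ∧
        ∀ x : ℝ≥0, f (S.toTree x) = S.field (fun t => B t ω) x := by
  exact hXYZ.ae_exists_continuous_extension hθ hB hBXYZ hint
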